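/- **Model.** There are $N\ge 1$ sources and one energy-harvesting sensor. Energy units arrive at the sensor as a Poisson process of rate $\lambda_e>0$, data packets of source $j$ (time-stamped with their generation time) as a Poisson process of rate $\lambda_{d,j}>0$; each (instantaneous) transmission attempt is erased with probability $q\in[0,1)$, i.i.d. over attempts; all these are independent. Battery and data buffer have size one, and an attempt empties both. Let $u_j(t)$ be the time-stamp of the latest packet of source $j$ received by time $t$, and $a_j(t)=t-u_j(t)$ its age of information (AoI), with $a_j(0)=0$ for all $j$. Under *maximum-age-first* (MAF) scheduling the buffer accepts only packets of the source of maximum age (ties: smallest index), a new packet preempting an older one. Under the *$\gamma$-threshold policy*, $\gamma\ge 0$, if $e$ and $d$ are the times from the last attempt (or from $t=0$) to the next energy arrival and to the next data arrival of the source of maximum age, then the next attempt takes place $w(\max\{e,d\})$ time units after the last one, where $w(t)=t+\max(\gamma-t,0)$; it sends the freshest packet of that source. Let $s_{0,j}=0$ and let $s_{i,j}$ be the time of the $i$-th successful transmission of source $j$. For $i\ge1$ put $L_{i,j}=s_{i,j}-s_{i-1,j}$ and $Q_{i,j}=\int_{s_{i-1,j}}^{s_{i,j}}a_j(t)\,dt$;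 put $\Delta_{i,j}=a_j(s_{i,j})$. The collective long-term average AoI is $$\overline{\mathrm{AoI}}_{q,N}(\mathrm{MAF},\gamma)=\frac1N\sum_{j=1}^N\limsup_{n\to\infty}\frac{\sum_{i=1}^n\mathbb E[Q_{i,j}]}{\sum_{i=1}^n\mathbb E[L_{i,j}]}.$$ Let $e^{(j)},d^{(j)}$ denote the times $e,d$ above that belong to the first attempt for source $j$ in its $i$-th epoch (measured from the moment the sensor turns to source $j$), and write $\Delta^{(j)}$ for $\Delta_{i,j}$, $i\ge 1$; the expectations below do not depend on $i\ge1$. **Theorem.** All the expectations above and below are finite, for each $j$ the $\limsup$ is a limit, and, with $W_\kappa=w(\max\{e^{(\kappa)},d^{(\kappa)}\})$, $$\overline{\mathrm{AoI}}_{q,N}(\mathrm{MAF},\gamma)=\frac1N\sum_{j=1}^N\mathbb E[\Delta^{(j)}]+\frac{\sum_{\kappa}\mathbb E[W_\kappa^2]}{2\sum_\kappa\mathbb E[W_\kappa]}+\frac{q\sum_\kappa(\mathbb E[W_\kappa])^2}{(1-q)\sum_\kappa\mathbb E[W_\kappa]}+\frac{\sum_{1\le\beta<\alpha\le N}\mathbb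 E[W_\alpha]\,\mathbb E[W_\beta]}{(1-q)\sum_\kappa\mathbb E[W_\kappa]},$$ where, writing $a=\lambda_e$ and $b=\lambda_{d,j}$, $$\mathbb E[\Delta^{(j)}]=\frac{1-e^{-b\gamma}}{b}-\gamma e^{-b\gamma}\Big(1-\frac{b}{a+b}e^{-a\gamma}\Big)+\frac{b}{(a+b)^2}e^{-(a+b)\gamma},$$ $$\begin{aligned}\mathbb E[W_j]={}&\gamma(1-e^{-b\gamma})(1-e^{-a\gamma})+\frac{b\gamma+1}{b}e^{-b\gamma}(1-e^{-a\gamma})+\frac{a\gamma+1}{a}e^{-a\gamma}(1-e^{-b\gamma})\\&+\frac{b[a(a+b)\gamma+2a+b]}{a(a+b)^2}e^{-(a+b)\gamma}+\frac{a[b(a+b)\gamma+2b+a]}{b(a+b)^2}e^{-(a+b)\gamma},\end{aligned}$$ $$\begin{aligned}\mathbb E[W_j^2]={}&\gamma^2(1-e^{-b\gamma})(1-e^{-a\gamma})+\frac{b^2\gamma^2+2b\gamma+2}{b^2}e^{-b\gamma}(1-e^{-a\gamma})+\frac{a^2\gamma^2+2a\gamma+2}{a^2}e^{-a\gamma}(1-e^{-b\gamma})\\&+\frac{b\big(a^2(a+b)^2\gamma^2+2a(a+b)(2a+b)\gamma+6a^2+6ab+2b^2\big)}{a^2(a+b)^3}e^{-(a+b)\gamma}\\&+\frac{a\big(b^2(a+b)^2\gamma^2+2b(a+b)(2b+a)\gamma+6b^2+6ab+2a^2\big)}{b^2(a+b)^3}e^{-(a+b)\gamma}.\end{aligned}$$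 -/

import Mathlib

open MeasureTheory ProbabilityTheory Filter Topology

namespace StatusUpdate

/-! ### Primitive random elements -/

/-- `arrival n ω` is the time of the `(n+1)`-st arrival. The arrivals form a (homogeneous) Poisson
process of the given rate: the first arrival time and the successive inter-arrival times are i.i.d.
exponential random variables with that rate. -/
structure IsPoissonProcess {Ω : Type*} [MeasurableSpace Ω] (P : Measure Ω)
    (arrival : ℕ → Ω → ℝ) (rate : ℝ) : Prop where
  measurable : ∀ n, Measurable (arrival n)
  law_first : P.map (arrival 0) = expMeasure rate
  law_gap : ∀ n, P.map (fun ω => arrival (n + 1) ω - arrival n ω) = expMeasure rate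
  indep : iIndepFun
    (fun (n : ℕ) (ω : Ω) => if n = 0 then arrival 0 ω else arrival n ω - arrival (n - 1) ω) P

/-- One realization of everything that is random in the system: the arrival times of the energy
units, the arrival (generation) times of the data packets of each of the `N` sources, and, for each
transmission attempt, whether it is erased by the channel. Attempts are numbered `0, 1, 2, …`
in order of time, over all sources together. -/
structure Path (N : ℕ) where
  energy : ℕ → ℝ
  data : Fin N → ℕ → ℝ
  erased : ℕ → Bool

/-- The probabilistic model: energy arrives as a Poisson process of rate `lamE`, the data of source
`j` as a Poisson process of rate `lamD j`, transmissions are erased i.i.d. with probability `q`, and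
all these processes are independent. -/
structure IsModel {N : ℕ} {Ω : Type*} [MeasurableSpace Ω] (P : Measure Ω) (X : Ω → Path N)
    (lamE : ℝ) (lamD : Fin N → ℝ) (q : ℝ) : Prop where
  energy_poisson : IsPoissonProcess P (fun n ω => (X ω).energy n) lamE
  data_poisson : ∀ j, IsPoissonProcess P (fun n ω => (X ω).data j n) (lamD j)
  erased_measurable : ∀ k, Measurable (fun ω => (X ω).erased k)
  erased_prob : ∀ k, P {ω | (X ω).erased k = true} = ENNReal.ofReal q
  erased_indep : iIndepFun (fun k ω => (X ω).erased k) P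
  data_indep : iIndepFun (fun j ω => (X ω).data j) P
  energy_indep_data : IndepFun (fun ω => (X ω).energy) (fun ω => (X ω).data) P
  arrivals_indep_erased :
    IndepFun (fun ω => ((X ω).energy, (X ω).data)) (fun ω => (X ω).erased) P

/-! ### Maximum-age-first scheduling with threshold waiting -/

/-- The `γ`-threshold waiting function `w(t) = t + [γ - t]⁺`. -/
noncomputable def wait (γ t : ℝ) : ℝ := t + max (γ - t) 0

/-- The first arrival strictly after time `t`. -/
noncomputable def nextArrival (a : ℕ → ℝ) (t : ℝ) : ℝ := sInf {s | s ∈ Set.range a ∧ t < s}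

/-- The latest arrival up to and including time `t`. -/
noncomputable def latestArrival (a : ℕ → ℝ) (t : ℝ) : ℝ := sSup {s | s ∈ Set.range a ∧ s ≤ t}

/-- The source of maximum age, given the current ages of all sources; ties are resolved in favour
of the smallest index. -/
noncomputable def maxAgeSource {N : ℕ} [NeZero N] (age : Fin N → ℝ) : Fin N :=
  open Classical in
  (Finset.univ.filter fun j => ∀ κ, age κ ≤ age j).min' (by
    obtain ⟨j, hj⟩ := Finite.exists_max age
    exact ⟨j, by simpa using hj⟩)

/-- The state of the system right after a transmission attempt. At such a time the battery and the
data buffer are both empty, so that only the current time and the time-stamps of the latest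
successfully received packets matter. -/
structure State (N : ℕ) where
  /-- the time of the latest attempt (`0` at the start) -/
  time : ℝ
  /-- the time-stamp of the latest packet of each source that the destination has received -/
  stamp : Fin N → ℝ

section Dynamics

variable {N : ℕ} [NeZero N] (γ : ℝ) (x : Path N)

/-- The source whose packets the data buffer accepts, from the given state until the next attempt:
the source of maximum age. (All ages grow at unit rate until the next attempt.) -/
noncomputable def State.source (S : State N) : Fin N := maxAgeSource fun j => S.time - S.stamp j

/-- Time from the given state to the next energy arrival. -/
noncomputable def State.energyWait (S : State N) : ℝ := nextArrival x.energy S.time - S.time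

/-- Time from the given state to the next data arrival of the source being accepted. -/
noncomputable def State.dataWait (S : State N) : ℝ :=
  nextArrival (x.data S.source) S.time - S.time

/-- The time of the attempt that follows the given state: `w(max{e, d})` after it. -/
noncomputable def State.nextTime (S : State N) : ℝ :=
  S.time + wait γ (max (S.energyWait x) (S.dataWait x))

/-- The system state after `k` attempts. Initially all sources have age `0` at time `0`. The attempt
number `k` sends the freshest packet of the accepted source (new packets preempt older ones); unless
it is erased, the destination receives that packet. -/
noncomputable def state : ℕ → State N
  | 0 => ⟨0, fun _ => 0⟩
  | k + 1 =>
    let S := state k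
    ⟨S.nextTime γ x,
      if x.erased k = true then S.stamp
      else Function.update S.stamp S.source
        (latestArrival (x.data S.source) (S.nextTime γ x))⟩

/-- Attempt number `k` is a successful transmission for source `j`. -/
def IsSuccess (j : Fin N) (k : ℕ) : Prop := (state γ x k).source = j ∧ x.erased k = false

/-- `s_{i,j}`: the time of the `i`-th successful transmission for source `j`, with `s_{0,j} = 0`. -/
noncomputable def successTime (j : Fin N) : ℕ → ℝ
  | 0 => 0
  | i + 1 => (state γ x (Nat.nth (IsSuccess γ x j) i + 1)).time

/-- `u_j(t)`: the time-stamp of the latest packet of source `j` received by time `t`. -/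
noncomputable def stampAt (j : Fin N) (t : ℝ) : ℝ :=
  (state γ x (sSup {k : ℕ | (state γ x k).time ≤ t})).stamp j

/-- The age of information `a_j(t) = t - u_j(t)`. -/
noncomputable def aoi (j : Fin N) (t : ℝ) : ℝ := t - stampAt γ x j t

/-- `Δ_{i,j}`: the age of source `j` right after its `i`-th successful transmission, that is, the
starting age of its epoch `i + 1`. -/
noncomputable def startAge (j : Fin N) (i : ℕ) : ℝ := aoi γ x j (successTime γ x j i)

/-- `L_{i,j}`, for `i ≥ 1`: the length of the `i`-th epoch of source `j`. -/
noncomputable def epochLength (j : Fin N) (i : ℕ) : ℝ :=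
  successTime γ x j i - successTime γ x j (i - 1)

/-- `Q_{i,j}`, for `i ≥ 1`: the area under the age curve over the `i`-th epoch of source `j`. -/
noncomputable def epochArea (j : Fin N) (i : ℕ) : ℝ :=
  ∫ t in (successTime γ x j (i - 1))..(successTime γ x j i), aoi γ x j t

/-- For `i ≥ 1`: the number of the first attempt for source `j` in its `i`-th epoch, that is, the
first one for source `j` after exactly `i - 1` successes of source `j`. -/
noncomputable def firstAttempt (j : Fin N) (i : ℕ) : ℕ :=
  open Classical in
  sInf {k : ℕ | (state γ x k).source = j ∧ Nat.count (IsSuccess γ x j) k = i - 1}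

/-- `e^{(j)}_{i,1}`: from the moment the sensor turns to source `j` in its `i`-th epoch to the first
energy arrival. -/
noncomputable def firstEnergy (j : Fin N) (i : ℕ) : ℝ :=
  (state γ x (firstAttempt γ x j i)).energyWait x

/-- `d^{(j)}_{i,1}`: from the moment the sensor turns to source `j` in its `i`-th epoch to the first
data arrival of source `j`. -/
noncomputable def firstData (j : Fin N) (i : ℕ) : ℝ :=
  (state γ x (firstAttempt γ x j i)).dataWait x

/-- `w(max{e^{(j)}, d^{(j)}})` in the `i`-th epoch of source `j`. -/
noncomputable def firstWait (j : Fin N) (i : ℕ) : ℝ :=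
  wait γ (max (firstEnergy γ x j i) (firstData γ x j i))

end Dynamics

/-! ### Long-term average age -/

section Average

variable {N : ℕ} [NeZero N] {Ω : Type*} [MeasurableSpace Ω]

/-- The average age of source `j` over its first `n` epochs, `∑ E[Q_{i,j}] / ∑ E[L_{i,j}]`. -/
noncomputable def averageAoI (P : Measure Ω) (X : Ω → Path N) (γ : ℝ) (j : Fin N) (n : ℕ) : ℝ :=
  (∑ i ∈ Finset.Icc 1 n, ∫ ω, epochArea γ (X ω) j i ∂P) /
    (∑ i ∈ Finset.Icc 1 n, ∫ ω, epochLength γ (X ω) j i ∂P)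

/-- The collective long-term average age of information. -/
noncomputable def collectiveAoI (P : Measure Ω) (X : Ω → Path N) (γ : ℝ) : ℝ :=
  (1 / (N : ℝ)) * ∑ j : Fin N, limsup (fun n => averageAoI P X γ j n) atTop

end Average

/-! ### Closed forms (`a` is the energy rate, `b` the data rate) -/

/-- Closed form of the mean starting age. -/
noncomputable def meanStartAge (a b γ : ℝ) : ℝ :=
  (1 - Real.exp (-(b * γ))) / b
    - γ * Real.exp (-(b * γ)) * (1 - b / (a + b) * Real.exp (-(a * γ)))
    + b / (a + b) ^ 2 * Real.exp (-((a + b) * γ))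

/-- Closed form of the first moment of `w(max{e, d})`. -/
noncomputable def waitMoment₁ (a b γ : ℝ) : ℝ :=
  γ * (1 - Real.exp (-(b * γ))) * (1 - Real.exp (-(a * γ)))
    + (b * γ + 1) / b * Real.exp (-(b * γ)) * (1 - Real.exp (-(a * γ)))
    + (a * γ + 1) / a * Real.exp (-(a * γ)) * (1 - Real.exp (-(b * γ)))
    + b * (a * (a + b) * γ + 2 * a + b) / (a * (a + b) ^ 2) * Real.exp (-((a + b) * γ))
    + a * (b * (a + b) * γ + 2 * b + a) / (b * (a + b) ^ 2) * Real.exp (-((a + b) * γ))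

/-- Closed form of the second moment of `w(max{e, d})`. -/
noncomputable def waitMoment₂ (a b γ : ℝ) : ℝ :=
  γ ^ 2 * (1 - Real.exp (-(b * γ))) * (1 - Real.exp (-(a * γ)))
    + (b ^ 2 * γ ^ 2 + 2 * b * γ + 2) / b ^ 2 * Real.exp (-(b * γ)) * (1 - Real.exp (-(a * γ)))
    + (a ^ 2 * γ ^ 2 + 2 * a * γ + 2) / a ^ 2 * Real.exp (-(a * γ)) * (1 - Real.exp (-(b * γ)))
    + b * (a ^ 2 * (a + b) ^ 2 * γ ^ 2 + 2 * a * (a + b) * (2 * a + b) * γ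
          + 6 * a ^ 2 + 6 * a * b + 2 * b ^ 2) / (a ^ 2 * (a + b) ^ 3)
        * Real.exp (-((a + b) * γ))
    + a * (b ^ 2 * (a + b) ^ 2 * γ ^ 2 + 2 * b * (a + b) * (2 * b + a) * γ
          + 6 * b ^ 2 + 6 * a * b + 2 * a ^ 2) / (b ^ 2 * (a + b) ^ 3)
        * Real.exp (-((a + b) * γ))

end StatusUpdate

open StatusUpdate

/-! Maximum-age-first scheduling is a round robin. Right after an attempt no received time-stamp
exceeds the current time, and the packet sent next is generated later, because the buffer has been
emptied. A success therefore moves its source to the end of the age order, and an erasure leaves the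
order alone, so the source being served is the number of successes so far modulo `N`
(`GoodPath.roundRobin`). Call visit `v` the block of attempts that ends with success number `v`,
counted from `0`. From the second one on, an epoch of source `j` consists of the `N` visits that
follow a visit of `j`. The age has slope one during an epoch, so its area is `Q = Δ L + L² / 2`,
with `Δ` the starting age (`GoodPath.epochArea_eq`).

On the probabilistic side, an attempt takes place `max{e, d, γ}` after the previous one, a time that
is determined by the arrivals up to it. By the Markov property of Poisson processes the system seen
from there has its original law and is independent of what the attempt showed (`IsSysLaw.attempt`).
`Regenerative` states this as an identity of integrals; the property persists when the map is
iterated up to the first success (`Regenerative.iterate_hitTime`). So visits regenerate as well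
(`IsSysLaw.visit`), and statistics of different visits are independent (`IsSysLaw.indepFun_visit`).

The duration `V` of a visit is a sum of waiting times up to the first success. With `m`, `m'` the
moments of one waiting time, conditioning on the first attempt gives `E V = m / (1 - q)` and `E V² =
(m' + 2 q m E V) / (1 - q)`; the packet delivered has the mean age of any packet sent, since
erasures ignore ages (`IsSysLaw.visit_moments`). Over a full round the means and the variances of
the visits add up, and `Δ` is independent of `L`, so that `E Q / E L = E Δ + E L² / (2 E L)`;
expanding `(∑ m)²` turns this into the formula (`epochSecond_div`). The first epoch of a source,
which starts with age `0` and may be shorter than a round, is lost in the Cesàro limit.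

The closed forms come from integrating over the first data arrival and then over the first energy
arrival. For the age, the Markov property is applied at time `c - u`: the latest packet at time `c`
has age at least `u` when one arrived by `c - u` and none since. -/

namespace StatusUpdate

open scoped ENNReal

set_option linter.unusedSectionVars false

/-! ### Arrival paths -/

/-- The arrival times of a simple point process on `(0, ∞)` without accumulation points. -/
structure Good (a : ℕ → ℝ) : Prop where
  pos : 0 < a 0
  mono : StrictMono a
  unbounded : ∀ t, ∃ n, t < a n

/-- The number of arrivals up to and including time `t`. -/
noncomputable def countUpTo (a : ℕ → ℝ) (t : ℝ) : ℕ := sInf {n | t < a n}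

/-- The arrivals after time `t`, seen from time `t`. -/
noncomputable def shift (a : ℕ → ℝ) (t : ℝ) : ℕ → ℝ := fun n => a (countUpTo a t + n) - t

/-- The latest arrival up to and including time `t`, if there is one. -/
noncomputable def lastUpTo (a : ℕ → ℝ) (t : ℝ) : ℝ := a (countUpTo a t - 1)

/-- The path with first arrival `x` that continues like `a` after `x`. -/
def glue (x : ℝ) (a : ℕ → ℝ) : ℕ → ℝ
  | 0 => x
  | n + 1 => x + a n

/-- The path after its first arrival. -/
def tail (a : ℕ → ℝ) : ℕ → ℝ := fun n => a (n + 1) - a 0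

/-- Two paths have the same arrivals up to time `t`. -/
def Agree (t : ℝ) (a b : ℕ → ℝ) : Prop := ∀ n, a n ≤ t ∨ b n ≤ t → a n = b n

lemma glue_head_tail (a : ℕ → ℝ) : glue (a 0) (tail a) = a := by
  funext n
  cases n <;> simp [glue, tail]

lemma Agree.glue {t x : ℝ} {a b : ℕ → ℝ} (h : Agree (t - x) a b) :
    Agree t (glue x a) (glue x b) := by
  intro n hn
  cases n with
  | zero => rfl
  | succ n =>
    simp only [StatusUpdate.glue] at hn ⊢
    rw [h n (hn.imp (fun h => by linarith) (fun h => by linarith))]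

/-! ### Counting, shifting and gluing of arrivals -/

namespace Good

variable {a : ℕ → ℝ} (ha : Good a)
include ha

lemma pos' (n : ℕ) : 0 < a n := ha.pos.trans_le (ha.mono.monotone n.zero_le)

lemma lt_count (t : ℝ) : t < a (countUpTo a t) := Nat.sInf_mem (ha.unbounded t)

lemma lt_iff {t : ℝ} {n : ℕ} : t < a n ↔ countUpTo a t ≤ n := by
  refine ⟨fun h => Nat.sInf_le h, fun h => (ha.lt_count t).trans_le (ha.mono.monotone h)⟩

lemma le_iff {t : ℝ} {n : ℕ} : a n ≤ t ↔ n < countUpTo a t := by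
  rw [← not_lt, ha.lt_iff, not_le]

lemma count_eq {t : ℝ} {m : ℕ} (h : ∀ n, t < a n ↔ m ≤ n) : countUpTo a t = m :=
  le_antisymm (ha.lt_iff.1 ((h m).2 le_rfl)) ((h _).1 (ha.lt_count t))

lemma count_mono {s t : ℝ} (h : s ≤ t) : countUpTo a s ≤ countUpTo a t :=
  ha.lt_iff.1 (h.trans_lt (ha.lt_count t))

lemma nextArrival_eq (t : ℝ) : nextArrival a t = a (countUpTo a t) := by
  apply IsLeast.csInf_eq
  refine ⟨⟨⟨_, rfl⟩, ha.lt_count t⟩, ?_⟩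
  rintro _ ⟨⟨n, rfl⟩, hn⟩
  exact ha.mono.monotone (ha.lt_iff.1 hn)

/-- Without an arrival up to `t` the two sides take unrelated default values: `sSup ∅ = 0` on the
left, and `a 0` on the right because of the truncated subtraction. -/
lemma latestArrival_eq {t : ℝ} (h : a 0 ≤ t) : latestArrival a t = lastUpTo a t := by
  have h0 := ha.le_iff.1 h
  apply IsGreatest.csSup_eq
  refine ⟨⟨⟨_, rfl⟩, ha.le_iff.2 (by omega)⟩, ?_⟩
  rintro _ ⟨⟨n, rfl⟩, hn⟩
  have := ha.le_iff.1 hn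
  exact ha.mono.monotone (by omega)

lemma lastUpTo_le {t : ℝ} (h : a 0 ≤ t) : lastUpTo a t ≤ t := by
  have h0 := ha.le_iff.1 h
  exact ha.le_iff.2 (by omega)

lemma lastUpTo_pos (t : ℝ) : 0 < lastUpTo a t := ha.pos' _

protected lemma shift (t : ℝ) : Good (shift a t) where
  pos := by simpa [StatusUpdate.shift] using ha.lt_count t
  mono := fun m n h => by
    simpa [StatusUpdate.shift] using ha.mono (by omega : countUpTo a t + m < countUpTo a t + n)
  unbounded := fun s => by
    obtain ⟨n, hn⟩ := ha.unbounded (s + t)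
    refine ⟨n, ?_⟩
    have := ha.mono.monotone (by omega : n ≤ countUpTo a t + n)
    simp only [StatusUpdate.shift]
    linarith

lemma count_shift {s t : ℝ} (hs : 0 ≤ s) :
    countUpTo a t + countUpTo (shift a t) s = countUpTo a (t + s) := by
  have h1 : countUpTo (StatusUpdate.shift a t) s = countUpTo a (t + s) - countUpTo a t := by
    refine (ha.shift t).count_eq fun n => ?_
    have h2 : s < StatusUpdate.shift a t n ↔ t + s < a (countUpTo a t + n) := by
      simp only [StatusUpdate.shift]
      constructor <;> intro h <;> linarith
    rw [h2, ha.lt_iff]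
    omega
  have := ha.count_mono (by linarith : t ≤ t + s)
  omega

lemma shift_shift {s t : ℝ} (hs : 0 ≤ s) : shift (shift a t) s = shift a (t + s) := by
  have h := ha.count_shift (t := t) hs
  funext n
  simp only [StatusUpdate.shift] at h ⊢
  rw [← add_assoc, h]
  ring

lemma lastUpTo_shift {s t : ℝ} (hs : 0 ≤ s) (h : shift a t 0 ≤ s) :
    t + lastUpTo (shift a t) s = lastUpTo a (t + s) := by
  have h1 := ha.count_shift (t := t) hs
  have h2 := (ha.shift t).le_iff.1 h
  simp only [lastUpTo]
  rw [StatusUpdate.shift, ← h1]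
  rw [Nat.add_sub_assoc (by omega)]
  ring

lemma shift_zero : shift a 0 = a := by
  have : countUpTo a 0 = 0 := ha.count_eq fun n => by simp [ha.pos' n]
  funext n
  simp [StatusUpdate.shift, this]

protected lemma glue {x : ℝ} (hx : 0 < x) : Good (glue x a) where
  pos := hx
  mono := strictMono_nat_of_lt_succ fun n => by
    cases n with
    | zero => simpa [StatusUpdate.glue] using ha.pos
    | succ n => simpa [StatusUpdate.glue] using ha.mono n.lt_succ_self
  unbounded := fun t => by
    obtain ⟨n, hn⟩ := ha.unbounded (t - x)
    exact ⟨n + 1, by simp only [StatusUpdate.glue]; linarith⟩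

lemma count_glue {x c : ℝ} (hx : 0 < x) (hc : x ≤ c) :
    countUpTo (glue x a) c = countUpTo a (c - x) + 1 := by
  refine (ha.glue hx).count_eq fun n => ?_
  cases n with
  | zero => simpa [StatusUpdate.glue] using hc
  | succ n =>
    rw [show c < StatusUpdate.glue x a (n + 1) ↔ c - x < a n by
      simp only [StatusUpdate.glue]; constructor <;> intro h <;> linarith, ha.lt_iff]
    omega

lemma count_glue_of_lt {x c : ℝ} (hx : 0 < x) (hc : c < x) : countUpTo (glue x a) c = 0 := by
  have := (ha.glue hx).lt_iff (t := c) (n := 0)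
  simp only [StatusUpdate.glue] at this
  simpa using this.1 hc

lemma shift_glue {x c : ℝ} (hx : 0 < x) (hc : x ≤ c) :
    shift (glue x a) c = shift a (c - x) := by
  funext n
  simp only [StatusUpdate.shift, ha.count_glue hx hc]
  rw [show countUpTo a (c - x) + 1 + n = countUpTo a (c - x) + n + 1 by ring]
  simp only [StatusUpdate.glue]
  ring

lemma shift_glue_self {x : ℝ} (hx : 0 < x) : shift (glue x a) x = a := by
  rw [ha.shift_glue hx le_rfl, sub_self, ha.shift_zero]

lemma shift_glue_of_lt {x c : ℝ} (hx : 0 < x) (hc : c < x) :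
    shift (glue x a) c = glue (x - c) a := by
  funext n
  simp only [StatusUpdate.shift, ha.count_glue_of_lt hx hc]
  cases n with
  | zero => simp [StatusUpdate.glue]
  | succ n => rw [zero_add]; simp only [StatusUpdate.glue]; ring

lemma count_congr {b : ℕ → ℝ} (hb : Good b) {t : ℝ} (h : Agree t a b) :
    countUpTo a t = countUpTo b t := by
  refine ha.count_eq fun n => ?_
  rw [← hb.lt_iff, ← not_le, ← not_le, not_iff_not]
  exact ⟨fun h' => h n (.inl h') ▸ h', fun h' => (h n (.inr h')).symm ▸ h'⟩

lemma lastUpTo_congr {b : ℕ → ℝ} (hb : Good b) {t : ℝ} (h0 : a 0 ≤ t) (h : Agree t a b) :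
    lastUpTo a t = lastUpTo b t := by
  have h1 := ha.le_iff.1 h0
  rw [lastUpTo, lastUpTo, ← ha.count_congr hb h]
  exact h _ (.inl (ha.le_iff.2 (by omega)))

end Good

/-! ### Measurability -/

lemma measurable_sInf_nat {α : Type*} [MeasurableSpace α] {p : α → ℕ → Prop}
    (hp : ∀ n, Measurable fun x => p x n) : Measurable fun x => sInf {n | p x n} := by
  refine measurable_to_countable' fun m => ?_
  -- Since `sInf ∅ = 0`, the fibre over `0` also contains the points at which no `n` qualifies.
  have key : (fun x => sInf {n | p x n}) ⁻¹' {m} =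
      {x | (p x m ∧ ∀ k < m, ¬ p x k) ∨ (m = 0 ∧ ∀ k, ¬ p x k)} := by
    ext x
    simp only [Set.mem_preimage, Set.mem_singleton_iff, Set.mem_ofPred_eq]
    constructor
    · rintro rfl
      by_cases h : ∃ k, p x k
      · exact .inl ⟨Nat.sInf_mem (s := {n | p x n}) h, fun k hk => Nat.notMem_of_lt_sInf hk⟩
      · refine .inr ⟨?_, by simpa using h⟩
        have : {n | p x n} = ∅ := by ext n; simpa using not_exists.1 h n
        simp [this]
    · rintro (⟨h1, h2⟩ | ⟨rfl, h⟩)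
      · refine le_antisymm (Nat.sInf_le h1) ?_
        by_contra! h'
        exact h2 _ h' (Nat.sInf_mem (s := {n | p x n}) ⟨m, h1⟩)
      · have : {n | p x n} = ∅ := by ext n; simpa using h n
        simp [this]
  rw [key]
  exact measurableSet_setOfPred.2 (((hp m).and (.forall fun k => .imp measurable_const (hp k).not)).or
    (measurable_const.and (.forall fun k => (hp k).not)))

lemma measurable_countUpTo : Measurable fun p : (ℕ → ℝ) × ℝ => countUpTo p.1 p.2 :=
  measurable_sInf_nat fun n => measurableSet_setOfPred.1
    (measurableSet_lt measurable_snd ((measurable_pi_apply n).comp measurable_fst))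

lemma measurable_apply_nat {α : Type*} [MeasurableSpace α] {f : α → ℕ → ℝ} {k : α → ℕ}
    (hf : Measurable f) (hk : Measurable k) : Measurable fun x => f x (k x) := by
  have : Measurable fun p : (ℕ → ℝ) × ℕ => p.1 p.2 :=
    measurable_from_prod_countable_left fun _ => measurable_pi_apply _
  exact this.comp (hf.prodMk hk)

lemma measurable_shift : Measurable fun p : (ℕ → ℝ) × ℝ => shift p.1 p.2 :=
  measurable_pi_lambda _ fun n => (measurable_apply_nat measurable_fst
    (measurable_countUpTo.add_const n)).sub measurable_snd

lemma measurable_lastUpTo : Measurable fun p : (ℕ → ℝ) × ℝ => lastUpTo p.1 p.2 :=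
  measurable_apply_nat measurable_fst
    ((measurable_of_countable (· - 1)).comp measurable_countUpTo)

lemma measurable_glue : Measurable fun p : ℝ × (ℕ → ℝ) => glue p.1 p.2 :=
  measurable_pi_lambda _ fun n => by
    cases n with
    | zero => exact measurable_fst
    | succ n => exact measurable_fst.add ((measurable_pi_apply n).comp measurable_snd)

lemma measurable_tail : Measurable tail :=
  measurable_pi_lambda _ fun _ => (measurable_pi_apply _).sub (measurable_pi_apply _)

/-! ### Regenerative maps -/

/-- The image `Φ y` is distributed like `y` and is independent of the observation `ρ y`. -/
structure Regenerative {Y R : Type*} [MeasurableSpace Y] [MeasurableSpace R] (μ : Measure Y)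
    (ρ : Y → R) (Φ : Y → Y) : Prop where
  measurable_obs : Measurable ρ
  measurable_map : Measurable Φ
  lintegral_eq : ∀ H : R × Y → ℝ≥0∞, Measurable H →
    ∫⁻ y, H (ρ y, Φ y) ∂μ = ∫⁻ y, ∫⁻ y', H (ρ y, y') ∂μ ∂μ

/-- The observations made along the iterates of `Φ`. -/
def history {Y R : Type*} (ρ : Y → R) (Φ : Y → Y) (y : Y) : ℕ → R := fun m => ρ (Φ^[m] y)

/-- The sequence `f` preceded by `r`. -/
def prepend {R : Type*} (r : R) (f : ℕ → R) : ℕ → R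
  | 0 => r
  | n + 1 => f n

lemma measurable_prepend {R : Type*} [MeasurableSpace R] :
    Measurable fun p : R × (ℕ → R) => prepend p.1 p.2 :=
  measurable_pi_lambda _ fun n => by
    cases n with
    | zero => exact measurable_fst
    | succ n => exact (measurable_pi_apply n).comp measurable_snd

/-- The first `n` at which the sequence `f` is in `S`. -/
noncomputable def hitTime {R : Type*} (S : Set R) (f : ℕ → R) : ℕ := sInf {n | f n ∈ S}

lemma hitTime_eq_iff {R : Type*} {S : Set R} {f : ℕ → R} (hf : ∃ n, f n ∈ S) {n : ℕ} :
    hitTime S f = n ↔ f n ∈ S ∧ ∀ m < n, f m ∉ S := by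
  constructor
  · rintro rfl
    exact ⟨Nat.sInf_mem (s := {n | f n ∈ S}) hf, fun k hk => Nat.notMem_of_lt_sInf hk⟩
  · rintro ⟨h1, h2⟩
    refine le_antisymm (Nat.sInf_le h1) ?_
    by_contra! h'
    exact h2 _ h' (Nat.sInf_mem (s := {n | f n ∈ S}) hf)

lemma measurable_hitTime {R : Type*} [MeasurableSpace R] {S : Set R} (hS : MeasurableSet S) :
    Measurable (hitTime S) :=
  measurable_sInf_nat fun n => measurableSet_setOfPred.1 (measurable_pi_apply n hS)

/-! ### Markov and strong Markov properties -/

namespace Regenerative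

variable {Y R : Type*} [MeasurableSpace Y] [MeasurableSpace R] {μ : Measure Y}
  [IsProbabilityMeasure μ] {ρ : Y → R} {Φ : Y → Y}

lemma map_prod (h : Regenerative μ ρ Φ) :
    μ.map (fun y => (ρ y, Φ y)) = (μ.map ρ).prod μ := by
  have := Measure.isProbabilityMeasure_map (μ := μ) h.measurable_obs.aemeasurable
  refine Measure.ext_of_lintegral _ fun H hH => ?_
  rw [lintegral_map hH (h.measurable_obs.prodMk h.measurable_map), h.lintegral_eq H hH,
    lintegral_prod _ hH.aemeasurable, lintegral_map hH.lintegral_prod_right' h.measurable_obs]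

lemma of_map_prod (hρ : Measurable ρ) (hΦ : Measurable Φ)
    (h : μ.map (fun y => (ρ y, Φ y)) = (μ.map ρ).prod μ) : Regenerative μ ρ Φ := by
  have := Measure.isProbabilityMeasure_map (μ := μ) hρ.aemeasurable
  refine ⟨hρ, hΦ, fun H hH => ?_⟩
  rw [← lintegral_map hH (hρ.prodMk hΦ), h, lintegral_prod _ hH.aemeasurable,
    lintegral_map hH.lintegral_prod_right' hρ]

lemma measurePreserving (h : Regenerative μ ρ Φ) : MeasurePreserving Φ μ μ := by
  refine ⟨h.measurable_map, Measure.ext_of_lintegral _ fun H hH => ?_⟩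
  rw [lintegral_map hH h.measurable_map]
  simpa using h.lintegral_eq (fun p => H p.2) (hH.comp measurable_snd)

lemma indepFun (h : Regenerative μ ρ Φ) : IndepFun ρ Φ μ := by
  rw [indepFun_iff_map_prod_eq_prod_map_map h.measurable_obs.aemeasurable
    h.measurable_map.aemeasurable, h.map_prod, h.measurePreserving.map_eq]

/-- Transport along a semiconjugacy. -/
lemma transport {Z : Type*} [MeasurableSpace Z] (h : Regenerative μ ρ Φ) {π : Y → Z}
    (hπ : Measurable π) {ρ' : Z → R} {Φ' : Z → Z} (hρ : Measurable ρ') (hΦ : Measurable Φ')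
    (e1 : ∀ y, ρ' (π y) = ρ y) (e2 : ∀ y, Φ' (π y) = π (Φ y)) :
    Regenerative (μ.map π) ρ' Φ' := by
  have := Measure.isProbabilityMeasure_map (μ := μ) hπ.aemeasurable
  refine ⟨hρ, hΦ, fun H hH => ?_⟩
  rw [lintegral_map (f := fun z => H (ρ' z, Φ' z)) (hH.comp (hρ.prodMk hΦ)) hπ,
    lintegral_map (Measurable.lintegral_prod_right' (f := fun p : Z × Z => H (ρ' p.1, p.2))
      (hH.comp ((hρ.comp measurable_fst).prodMk measurable_snd))) hπ]
  simp only [e1, e2]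
  rw [h.lintegral_eq (fun p => H (p.1, π p.2))
    (hH.comp (measurable_fst.prodMk (hπ.comp measurable_snd)))]
  refine lintegral_congr fun y => ?_
  exact (lintegral_map (f := fun z => H (ρ y, z)) (by fun_prop) hπ).symm

omit [IsProbabilityMeasure μ] in
lemma measurable_history (h : Regenerative μ ρ Φ) : Measurable (history ρ Φ) :=
  measurable_pi_lambda _ fun m => h.measurable_obs.comp (h.measurable_map.iterate m)

/-- The Markov property after `n` steps. -/
lemma lintegral_iterate (h : Regenerative μ ρ Φ) (n : ℕ) (H : (ℕ → R) × Y → ℝ≥0∞)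
    (hH : Measurable H)
    (hn : ∀ f g y, (∀ m < n, f m = g m) → H (f, y) = H (g, y)) :
    ∫⁻ y, H (history ρ Φ y, Φ^[n] y) ∂μ = ∫⁻ y, ∫⁻ y', H (history ρ Φ y, y') ∂μ ∂μ := by
  have hist : ∀ y, history ρ Φ y = prepend (ρ y) (history ρ Φ (Φ y)) := fun y => by
    funext m
    cases m <;> simp [history, prepend]
  have mh := h.measurable_history
  induction n generalizing H with
  | zero =>
    -- For `n = 0` the hypothesis `hn` says that `H` ignores the history altogether.
    have : ∀ y, ∫⁻ y', H (history ρ Φ y, y') ∂μ = ∫⁻ y', H (history ρ Φ y', y') ∂μ :=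
      fun y => lintegral_congr fun y' => hn _ _ _ (by simp)
    simp [this]
  | succ n ih =>
    have m1 : Measurable fun p : R × Y => H (prepend p.1 (history ρ Φ p.2), Φ^[n] p.2) :=
      hH.comp ((measurable_prepend.comp (measurable_fst.prodMk (mh.comp measurable_snd))).prodMk
        ((h.measurable_map.iterate n).comp measurable_snd))
    have m2 : Measurable fun p : R × Y => ∫⁻ y', H (prepend p.1 (history ρ Φ p.2), y') ∂μ :=
      Measurable.lintegral_prod_right' (f := fun p : (R × Y) × Y =>
        H (prepend p.1.1 (history ρ Φ p.1.2), p.2)) (hH.comp ((measurable_prepend.comp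
          ((measurable_fst.comp measurable_fst).prodMk
            (mh.comp (measurable_snd.comp measurable_fst)))).prodMk measurable_snd))
    calc ∫⁻ y, H (history ρ Φ y, Φ^[n + 1] y) ∂μ
        = ∫⁻ y, H (prepend (ρ y) (history ρ Φ (Φ y)), Φ^[n] (Φ y)) ∂μ := by
          refine lintegral_congr fun y => ?_
          rw [hist y, Function.iterate_succ_apply]
      _ = ∫⁻ y, ∫⁻ y', H (prepend (ρ y) (history ρ Φ y'), Φ^[n] y') ∂μ ∂μ :=
          h.lintegral_eq _ m1
      _ = ∫⁻ y, ∫⁻ y', ∫⁻ y'', H (prepend (ρ y) (history ρ Φ y'), y'') ∂μ ∂μ ∂μ := by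
          -- With the first observation `ρ y` frozen, the functional looks at only `n` further
          -- observations.
          refine lintegral_congr fun y => ih (fun p => H (prepend (ρ y) p.1, p.2))
            (hH.comp ((measurable_prepend.comp
              (measurable_const.prodMk measurable_fst)).prodMk measurable_snd)) ?_
          intro f g y' hfg
          refine hn _ _ _ fun m hm => ?_
          cases m with
          | zero => rfl
          | succ m => exact hfg m (by omega)
      _ = ∫⁻ y, ∫⁻ y'', H (prepend (ρ y) (history ρ Φ (Φ y)), y'') ∂μ ∂μ :=
          (h.lintegral_eq _ m2).symm
      _ = _ := by simp only [← hist]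

/-- The strong Markov property at the first time the observation is in `S`. -/
lemma iterate_hitTime {R' : Type*} [MeasurableSpace R'] (h : Regenerative μ ρ Φ) {S : Set R}
    (hS : MeasurableSet S) (hfin : ∀ᵐ y ∂μ, ∃ n, history ρ Φ y n ∈ S) {U : (ℕ → R) → R'}
    (hU : Measurable U)
    (hUS : ∀ f g n, f n ∈ S → (∀ m < n, f m ∉ S) → (∀ m ≤ n, f m = g m) → U f = U g) :
    Regenerative μ (fun y => U (history ρ Φ y))
      (fun y => Φ^[hitTime S (history ρ Φ y) + 1] y) := by
  have mh := h.measurable_history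
  have mit : Measurable fun p : Y × ℕ => Φ^[p.2 + 1] p.1 :=
    measurable_from_prod_countable_left fun n => h.measurable_map.iterate (n + 1)
  refine ⟨hU.comp mh, mit.comp (measurable_id.prodMk ((measurable_hitTime hS).comp mh)),
    fun H hH => ?_⟩
  -- On `A n` the first visit of `S` is at `n`. Membership in `A n`, and `U` on `A n`, depend on the
  -- observations `0, …, n` only, so the Markov property after `n + 1` steps applies to each piece.
  set A : ℕ → Set (ℕ → R) := fun n => {f | f n ∈ S ∧ ∀ m < n, f m ∉ S} with hA
  have memA : ∀ f n, f ∈ A n ↔ f n ∈ S ∧ ∀ m < n, f m ∉ S := fun _ _ => Iff.rfl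
  have mA : ∀ n, MeasurableSet (A n) := fun n => measurableSet_setOfPred.2
    ((measurableSet_setOfPred.1 (measurable_pi_apply n hS)).and (.forall fun k =>
      .imp measurable_const (measurableSet_setOfPred.1 (measurable_pi_apply k hS)).not))
  have split : ∀ G : ℕ → Y → ℝ≥0∞, (∀ n, Measurable (G n)) →
      ∫⁻ y, G (hitTime S (history ρ Φ y)) y ∂μ =
        ∑' n, ∫⁻ y, (A n).indicator 1 (history ρ Φ y) * G n y ∂μ := by
    intro G hG
    have m1 : ∀ n, Measurable fun y => (A n).indicator (1 : (ℕ → R) → ℝ≥0∞) (history ρ Φ y) * G n y :=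
      fun n => ((measurable_one.indicator (mA n)).comp mh).mul (hG n)
    rw [← lintegral_tsum fun n => (m1 n).aemeasurable]
    refine lintegral_congr_ae ?_
    filter_upwards [hfin] with y hy
    rw [tsum_eq_single (hitTime S (history ρ Φ y))]
    · rw [Set.indicator_of_mem ((memA _ _).2 ((hitTime_eq_iff hy).1 rfl))]
      simp
    · intro n hn
      rw [Set.indicator_of_notMem fun h' => hn ((hitTime_eq_iff hy).2 ((memA _ _).1 h')).symm, zero_mul]
  rw [split (fun n y => H (U (history ρ Φ y), Φ^[n + 1] y)) fun n => hH.comp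
      ((hU.comp mh).prodMk (h.measurable_map.iterate _)),
    split (fun _ y => ∫⁻ y', H (U (history ρ Φ y), y') ∂μ) fun n =>
      Measurable.lintegral_prod_right' (f := fun p : Y × Y => H (U (history ρ Φ p.1), p.2))
        (hH.comp (((hU.comp mh).comp measurable_fst).prodMk measurable_snd))]
  refine tsum_congr fun n => ?_
  rw [h.lintegral_iterate (n + 1) (fun p => (A n).indicator 1 p.1 * H (U p.1, p.2))
    (((measurable_one.indicator (mA n)).comp measurable_fst).mul
      (hH.comp ((hU.comp measurable_fst).prodMk measurable_snd)))]
  · refine lintegral_congr fun y => ?_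
    dsimp only
    exact lintegral_const_mul (f := fun y' => H (U (history ρ Φ y), y')) _ (by fun_prop)
  · intro f g y hfg
    have hAfg : f ∈ A n ↔ g ∈ A n := by
      simp only [hA, Set.mem_ofPred_eq]
      rw [hfg n (by omega)]
      refine and_congr_right fun _ => forall₂_congr fun m hm => ?_
      rw [hfg m (by omega)]
    by_cases hf : f ∈ A n
    · have := hUS f g n hf.1 hf.2 fun m hm => hfg m (by omega)
      simp only [Set.indicator_of_mem hf, Set.indicator_of_mem (hAfg.1 hf), this,
        Pi.one_apply]
    · simp only [Set.indicator_of_notMem hf, Set.indicator_of_notMem (mt hAfg.2 hf), zero_mul]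

end Regenerative

/-- The one-sided shift of an i.i.d. sequence. -/
lemma regenerative_infinitePi {R : Type*} [MeasurableSpace R] (ν : Measure R)
    [IsProbabilityMeasure ν] :
    Regenerative (Measure.infinitePi fun _ : ℕ => ν) (fun f => f 0) (fun f n => f (n + 1)) := by
  -- An independent coordinate put in front of an i.i.d. sequence reproduces its law. As `prepend`
  -- undoes the splitting into first entry and shifted sequence, this is already the claim.
  have hcons : (ν.prod (Measure.infinitePi fun _ : ℕ => ν)).map (fun p => prepend p.1 p.2) =
      Measure.infinitePi fun _ : ℕ => ν := by
    refine Measure.eq_infinitePi _ fun s t ht => ?_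
    classical
    obtain ⟨n, hn⟩ := s.exists_nat_subset_range
    -- Filling up with `univ` makes the cylinder one over an initial segment, from which coordinate
    -- `0` splits off.
    set t' : ℕ → Set R := fun i => if i ∈ s then t i else Set.univ with ht'
    have mt' : ∀ i, MeasurableSet (t' i) := fun i => by
      simp only [ht']; split_ifs <;> simp [ht]
    have hpi : Set.pi s t = Set.pi (Finset.range (n + 1)) t' := by
      ext f
      simp only [Set.mem_pi, Finset.mem_coe, Finset.mem_range, ht']
      constructor
      · intro h i _
        split_ifs with hi
        · exact h i hi
        · trivial
      · intro h i hi
        simpa [hi] using h i (by have := Finset.mem_range.1 (hn hi); omega)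
    have hprod : ∏ i ∈ s, ν (t i) = ∏ i ∈ Finset.range (n + 1), ν (t' i) := by
      rw [← Finset.prod_subset (hn.trans (Finset.range_subset_range.2 n.le_succ))]
      · exact Finset.prod_congr rfl fun i hi => by simp [ht', hi]
      · intro i _ hi
        simp [ht', hi]
    have hpre : (fun p : R × (ℕ → R) => prepend p.1 p.2) ⁻¹' Set.pi (Finset.range (n + 1)) t' =
        t' 0 ×ˢ Set.pi (Finset.range n) fun i => t' (i + 1) := by
      ext p
      simp only [Set.mem_preimage, Set.mem_pi, Finset.mem_coe, Finset.mem_range, Set.mem_prod]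
      constructor
      · exact fun h => ⟨h 0 n.succ_pos, fun i hi => h (i + 1) (by omega)⟩
      · rintro ⟨h0, h1⟩ i hi
        cases i with
        | zero => exact h0
        | succ i => exact h1 i (by omega)
    rw [hpi, hprod, Measure.map_apply measurable_prepend
      (.pi (Finset.countable_toSet _) fun i _ => mt' i), hpre, Measure.prod_prod,
      Measure.infinitePi_pi _ (fun i _ => mt' _), Finset.prod_range_succ', mul_comm]
  refine .of_map_prod (measurable_pi_apply 0)
    (measurable_pi_lambda _ fun n => measurable_pi_apply _) ?_
  rw [Measure.infinitePi_map_eval]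
  conv_lhs => rw [← hcons]
  rw [Measure.map_map ((measurable_pi_apply 0).prodMk
    (measurable_pi_lambda _ fun n => measurable_pi_apply _)) measurable_prepend]
  exact Measure.map_id

/-! ### The exponential distribution -/

lemma lintegral_expMeasure {r : ℝ} (f : ℝ → ℝ≥0∞) (hf : Measurable f) :
    ∫⁻ x, f x ∂expMeasure r =
      ∫⁻ x in Set.Ioi 0, ENNReal.ofReal (r * Real.exp (-(r * x))) * f x := by
  have hpdf : expMeasure r = volume.withDensity (exponentialPDF r) := rfl
  have hm : Measurable (exponentialPDF r) := (measurable_exponentialPDFReal r).ennreal_ofReal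
  rw [hpdf, lintegral_withDensity_eq_lintegral_mul _ hm hf, ← lintegral_indicator measurableSet_Ioi]
  refine lintegral_congr_ae ?_
  filter_upwards [Measure.ae_ne volume (0 : ℝ)] with x hx
  rcases lt_or_gt_of_ne hx with h | h
  · simp [exponentialPDF_of_neg h, h.le]
  · rw [Set.indicator_of_mem (Set.mem_Ioi.2 h), Pi.mul_apply, exponentialPDF_of_nonneg h.le]

lemma ae_pos_expMeasure (r : ℝ) : ∀ᵐ x ∂expMeasure r, 0 < x := by
  have : MeasurableSet {x : ℝ | ¬ 0 < x} := (measurableSet_lt measurable_const measurable_id).compl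
  rw [ae_iff, ← lintegral_indicator_one this, lintegral_expMeasure _ (measurable_one.indicator this),
    ← lintegral_zero (μ := volume.restrict (Set.Ioi (0 : ℝ)))]
  refine setLIntegral_congr_fun measurableSet_Ioi fun x hx => ?_
  rw [Set.indicator_of_notMem (not_not.2 hx), mul_zero]

/-- The exponential distribution is memoryless. -/
lemma lintegral_expMeasure_sub {r c : ℝ} (hc : 0 ≤ c) (f : ℝ → ℝ≥0∞)
    (hf : Measurable f) :
    ∫⁻ x, (Set.Ioi c).indicator (fun x => f (x - c)) x ∂expMeasure r =
      ENNReal.ofReal (Real.exp (-(r * c))) * ∫⁻ x, f x ∂expMeasure r := by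
  rw [lintegral_expMeasure _ (Measurable.indicator (f := fun x => f (x - c)) (by fun_prop)
      measurableSet_Ioi),
    lintegral_expMeasure _ hf, ← lintegral_const_mul _ (by fun_prop),
    ← lintegral_indicator measurableSet_Ioi, ← lintegral_indicator measurableSet_Ioi]
  -- Lebesgue measure is invariant under the translation by `c`, and the density at `x` is `exp (-(r
  -- * c))` times the density at `x - c`.
  refine Eq.trans ?_ (lintegral_sub_right_eq_self _ c)
  refine lintegral_congr fun x => ?_
  by_cases hx : c < x
  · have h1 : (0 : ℝ) < x := hc.trans_lt hx
    have h2 : (0 : ℝ) < x - c := sub_pos.2 hx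
    rw [Set.indicator_of_mem (Set.mem_Ioi.2 h1), Set.indicator_of_mem (Set.mem_Ioi.2 hx),
      Set.indicator_of_mem (Set.mem_Ioi.2 h2), ← mul_assoc, ← ENNReal.ofReal_mul (Real.exp_nonneg _)]
    congr 2
    rw [mul_left_comm, ← Real.exp_add]
    ring_nf
  · have h2 : x - c ∉ Set.Ioi (0 : ℝ) := by simpa using hx
    rw [Set.indicator_of_notMem h2]
    by_cases h1 : x ∈ Set.Ioi (0 : ℝ)
    · rw [Set.indicator_of_mem h1, Set.indicator_of_notMem (by simpa using hx), mul_zero]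
    · rw [Set.indicator_of_notMem h1]

/-! ### The law of a Poisson process -/

/-- The law of the arrival times of a Poisson process of rate `r`. -/
structure IsPoissonLaw (μ : Measure (ℕ → ℝ)) (r : ℝ) : Prop where
  prob : IsProbabilityMeasure μ
  regenerative : Regenerative μ (fun a => a 0) tail
  first : μ.map (fun a => a 0) = expMeasure r

/-- The arrivals are the partial sums of the i.i.d. gaps, and `psum` intertwines the shift of the
gap sequence with `tail`. The regenerative property of the shift is thus carried over to arrival
paths. -/
lemma IsPoissonProcess.isPoissonLaw {Ω : Type*} [MeasurableSpace Ω] {P : Measure Ω}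
    [IsProbabilityMeasure P] {arrival : ℕ → Ω → ℝ} {r : ℝ} (h : IsPoissonProcess P arrival r)
    (hr : 0 < r) : IsPoissonLaw (P.map fun ω n => arrival n ω) r := by
  have := isProbabilityMeasure_expMeasure hr
  have hm := h.measurable
  have mpath : Measurable fun ω n => arrival n ω := measurable_pi_lambda _ hm
  set gap : ℕ → Ω → ℝ := fun n ω =>
    if n = 0 then arrival 0 ω else arrival n ω - arrival (n - 1) ω with hgap
  have mgap : ∀ n, Measurable (gap n) := fun n => by
    cases n with
    | zero => simpa [hgap] using hm 0
    | succ n => simpa [hgap] using! (hm (n + 1)).sub (hm n)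
  have lgap : ∀ n, P.map (gap n) = expMeasure r := fun n => by
    cases n with
    | zero => simpa [hgap] using h.law_first
    | succ n => simpa [hgap] using h.law_gap n
  have law : P.map (fun ω n => gap n ω) = Measure.infinitePi fun _ : ℕ => expMeasure r := by
    rw [h.indep.map_fun_eq_infinitePi_map mgap]
    simp_rw [lgap]
  set psum : (ℕ → ℝ) → ℕ → ℝ := fun f n => ∑ i ∈ Finset.range (n + 1), f i with hpsum
  have mpsum : Measurable psum := by fun_prop
  have hpath : (fun ω n => arrival n ω) = psum ∘ fun ω n => gap n ω := by
    funext ω n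
    simp only [hpsum, Function.comp, Finset.sum_range_succ', hgap]
    have := Finset.sum_range_sub (fun i => arrival i ω) n
    simp only [Nat.add_eq_zero_iff, one_ne_zero, and_false, if_false, if_true, Nat.add_sub_cancel]
    linarith
  have law' : P.map (fun ω n => arrival n ω) =
      (Measure.infinitePi fun _ : ℕ => expMeasure r).map psum := by
    rw [hpath, ← Measure.map_map mpsum (measurable_pi_lambda _ mgap), law]
  refine ⟨Measure.isProbabilityMeasure_map mpath.aemeasurable, ?_, ?_⟩
  · rw [law']
    refine (regenerative_infinitePi (expMeasure r)).transport mpsum (measurable_pi_apply 0)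
      measurable_tail (fun f => by simp [hpsum]) fun f => ?_
    funext n
    simp only [tail, hpsum]
    rw [Finset.sum_range_succ' _ (n + 1)]
    simp
  · rw [Measure.map_map (measurable_pi_apply 0) mpath]
    exact h.law_first

/-! ### Absence of explosion and the Markov property of Poisson processes -/

namespace IsPoissonLaw

variable {μ : Measure (ℕ → ℝ)} {r : ℝ}

/-- Disintegration at the first arrival: an exponential time followed by a fresh copy of the path.
It reduces claims about paths to the exponential law. -/
lemma lintegral_eq (h : IsPoissonLaw μ r) (f : (ℕ → ℝ) → ℝ≥0∞) (hf : Measurable f) :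
    ∫⁻ a, f a ∂μ = ∫⁻ x, ∫⁻ a, f (glue x a) ∂μ ∂expMeasure r := by
  have := h.prob
  have m := hf.comp measurable_glue
  have := h.regenerative.lintegral_eq (fun p => f (glue p.1 p.2)) m
  simp only [glue_head_tail] at this
  rw [this, ← h.first, lintegral_map (f := fun x => ∫⁻ a, f (glue x a) ∂μ)
    m.lintegral_prod_right' (measurable_pi_apply 0)]

/-- Explosion is excluded by a contraction. For `f a = inf exp (-a n)`, restarting at the first
arrival gives `∫ f ≤ c ∫ f` with `c = E exp (-x) < 1`; hence `f = 0` almost surely, that is, the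
arrivals are unbounded. -/
lemma ae_good (h : IsPoissonLaw μ r) (hr : 0 < r) : ∀ᵐ a ∂μ, Good a := by
  have := h.prob
  have := isProbabilityMeasure_expMeasure hr
  have h0 : ∀ᵐ a ∂μ, 0 < a 0 := by
    have := ae_pos_expMeasure r
    rw [← h.first] at this
    exact ae_of_ae_map (measurable_pi_apply 0).aemeasurable this
  -- The iterates of `tail` restart the path at successive arrivals and preserve the law, so every
  -- gap is as positive as the first arrival.
  have hgap : ∀ᵐ a ∂μ, ∀ n, 0 < (tail^[n] a) 0 := ae_all_iff.2 fun n =>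
    (h.regenerative.measurePreserving.iterate n).quasiMeasurePreserving.ae h0
  have hit : ∀ n (a : ℕ → ℝ), tail^[n + 1] a = fun m => a (n + 1 + m) - a n := by
    intro n
    induction n with
    | zero => intro a; funext m; simp [tail, add_comm]
    | succ n ih =>
      intro a
      funext m
      rw [Function.iterate_succ_apply', ih]
      simp only [tail, add_zero]
      rw [show n + 1 + (m + 1) = n + 1 + 1 + m by ring]
      ring
  set f : (ℕ → ℝ) → ℝ≥0∞ := fun a => ⨅ n, ENNReal.ofReal (Real.exp (-a n)) with hf
  have mf : Measurable f := by
    refine Measurable.iInf fun n => ?_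
    fun_prop
  set c := ∫⁻ x, ENNReal.ofReal (Real.exp (-x)) ∂expMeasure r with hc
  have hc1 : c < 1 := by
    have : c < ∫⁻ _, 1 ∂expMeasure r := by
      refine lintegral_strict_mono (IsProbabilityMeasure.ne_zero _) measurable_const.aemeasurable ?_ ?_
      · refine ne_top_of_le_ne_top ENNReal.one_ne_top ?_
        calc c ≤ ∫⁻ _, 1 ∂expMeasure r := lintegral_mono_ae (by
              filter_upwards [ae_pos_expMeasure r] with x hx
              simpa using hx.le)
          _ = 1 := by simp
      · filter_upwards [ae_pos_expMeasure r] with x hx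
        simpa using hx
    simpa using this
  have hfle : ∀ x a, f (glue x a) ≤ ENNReal.ofReal (Real.exp (-x)) * f a := by
    intro x a
    simp only [hf]
    rw [ENNReal.mul_iInf_of_ne (by simp [Real.exp_pos]) ENNReal.ofReal_ne_top]
    refine le_iInf fun n => (iInf_le _ (n + 1)).trans ?_
    rw [← ENNReal.ofReal_mul (Real.exp_nonneg _), ← Real.exp_add]
    simp only [glue]
    rw [neg_add]
  have hfint : ∫⁻ a, f a ∂μ ≤ c * ∫⁻ a, f a ∂μ := by
    conv_lhs => rw [h.lintegral_eq f mf]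
    calc _ ≤ ∫⁻ x, ∫⁻ a, ENNReal.ofReal (Real.exp (-x)) * f a ∂μ ∂expMeasure r :=
          lintegral_mono fun x => lintegral_mono fun a => hfle x a
      _ = _ := by
          simp_rw [lintegral_const_mul _ mf]
          rw [lintegral_mul_const _ (by fun_prop)]
  -- Finiteness is what makes `∫ f ≤ c ∫ f` force `∫ f = 0`.
  have hffin : ∫⁻ a, f a ∂μ ≠ ∞ := by
    refine ne_top_of_le_ne_top ENNReal.one_ne_top ?_
    calc ∫⁻ a, f a ∂μ ≤ ∫⁻ _, 1 ∂μ := lintegral_mono_ae (by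
            filter_upwards [h0] with a ha
            refine (iInf_le _ 0).trans ?_
            simpa using ha.le)
      _ = 1 := by simp
  have hzero : ∫⁻ a, f a ∂μ = 0 := by
    by_contra hne
    have : c * ∫⁻ a, f a ∂μ < 1 * ∫⁻ a, f a ∂μ :=
      ENNReal.mul_lt_mul_left hne hffin hc1
    rw [one_mul] at this
    exact absurd hfint (not_le.2 this)
  filter_upwards [h0, hgap, (lintegral_eq_zero_iff mf).1 hzero] with a ha hg hz
  refine ⟨ha, strictMono_nat_of_lt_succ fun n => ?_, fun t => ?_⟩
  · have := hg (n + 1)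
    rw [hit] at this
    simpa using this
  · have : f a < ENNReal.ofReal (Real.exp (-t)) := by
      rw [hz]
      simp [Real.exp_pos]
    obtain ⟨n, hn⟩ := iInf_lt_iff.1 this
    refine ⟨n, ?_⟩
    simpa using (ENNReal.ofReal_lt_ofReal_iff (Real.exp_pos _)).1 hn

/-- The Markov property at a deterministic time, on the event of `n` previous arrivals. -/
lemma lintegral_shift_count (h : IsPoissonLaw μ r) (hr : 0 < r) (n : ℕ) {c : ℝ} (hc : 0 ≤ c)
    (K : (ℕ → ℝ) × (ℕ → ℝ) → ℝ≥0∞) (hK : Measurable K)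
    (hKc : ∀ a b y, Good a → Good b → Agree c a b → K (a, y) = K (b, y)) :
    ∫⁻ a, (if countUpTo a c = n then K (a, shift a c) else 0) ∂μ =
      ∫⁻ a, (if countUpTo a c = n then ∫⁻ b, K (a, b) ∂μ else 0) ∂μ := by
  have := h.prob
  have := isProbabilityMeasure_expMeasure hr
  have hgood := h.ae_good hr
  have mcount : ∀ c n, MeasurableSet {a : ℕ → ℝ | countUpTo a c = n} := fun c n =>
    (measurable_countUpTo.comp (measurable_id.prodMk measurable_const)) (measurableSet_singleton n)
  have mshift : ∀ c, Measurable fun a : ℕ → ℝ => shift a c := fun c =>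
    measurable_shift.comp (measurable_id.prodMk measurable_const)
  have mL : ∀ c n (K : (ℕ → ℝ) × (ℕ → ℝ) → ℝ≥0∞), Measurable K →
      Measurable fun a => if countUpTo a c = n then K (a, shift a c) else 0 := fun c n K hK =>
    Measurable.ite (mcount c n) (hK.comp (measurable_id.prodMk (mshift c))) measurable_const
  have mR : ∀ c n (K : (ℕ → ℝ) × (ℕ → ℝ) → ℝ≥0∞), Measurable K →
      Measurable fun a => if countUpTo a c = n then ∫⁻ b, K (a, b) ∂μ else 0 := fun c n K hK =>
    Measurable.ite (mcount c n) hK.lintegral_prod_right' measurable_const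
  induction n generalizing c K with
  | zero =>
    -- Any good path without arrivals up to `c` serves for comparison: on the event of no arrivals,
    -- `K` takes the same value as at `b₀`.
    set b₀ : ℕ → ℝ := fun n => c + 1 + n with hb₀
    have hb : Good b₀ := ⟨by simp only [hb₀]; push_cast; linarith,
      strictMono_nat_of_lt_succ fun n => by simp [hb₀], fun t => by
        obtain ⟨n, hn⟩ := exists_nat_gt t
        exact ⟨n, by simp only [hb₀]; linarith⟩⟩
    have hk : ∀ x a y, 0 < x → Good a → c < x → K (glue x a, y) = K (b₀, y) := by
      intro x a y hx ha hcx
      refine hKc _ _ _ (ha.glue hx) hb fun n hn => ?_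
      have h1 : c < glue x a n := hcx.trans_le ((ha.glue hx).mono.monotone n.zero_le)
      have h2 : c < b₀ n := by simp only [hb₀]; linarith [n.cast_nonneg (α := ℝ)]
      exact absurd hn (by rw [not_or, not_le, not_le]; exact ⟨h1, h2⟩)
    rw [h.lintegral_eq _ (mL c 0 K hK), h.lintegral_eq _ (mR c 0 K hK)]
    set k : (ℕ → ℝ) → ℝ≥0∞ := fun y => K (b₀, y) with hkdef
    have mk : Measurable k := hK.comp (measurable_const.prodMk measurable_id)
    -- By memorylessness the overshoot of the first arrival beyond `c` is exponential again, so both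
    -- sides equal `exp (-(r * c)) * ∫ k`.
    have e1 := lintegral_expMeasure_sub (r := r) hc (fun x => ∫⁻ a, k (glue x a) ∂μ)
      (mk.comp measurable_glue).lintegral_prod_right'
    have e2 := lintegral_expMeasure_sub (r := r) hc (fun _ => ∫⁻ a, k a ∂μ) measurable_const
    rw [← h.lintegral_eq k mk] at e1
    rw [lintegral_const, measure_univ, mul_one] at e2
    refine Eq.trans ?_ (e1.trans e2.symm |>.trans ?_)
    · refine lintegral_congr_ae ?_
      filter_upwards [ae_pos_expMeasure r] with x hx
      by_cases hcx : c < x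
      · rw [Set.indicator_of_mem (Set.mem_Ioi.2 hcx)]
        refine lintegral_congr_ae ?_
        filter_upwards [hgood] with a ha
        rw [if_pos (ha.count_glue_of_lt hx hcx), ha.shift_glue_of_lt hx hcx, hk x a _ hx ha hcx]
      · rw [Set.indicator_of_notMem (by simpa using hcx)]
        refine Eq.trans (lintegral_congr_ae ?_) lintegral_zero
        filter_upwards [hgood] with a ha
        rw [if_neg (by rw [ha.count_glue hx (not_lt.1 hcx)]; omega)]
    · refine lintegral_congr_ae ?_
      filter_upwards [ae_pos_expMeasure r] with x hx
      by_cases hcx : c < x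
      · rw [Set.indicator_of_mem (Set.mem_Ioi.2 hcx)]
        have : ∫⁻ a, k a ∂μ = ∫⁻ _ : ℕ → ℝ, ∫⁻ a, k a ∂μ ∂μ := by simp
        rw [this]
        refine lintegral_congr_ae ?_
        filter_upwards [hgood] with a ha
        rw [if_pos (ha.count_glue_of_lt hx hcx)]
        exact lintegral_congr fun y => (hk x a y hx ha hcx).symm
      · rw [Set.indicator_of_notMem (by simpa using hcx)]
        refine Eq.trans lintegral_zero.symm (lintegral_congr_ae ?_)
        filter_upwards [hgood] with a ha
        rw [if_neg (by rw [ha.count_glue hx (not_lt.1 hcx)]; omega)]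
  | succ n ih =>
    rw [h.lintegral_eq _ (mL c (n + 1) K hK), h.lintegral_eq _ (mR c (n + 1) K hK)]
    refine lintegral_congr_ae ?_
    filter_upwards [ae_pos_expMeasure r] with x hx
    by_cases hcx : x ≤ c
    · have mKx : Measurable fun p : (ℕ → ℝ) × (ℕ → ℝ) => K (glue x p.1, p.2) :=
        hK.comp ((measurable_glue.comp (measurable_const.prodMk measurable_fst)).prodMk
          measurable_snd)
      -- After a first arrival at `x ≤ c`, there remain `n` arrivals up to time `c - x` of the
      -- continued path.
      have := ih (sub_nonneg.2 hcx) (fun p => K (glue x p.1, p.2)) mKx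
        fun a b y ha hb hab => hKc _ _ _ (ha.glue hx) (hb.glue hx) hab.glue
      refine Eq.trans (lintegral_congr_ae ?_) (this.trans (lintegral_congr_ae ?_))
      · filter_upwards [hgood] with a ha
        simp only [ha.count_glue hx hcx, ha.shift_glue hx hcx, Nat.add_right_cancel_iff]
      · filter_upwards [hgood] with a ha
        simp only [ha.count_glue hx hcx, Nat.add_right_cancel_iff]
    · refine lintegral_congr_ae ?_
      filter_upwards [hgood] with a ha
      simp [ha.count_glue_of_lt hx (not_le.1 hcx)]

/-- The Markov property at a deterministic time. -/
lemma lintegral_shift (h : IsPoissonLaw μ r) (hr : 0 < r) {c : ℝ} (hc : 0 ≤ c)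
    (K : (ℕ → ℝ) × (ℕ → ℝ) → ℝ≥0∞) (hK : Measurable K)
    (hKc : ∀ a b y, Good a → Good b → Agree c a b → K (a, y) = K (b, y)) :
    ∫⁻ a, K (a, shift a c) ∂μ = ∫⁻ a, ∫⁻ b, K (a, b) ∂μ ∂μ := by
  have := h.prob
  have mcount : ∀ n, MeasurableSet {a : ℕ → ℝ | countUpTo a c = n} := fun n =>
    (measurable_countUpTo.comp (measurable_id.prodMk measurable_const)) (measurableSet_singleton n)
  have split : ∀ F : (ℕ → ℝ) → ℝ≥0∞, Measurable F →
      ∫⁻ a, F a ∂μ = ∑' n, ∫⁻ a, (if countUpTo a c = n then F a else 0) ∂μ := by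
    intro F hF
    rw [← lintegral_tsum fun n => (Measurable.ite (mcount n) hF measurable_const).aemeasurable]
    refine lintegral_congr fun a => ?_
    rw [tsum_eq_single (countUpTo a c) fun n hn => if_neg hn.symm, if_pos rfl]
  have mshift : Measurable fun a : ℕ → ℝ => shift a c :=
    measurable_shift.comp (measurable_id.prodMk measurable_const)
  rw [split (fun a => K (a, shift a c)) (hK.comp (measurable_id.prodMk mshift)), split _ hK.lintegral_prod_right']
  exact tsum_congr fun n => h.lintegral_shift_count hr n hc K hK hKc

/-- The Markov property at the maximum of the first arrival and a deterministic time. -/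
lemma lintegral_shift_max (h : IsPoissonLaw μ r) (hr : 0 < r) {c : ℝ}
    (K : (ℕ → ℝ) × (ℕ → ℝ) → ℝ≥0∞) (hK : Measurable K)
    (hKc : ∀ a b y, Good a → Good b → Agree (max (a 0) c) a b → K (a, y) = K (b, y)) :
    ∫⁻ a, K (a, shift a (max (a 0) c)) ∂μ = ∫⁻ a, ∫⁻ b, K (a, b) ∂μ ∂μ := by
  have := h.prob
  have hgood := h.ae_good hr
  have mshift : Measurable fun a : ℕ → ℝ => shift a (max (a 0) c) :=
    measurable_shift.comp (measurable_id.prodMk ((measurable_pi_apply 0).max measurable_const))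
  rw [h.lintegral_eq (fun a => K (a, shift a (max (a 0) c)))
      (hK.comp (measurable_id.prodMk mshift)),
    h.lintegral_eq _ hK.lintegral_prod_right']
  refine lintegral_congr_ae ?_
  filter_upwards [ae_pos_expMeasure r] with x hx
  have hx0 : ∀ a, glue x a 0 = x := fun _ => rfl
  -- If the first arrival `x` is at most `c`, the time is `c`, which the path after `x` sees as the
  -- deterministic time `c - x`. Otherwise the time is `x` itself, and the path seen from there is
  -- the fresh copy.
  by_cases hcx : x ≤ c
  · have mKx : Measurable fun p : (ℕ → ℝ) × (ℕ → ℝ) => K (glue x p.1, p.2) :=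
      hK.comp ((measurable_glue.comp (measurable_const.prodMk measurable_fst)).prodMk
        measurable_snd)
    have := h.lintegral_shift hr (sub_nonneg.2 hcx) (fun p => K (glue x p.1, p.2)) mKx
      fun a b y ha hb hab => hKc _ _ _ (ha.glue hx) (hb.glue hx) (by
        rw [hx0, max_eq_right hcx]
        exact hab.glue)
    refine Eq.trans (lintegral_congr_ae ?_) this
    filter_upwards [hgood] with a ha
    simp only [hx0, max_eq_right hcx, ha.shift_glue hx hcx]
  · have hmax : max x c = x := max_eq_left (not_le.1 hcx).le
    have hk : ∀ a b y, Good a → Good b → K (glue x a, y) = K (glue x b, y) := by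
      intro a b y ha hb
      refine hKc _ _ _ (ha.glue hx) (hb.glue hx) ?_
      rw [hx0, hmax]
      have : Agree (x - x) a b := fun n hn => absurd hn (by
        rw [sub_self, not_or, not_le, not_le]
        exact ⟨ha.pos' n, hb.pos' n⟩)
      exact this.glue
    have e : ∀ᵐ a ∂μ, ∫⁻ b, K (glue x a, b) ∂μ = ∫⁻ b, K (glue x b, b) ∂μ := by
      filter_upwards [hgood] with a ha
      refine lintegral_congr_ae ?_
      filter_upwards [hgood] with b hb using hk a b b ha hb
    rw [lintegral_congr_ae e, lintegral_const, measure_univ, mul_one]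
    refine lintegral_congr_ae ?_
    filter_upwards [hgood] with a ha
    simp only [hx0, hmax, ha.shift_glue_self hx]

lemma measurePreserving_shift (h : IsPoissonLaw μ r) (hr : 0 < r) {c : ℝ} (hc : 0 ≤ c) :
    MeasurePreserving (fun a => shift a c) μ μ := by
  have := h.prob
  have mshift : Measurable fun a : ℕ → ℝ => shift a c :=
    measurable_shift.comp (measurable_id.prodMk measurable_const)
  refine ⟨mshift, Measure.ext_of_lintegral _ fun H hH => ?_⟩
  rw [lintegral_map hH mshift]
  simpa using h.lintegral_shift hr hc (fun p => H p.2) (hH.comp measurable_snd)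
    fun _ _ _ _ _ _ => rfl

end IsPoissonLaw

/-! ### One transmission attempt -/

@[fun_prop]
lemma measurable_shift_comp {α : Type*} [MeasurableSpace α] {f : α → ℕ → ℝ} {g : α → ℝ}
    (hf : Measurable f) (hg : Measurable g) : Measurable fun x => shift (f x) (g x) :=
  measurable_shift.comp (hf.prodMk hg)

@[fun_prop]
lemma measurable_lastUpTo_comp {α : Type*} [MeasurableSpace α] {f : α → ℕ → ℝ} {g : α → ℝ}
    (hf : Measurable f) (hg : Measurable g) : Measurable fun x => lastUpTo (f x) (g x) :=
  measurable_lastUpTo.comp (hf.prodMk hg)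

/-- The waiting time `max{e, d, γ}` of an attempt, given the energy and data arrivals. -/
def attemptWait (γ : ℝ) (a b : ℕ → ℝ) : ℝ := max (max (a 0) (b 0)) γ

/-- The age of the packet that is sent by an attempt, given the energy and data arrivals. -/
noncomputable def attemptAge (γ : ℝ) (a b : ℕ → ℝ) : ℝ :=
  attemptWait γ a b - lastUpTo b (attemptWait γ a b)

@[fun_prop]
lemma measurable_attemptWait {α : Type*} [MeasurableSpace α] {γ : ℝ} {f g : α → ℕ → ℝ}
    (hf : Measurable f) (hg : Measurable g) : Measurable fun x => attemptWait γ (f x) (g x) := by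
  unfold attemptWait
  fun_prop

@[fun_prop]
lemma measurable_attemptAge {α : Type*} [MeasurableSpace α] {γ : ℝ} {f g : α → ℕ → ℝ}
    (hf : Measurable f) (hg : Measurable g) : Measurable fun x => attemptAge γ (f x) (g x) := by
  unfold attemptAge
  fun_prop

/-- Two groupings of the same maximum: with one of the paths frozen, the time of the attempt is the
maximum of the first arrival of the other path and a constant, as `lintegral_shift_max` requires. -/
lemma attemptWait_eq_left (γ : ℝ) (a b : ℕ → ℝ) :
    attemptWait γ a b = max (a 0) (max (b 0) γ) := max_assoc _ _ _

lemma attemptWait_eq_right (γ : ℝ) (a b : ℕ → ℝ) :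
    attemptWait γ a b = max (b 0) (max (a 0) γ) := by
  rw [attemptWait_eq_left, max_left_comm]

lemma attemptWait_nonneg {γ : ℝ} (hγ : 0 ≤ γ) (a b : ℕ → ℝ) : 0 ≤ attemptWait γ a b :=
  hγ.trans (le_max_right _ _)

/-- The Markov property of two independent Poisson processes at the time of an attempt. -/
lemma lintegral_attempt_pair {μ ν : Measure (ℕ → ℝ)} {r s γ : ℝ} (hμ : IsPoissonLaw μ r)
    (hν : IsPoissonLaw ν s) (hr : 0 < r) (hs : 0 < s)
    (H : (ℝ × ℝ) × (ℕ → ℝ) × (ℕ → ℝ) → ℝ≥0∞) (hH : Measurable H) :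
    ∫⁻ a, ∫⁻ b, H ((attemptWait γ a b, attemptAge γ a b),
        (shift a (attemptWait γ a b), shift b (attemptWait γ a b))) ∂ν ∂μ =
      ∫⁻ a, ∫⁻ b, ∫⁻ a', ∫⁻ b', H ((attemptWait γ a b, attemptAge γ a b), (a', b')) ∂ν ∂μ ∂ν ∂μ := by
  have := hμ.prob
  have := hν.prob
  calc _ = ∫⁻ a, ∫⁻ b, ∫⁻ b', H ((attemptWait γ a b, attemptAge γ a b),
        (shift a (attemptWait γ a b), b')) ∂ν ∂ν ∂μ := by
        refine lintegral_congr fun a => ?_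
        -- The energy path is frozen and the data path is resampled first. The age of the packet
        -- depends on the data up to the attempt only, so the observation may stay inside.
        have := hν.lintegral_shift_max hs (c := max (a 0) γ) (fun p =>
          H ((attemptWait γ a p.1, attemptAge γ a p.1), (shift a (attemptWait γ a p.1), p.2)))
          (by fun_prop) fun b b' y hb hb' hag => by
            have h0 : b 0 = b' 0 := hag 0 (.inl (le_max_left _ _))
            have hw : attemptWait γ a b = attemptWait γ a b' := by simp only [attemptWait, h0]
            have hle : b 0 ≤ attemptWait γ a b := by
              rw [attemptWait_eq_right]; exact le_max_left _ _
            rw [← attemptWait_eq_right] at hag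
            simp only [attemptAge, ← hw, hb.lastUpTo_congr hb' hle hag]
        simpa only [← attemptWait_eq_right] using this
    _ = ∫⁻ b, ∫⁻ a, ∫⁻ b', H ((attemptWait γ a b, attemptAge γ a b),
        (shift a (attemptWait γ a b), b')) ∂ν ∂μ ∂ν := lintegral_lintegral_swap
          (Measurable.aemeasurable (Measurable.lintegral_prod_right' (f := fun p :
            ((ℕ → ℝ) × (ℕ → ℝ)) × (ℕ → ℝ) => H ((attemptWait γ p.1.1 p.1.2,
            attemptAge γ p.1.1 p.1.2), (shift p.1.1 (attemptWait γ p.1.1 p.1.2), p.2)))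
            (by fun_prop)))
    _ = ∫⁻ b, ∫⁻ a, ∫⁻ a', ∫⁻ b', H ((attemptWait γ a b, attemptAge γ a b), (a', b'))
          ∂ν ∂μ ∂μ ∂ν := by
        refine lintegral_congr fun b => ?_
        -- Now the data path is frozen; the observation depends on the energy path through its first
        -- arrival alone.
        have := hμ.lintegral_shift_max hr (c := max (b 0) γ) (fun p => ∫⁻ b',
          H ((attemptWait γ p.1 b, attemptAge γ p.1 b), (p.2, b')) ∂ν)
          (Measurable.lintegral_prod_right' (f := fun p : ((ℕ → ℝ) × (ℕ → ℝ)) × (ℕ → ℝ) =>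
            H ((attemptWait γ p.1.1 b, attemptAge γ p.1.1 b), (p.1.2, p.2))) (by fun_prop))
          fun a a' y ha ha' hag => by
            have h0 : a 0 = a' 0 := hag 0 (.inl (le_max_left _ _))
            simp only [attemptAge, attemptWait, h0]
        simpa only [← attemptWait_eq_left] using this
    _ = _ := lintegral_lintegral_swap (Measurable.aemeasurable
          (Measurable.lintegral_prod_right' (f := fun p : ((ℕ → ℝ) × (ℕ → ℝ)) × (ℕ → ℝ) =>
            ∫⁻ b', H ((attemptWait γ p.1.2 p.1.1, attemptAge γ p.1.2 p.1.1), (p.2, b')) ∂ν)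
          (Measurable.lintegral_prod_right' (f := fun p :
            (((ℕ → ℝ) × (ℕ → ℝ)) × (ℕ → ℝ)) × (ℕ → ℝ) =>
            H ((attemptWait γ p.1.1.2 p.1.1.1, attemptAge γ p.1.1.2 p.1.1.1), (p.1.2, p.2)))
            (by fun_prop))))

/-- Resampling one coordinate of a product measure. -/
lemma map_update_pi {ι : Type*} [Fintype ι] [DecidableEq ι] {α : Type*} [MeasurableSpace α]
    (ν : ι → Measure α) [∀ i, IsProbabilityMeasure (ν i)] (s : ι) :
    ((Measure.pi ν).prod (ν s)).map (fun p => Function.update p.1 s p.2) = Measure.pi ν := by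
  symm
  refine Measure.pi_eq fun t ht => ?_
  have hm : Measurable fun p : (ι → α) × α => Function.update p.1 s p.2 := by fun_prop
  have hpre : (fun p : (ι → α) × α => Function.update p.1 s p.2) ⁻¹' Set.univ.pi t =
      Set.univ.pi (Function.update t s Set.univ) ×ˢ t s := by
    ext p
    simp only [Set.mem_preimage, Set.mem_univ_pi, Set.mem_prod]
    constructor
    · refine fun h => ⟨fun i => ?_, by simpa using h s⟩
      by_cases hi : i = s
      · subst hi; simp
      · simpa [hi] using h i
    · rintro ⟨h1, h2⟩ i
      by_cases hi : i = s
      · subst hi; simpa using h2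
      · simpa [hi] using h1 i
  rw [Measure.map_apply hm (.univ_pi ht), hpre, Measure.prod_prod, Measure.pi_pi,
    ← Finset.mul_prod_erase _ _ (Finset.mem_univ s), ← Finset.mul_prod_erase _ _ (Finset.mem_univ s)]
  simp only [Function.update_self, measure_univ, one_mul]
  rw [mul_comm]
  congr 1
  refine Finset.prod_congr rfl fun i hi => ?_
  rw [Function.update_of_ne (Finset.ne_of_mem_erase hi)]

/-- The arrivals of energy, the arrivals of data of each source, and the erasures. -/
abbrev Sys (N : ℕ) : Type := (ℕ → ℝ) × (Fin N → ℕ → ℝ) × (ℕ → Bool)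

section Attempt

variable {N : ℕ}

/-- The waiting time, the age of the packet sent, and the erasure of the next attempt, which is for
source `s`. -/
noncomputable def attemptObs (γ : ℝ) (s : Fin N) (y : Sys N) : (ℝ × ℝ) × Bool :=
  ((attemptWait γ y.1 (y.2.1 s), attemptAge γ y.1 (y.2.1 s)), y.2.2 0)

/-- The system after the next attempt, which is for source `s`. -/
noncomputable def attemptNext (γ : ℝ) (s : Fin N) (y : Sys N) : Sys N :=
  (shift y.1 (attemptWait γ y.1 (y.2.1 s)),
    fun κ => shift (y.2.1 κ) (attemptWait γ y.1 (y.2.1 s)), fun n => y.2.2 (n + 1))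

/-- The law of the system: independent Poisson arrivals and i.i.d. erasures. -/
structure IsSysLaw (Θ : Measure (Sys N)) (lamE : ℝ) (lamD : Fin N → ℝ) (q : ℝ)
    (μ : Measure (ℕ → ℝ)) (ν : Fin N → Measure (ℕ → ℝ)) (β : Measure (ℕ → Bool)) : Prop where
  eq : Θ = μ.prod ((Measure.pi ν).prod β)
  energy : IsPoissonLaw μ lamE
  data : ∀ j, IsPoissonLaw (ν j) (lamD j)
  prob : IsProbabilityMeasure β
  erased : Regenerative β (fun b => b 0) (fun b n => b (n + 1))
  erased_true : β {b | b 0 = true} = ENNReal.ofReal q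

lemma IsSysLaw.isProbabilityMeasure {Θ : Measure (Sys N)} {lamE : ℝ} {lamD : Fin N → ℝ} {q : ℝ}
    {μ : Measure (ℕ → ℝ)} {ν : Fin N → Measure (ℕ → ℝ)} {β : Measure (ℕ → Bool)}
    (h : IsSysLaw Θ lamE lamD q μ ν β) : IsProbabilityMeasure Θ := by
  have := h.energy.prob
  have := fun j => (h.data j).prob
  have := h.prob
  rw [h.eq]
  infer_instance

/-- The time of the attempt is determined by the energy and by the data of source `s`;
`lintegral_attempt_pair` treats these two. Given them, that time is a constant for the independent
data of the other sources, whose law is invariant under such a shift, and the erasures regenerate on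
their own. -/
lemma IsSysLaw.attempt {Θ : Measure (Sys N)} {lamE : ℝ} {lamD : Fin N → ℝ} {q : ℝ}
    {μ : Measure (ℕ → ℝ)} {ν : Fin N → Measure (ℕ → ℝ)} {β : Measure (ℕ → Bool)}
    (h : IsSysLaw Θ lamE lamD q μ ν β) (hE : 0 < lamE) (hD : ∀ j, 0 < lamD j) {γ : ℝ} (hγ : 0 ≤ γ)
    (s : Fin N) : Regenerative Θ (attemptObs γ s) (attemptNext γ s) := by
  have := h.energy.prob
  have := fun j => (h.data j).prob
  have := h.prob
  have mobs : Measurable (attemptObs γ s : Sys N → _) := by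
    unfold attemptObs
    fun_prop
  have mnext : Measurable (attemptNext γ s : Sys N → _) := by
    unfold attemptNext
    fun_prop
  refine ⟨mobs, mnext, fun H hH => ?_⟩
  have mup : Measurable fun p : (Fin N → ℕ → ℝ) × (ℕ → ℝ) => Function.update p.1 s p.2 := by
    fun_prop
  -- Coordinate `s` is integrated separately from the others; coordinate `s` of the remaining `D`
  -- becomes a dummy.
  have resample : ∀ f : (Fin N → ℕ → ℝ) → ℝ≥0∞, Measurable f →
      ∫⁻ D, f D ∂Measure.pi ν = ∫⁻ a, ∫⁻ D, f (Function.update D s a) ∂Measure.pi ν ∂ν s := by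
    intro f hf
    conv_lhs => rw [← map_update_pi ν s]
    rw [lintegral_map hf mup, lintegral_prod_symm' (fun p => f (Function.update p.1 s p.2))
      (hf.comp mup)]
  set H1 : (ℝ × ℝ) × (ℕ → ℝ) × (Fin N → ℕ → ℝ) → ℝ≥0∞ := fun p =>
    ∫⁻ b, ∫⁻ b', H ((p.1, b 0), (p.2.1, p.2.2, b')) ∂β ∂β with hH1
  have mH1 : Measurable H1 := Measurable.lintegral_prod_right'
    (f := fun p : ((ℝ × ℝ) × (ℕ → ℝ) × (Fin N → ℕ → ℝ)) × (ℕ → Bool) =>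
      ∫⁻ b', H ((p.1.1, p.2 0), (p.1.2.1, p.1.2.2, b')) ∂β)
    (Measurable.lintegral_prod_right' (f := fun p :
      (((ℝ × ℝ) × (ℕ → ℝ) × (Fin N → ℕ → ℝ)) × (ℕ → Bool)) × (ℕ → Bool) =>
      H ((p.1.1.1, p.1.2 0), (p.1.1.2.1, p.1.1.2.2, p.2))) (by fun_prop))
  set H2 : (ℝ × ℝ) × (ℕ → ℝ) × (ℕ → ℝ) → ℝ≥0∞ := fun p =>
    ∫⁻ D, H1 (p.1, (p.2.1, Function.update D s p.2.2)) ∂Measure.pi ν with hH2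
  have mH2 : Measurable H2 := Measurable.lintegral_prod_right'
    (f := fun p : ((ℝ × ℝ) × (ℕ → ℝ) × (ℕ → ℝ)) × (Fin N → ℕ → ℝ) =>
      H1 (p.1.1, (p.1.2.1, Function.update p.2 s p.1.2.2))) (by fun_prop)
  have hmarg : ∀ (p : ℝ × ℝ) (a' : ℕ → ℝ), ∫⁻ b', H2 (p, (a', b')) ∂ν s =
      ∫⁻ D, H1 (p, (a', D)) ∂Measure.pi ν := fun p a' =>
    (resample (fun D => H1 (p, (a', D))) (by fun_prop)).symm
  have left : ∫⁻ y, H (attemptObs γ s y, attemptNext γ s y) ∂Θ =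
      ∫⁻ a, ∫⁻ b, H2 ((attemptWait γ a b, attemptAge γ a b),
        (shift a (attemptWait γ a b), shift b (attemptWait γ a b))) ∂ν s ∂μ := by
    have mf : Measurable fun y : Sys N => H (attemptObs γ s y, attemptNext γ s y) := by fun_prop
    rw [h.eq, lintegral_prod _ mf.aemeasurable]
    refine lintegral_congr fun a => ?_
    rw [lintegral_prod _ (by fun_prop)]
    calc _ = ∫⁻ D, H1 ((attemptWait γ a (D s), attemptAge γ a (D s)),
          (shift a (attemptWait γ a (D s)), fun κ => shift (D κ) (attemptWait γ a (D s))))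
            ∂Measure.pi ν := lintegral_congr fun D => h.erased.lintegral_eq (fun p =>
          H (((attemptWait γ a (D s), attemptAge γ a (D s)), p.1),
            (shift a (attemptWait γ a (D s)), fun κ => shift (D κ) (attemptWait γ a (D s)), p.2)))
            (by fun_prop)
      _ = _ := by
        rw [resample _ (by fun_prop)]
        refine lintegral_congr fun b => ?_
        -- With `a` and `b` fixed, all coordinates of `D` are shifted by the same constant. This
        -- includes the dummy coordinate `s`, which the update overwrites by the shift of `b`.
        have hpres : MeasurePreserving (fun (D : Fin N → ℕ → ℝ) κ =>
            shift (D κ) (attemptWait γ a b)) (Measure.pi ν) (Measure.pi ν) :=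
          measurePreserving_pi ν ν fun κ =>
            (h.data κ).measurePreserving_shift (hD κ) (attemptWait_nonneg hγ a b)
        rw [hH2]
        dsimp only
        conv_rhs => rw [← hpres.map_eq]
        rw [lintegral_map (by fun_prop) hpres.measurable]
        refine lintegral_congr fun D => ?_
        simp only [Function.update_self]
        congr 3
        funext κ
        by_cases hκ : κ = s
        · subst hκ; simp
        · simp [hκ]
  rw [left, lintegral_attempt_pair h.energy (h.data s) hE (hD s) H2 mH2, h.eq, lintegral_prod _
    (Measurable.aemeasurable (Measurable.lintegral_prod_right' (f := fun p : Sys N × Sys N =>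
      H (attemptObs γ s p.1, p.2)) (by fun_prop)))]
  refine lintegral_congr fun a => ?_
  simp only [hmarg]
  set G : ℝ × ℝ → ℝ≥0∞ := fun p => ∫⁻ a', ∫⁻ D, H1 (p, (a', D)) ∂Measure.pi ν ∂μ with hG
  have mG : Measurable G := Measurable.lintegral_prod_right'
    (f := fun p : (ℝ × ℝ) × (ℕ → ℝ) => ∫⁻ D, H1 (p.1, (p.2, D)) ∂Measure.pi ν)
    (Measurable.lintegral_prod_right' (f := fun p : ((ℝ × ℝ) × (ℕ → ℝ)) × (Fin N → ℕ → ℝ) =>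
      H1 (p.1.1, (p.1.2, p.2))) (by fun_prop))
  have hswap : ∀ p : ℝ × ℝ, G p = ∫⁻ b, ∫⁻ y', H ((p, b 0), y') ∂(μ.prod ((Measure.pi ν).prod β)) ∂β := by
    intro p
    have mK : Measurable fun z : ((ℕ → ℝ) × (Fin N → ℕ → ℝ)) × (ℕ → Bool) =>
        ∫⁻ b', H ((p, z.2 0), (z.1.1, z.1.2, b')) ∂β := Measurable.lintegral_prod_right'
      (f := fun z : (((ℕ → ℝ) × (Fin N → ℕ → ℝ)) × (ℕ → Bool)) × (ℕ → Bool) =>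
        H ((p, z.1.2 0), (z.1.1.1, z.1.1.2, z.2))) (by fun_prop)
    calc G p = ∫⁻ z, ∫⁻ b, ∫⁻ b', H ((p, b 0), (z.1, z.2, b')) ∂β ∂β ∂(μ.prod (Measure.pi ν)) :=
          (lintegral_prod (fun z : (ℕ → ℝ) × (Fin N → ℕ → ℝ) => H1 (p, z))
            (by fun_prop)).symm
      _ = ∫⁻ b, ∫⁻ z, ∫⁻ b', H ((p, b 0), (z.1, z.2, b')) ∂β ∂(μ.prod (Measure.pi ν)) ∂β :=
          lintegral_lintegral_swap mK.aemeasurable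
      _ = _ := by
          refine lintegral_congr fun b => ?_
          rw [lintegral_prod _ (by fun_prop), lintegral_prod _ (by fun_prop)]
          refine lintegral_congr fun a' => ?_
          rw [lintegral_prod _ (by fun_prop)]
  have hmp := measurePreserving_eval ν s
  calc ∫⁻ b, G (attemptWait γ a b, attemptAge γ a b) ∂ν s
      = ∫⁻ D, G (attemptWait γ a (D s), attemptAge γ a (D s)) ∂Measure.pi ν := by
        rw [← hmp.map_eq, lintegral_map (by fun_prop) hmp.measurable]
    _ = _ := by
        rw [lintegral_prod _ (Measurable.aemeasurable (Measurable.lintegral_prod_right' (f := fun p :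
          ((Fin N → ℕ → ℝ) × (ℕ → Bool)) × Sys N => H (attemptObs γ s (a, p.1), p.2)) (by fun_prop)))]
        exact lintegral_congr fun D => hswap _

end Attempt

/-! ### Sums up to a geometric number of steps -/

/-- The bound is the fixed point of `x ↦ A + p * x`. It controls the moments of truncated sums
uniformly in the truncation. -/
lemma ENNReal_le_of_affine_recursion {A p : ℝ≥0∞} (hp : p < 1) {u : ℕ → ℝ≥0∞} (h0 : u 0 = 0)
    (hu : ∀ n, u (n + 1) ≤ A + p * u n) (n : ℕ) : u n ≤ A * (1 - p)⁻¹ := by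
  induction n with
  | zero => simp [h0]
  | succ n ih =>
    have h1 : (1 - p) * (1 - p)⁻¹ = 1 :=
      ENNReal.mul_inv_cancel (tsub_pos_of_lt hp).ne' (ENNReal.sub_ne_top ENNReal.one_ne_top)
    calc u (n + 1) ≤ A + p * (A * (1 - p)⁻¹) := (hu n).trans (by gcongr)
      _ = A * ((1 - p) * (1 - p)⁻¹) + p * (A * (1 - p)⁻¹) := by rw [h1, mul_one]
      _ = A * (1 - p)⁻¹ * ((1 - p) + p) := by ring
      _ = A * (1 - p)⁻¹ := by rw [tsub_add_cancel_of_le hp.le, mul_one]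

section Total

variable {R M : Type*}

/-- The sum of `w` along `f` up to and including the first visit of `S`. -/
noncomputable def totalUntil [AddCommMonoid M] (S : Set R) (w : R → M) (f : ℕ → R) : M :=
  ∑ m ∈ Finset.range (hitTime S f + 1), w (f m)

lemma hitTime_prepend_of_mem {S : Set R} {r : R} {f : ℕ → R} (hr : r ∈ S) :
    hitTime S (prepend r f) = 0 :=
  (hitTime_eq_iff ⟨0, hr⟩).2 ⟨hr, by simp⟩

lemma hitTime_prepend_of_notMem {S : Set R} {r : R} {f : ℕ → R} (hr : r ∉ S)
    (hf : ∃ n, f n ∈ S) : hitTime S (prepend r f) = hitTime S f + 1 := by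
  have h := (hitTime_eq_iff hf).1 rfl
  refine (hitTime_eq_iff ⟨_ + 1, h.1⟩).2 ⟨h.1, fun m hm => ?_⟩
  cases m with
  | zero => exact hr
  | succ m => exact h.2 m (by omega)

lemma totalUntil_prepend_of_mem [AddCommMonoid M] {S : Set R} {w : R → M} {r : R} {f : ℕ → R}
    (hr : r ∈ S) : totalUntil S w (prepend r f) = w r := by
  simp [totalUntil, hitTime_prepend_of_mem hr, prepend]

lemma totalUntil_prepend_of_notMem [AddCommMonoid M] {S : Set R} {w : R → M} {r : R} {f : ℕ → R}
    (hr : r ∉ S) (hf : ∃ n, f n ∈ S) :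
    totalUntil S w (prepend r f) = w r + totalUntil S w f := by
  rw [totalUntil, hitTime_prepend_of_notMem hr hf, Finset.sum_range_succ', add_comm]
  rfl

lemma measurable_totalUntil [MeasurableSpace R] [AddCommMonoid M] [MeasurableSpace M]
    [MeasurableAdd₂ M] {S : Set R} (hS : MeasurableSet S) {w : R → M} (hw : Measurable w) :
    Measurable (totalUntil S w) := by
  have : Measurable fun p : (ℕ → R) × ℕ => ∑ m ∈ Finset.range (p.2 + 1), w (p.1 m) :=
    measurable_from_prod_countable_left fun n =>
      Finset.measurable_sum (f := fun m (f : ℕ → R) => w (f m)) (Finset.range (n + 1))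
        fun m _ => hw.comp (measurable_pi_apply m)
  exact this.comp (measurable_id.prodMk (measurable_hitTime hS))

/-- The value of `g` along `f` at the first visit of `S`. -/
noncomputable def valueAt (S : Set R) (g : R → M) (f : ℕ → R) : M := g (f (hitTime S f))

lemma valueAt_prepend_of_mem {S : Set R} {g : R → M} {r : R} {f : ℕ → R} (hr : r ∈ S) :
    valueAt S g (prepend r f) = g r := by
  simp [valueAt, hitTime_prepend_of_mem hr, prepend]

lemma valueAt_prepend_of_notMem {S : Set R} {g : R → M} {r : R} {f : ℕ → R} (hr : r ∉ S)
    (hf : ∃ n, f n ∈ S) : valueAt S g (prepend r f) = valueAt S g f := by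
  rw [valueAt, hitTime_prepend_of_notMem hr hf]
  rfl

lemma measurable_valueAt [MeasurableSpace R] [MeasurableSpace M] {S : Set R}
    (hS : MeasurableSet S) {g : R → M} (hg : Measurable g) : Measurable (valueAt S g) := by
  have : Measurable fun p : (ℕ → R) × ℕ => g (p.1 p.2) :=
    measurable_from_prod_countable_left fun n => hg.comp (measurable_pi_apply n)
  exact this.comp (measurable_id.prodMk (measurable_hitTime hS))

end Total

namespace Regenerative

variable {Y R : Type*} [MeasurableSpace Y] [MeasurableSpace R] {μ : Measure Y}
  [IsProbabilityMeasure μ] {ρ : Y → R} {Φ : Y → Y} {S : Set R}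

omit [MeasurableSpace Y] [MeasurableSpace R] in
lemma history_eq_prepend (y : Y) : history ρ Φ y = prepend (ρ y) (history ρ Φ (Φ y)) := by
  funext m
  cases m <;> simp [history, prepend]

lemma ae_hit_map (h : Regenerative μ ρ Φ) (hfin : ∀ᵐ y ∂μ, ∃ n, history ρ Φ y n ∈ S) :
    ∀ᵐ y ∂μ, ∃ n, history ρ Φ (Φ y) n ∈ S :=
  h.measurePreserving.quasiMeasurePreserving.ae hfin

/-- First-step analysis: unless the first observation is in `S`, the search starts afresh. The value
`∞` may satisfy the equation too, so it determines the integral only once finiteness is known. -/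
lemma lintegral_valueAt (h : Regenerative μ ρ Φ) (hS : MeasurableSet S)
    (hfin : ∀ᵐ y ∂μ, ∃ n, history ρ Φ y n ∈ S) {g : R → ℝ≥0∞} (hg : Measurable g) :
    ∫⁻ y, valueAt S g (history ρ Φ y) ∂μ =
      ∫⁻ y, S.indicator g (ρ y) ∂μ +
        μ {y | ρ y ∉ S} * ∫⁻ y, valueAt S g (history ρ Φ y) ∂μ := by
  have mh := h.measurable_history
  have mρ := h.measurable_obs
  have mv := (measurable_valueAt hS hg).comp mh
  have m1 : Measurable (S.indicator g) := hg.indicator hS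
  have m2 : Measurable (Sᶜ.indicator (1 : R → ℝ≥0∞)) := measurable_one.indicator hS.compl
  have hq : ∫⁻ y, Sᶜ.indicator 1 (ρ y) ∂μ = μ {y | ρ y ∉ S} :=
    lintegral_indicator_one (s := {y | ρ y ∉ S}) (mρ hS.compl)
  calc ∫⁻ y, valueAt S g (history ρ Φ y) ∂μ
      = ∫⁻ y, S.indicator g (ρ y) +
          Sᶜ.indicator 1 (ρ y) * valueAt S g (history ρ Φ (Φ y)) ∂μ := by
        refine lintegral_congr_ae ?_
        filter_upwards [h.ae_hit_map hfin] with y hy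
        rw [history_eq_prepend y]
        by_cases hr : ρ y ∈ S
        · simp [hr, valueAt_prepend_of_mem hr]
        · simp [hr, valueAt_prepend_of_notMem hr hy]
    _ = ∫⁻ y, ∫⁻ y', S.indicator g (ρ y) +
          Sᶜ.indicator 1 (ρ y) * valueAt S g (history ρ Φ y') ∂μ ∂μ :=
        h.lintegral_eq (fun p => S.indicator g p.1 +
          Sᶜ.indicator 1 p.1 * valueAt S g (history ρ Φ p.2))
          ((m1.comp measurable_fst).add ((m2.comp measurable_fst).mul (mv.comp measurable_snd)))
    _ = ∫⁻ y, S.indicator g (ρ y) +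
          Sᶜ.indicator 1 (ρ y) * ∫⁻ y', valueAt S g (history ρ Φ y') ∂μ ∂μ := by
        refine lintegral_congr fun y => ?_
        rw [lintegral_add_left measurable_const, lintegral_const, measure_univ, mul_one]
        congr 1
        exact lintegral_const_mul _ mv
    _ = _ := by
        rw [lintegral_add_left (by fun_prop)]
        congr 1
        rw [lintegral_mul_const _ (by fun_prop), hq]

lemma lintegral_totalUntil (h : Regenerative μ ρ Φ) (hS : MeasurableSet S)
    (hfin : ∀ᵐ y ∂μ, ∃ n, history ρ Φ y n ∈ S) {w : R → ℝ≥0∞} (hw : Measurable w) :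
    ∫⁻ y, totalUntil S w (history ρ Φ y) ∂μ =
      ∫⁻ y, w (ρ y) ∂μ +
        μ {y | ρ y ∉ S} * ∫⁻ y, totalUntil S w (history ρ Φ y) ∂μ := by
  have mh := h.measurable_history
  have mρ := h.measurable_obs
  have mv := (measurable_totalUntil hS hw).comp mh
  have m2 : Measurable (Sᶜ.indicator (1 : R → ℝ≥0∞)) := measurable_one.indicator hS.compl
  have hq : ∫⁻ y, Sᶜ.indicator 1 (ρ y) ∂μ = μ {y | ρ y ∉ S} :=
    lintegral_indicator_one (s := {y | ρ y ∉ S}) (mρ hS.compl)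
  calc ∫⁻ y, totalUntil S w (history ρ Φ y) ∂μ
      = ∫⁻ y, w (ρ y) + Sᶜ.indicator 1 (ρ y) * totalUntil S w (history ρ Φ (Φ y)) ∂μ := by
        refine lintegral_congr_ae ?_
        filter_upwards [h.ae_hit_map hfin] with y hy
        rw [history_eq_prepend y]
        by_cases hr : ρ y ∈ S
        · simp [hr, totalUntil_prepend_of_mem hr]
        · simp [hr, totalUntil_prepend_of_notMem hr hy]
    _ = ∫⁻ y, ∫⁻ y', w (ρ y) +
          Sᶜ.indicator 1 (ρ y) * totalUntil S w (history ρ Φ y') ∂μ ∂μ :=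
        h.lintegral_eq (fun p => w p.1 +
          Sᶜ.indicator 1 p.1 * totalUntil S w (history ρ Φ p.2))
          ((hw.comp measurable_fst).add ((m2.comp measurable_fst).mul (mv.comp measurable_snd)))
    _ = ∫⁻ y, w (ρ y) +
          Sᶜ.indicator 1 (ρ y) * ∫⁻ y', totalUntil S w (history ρ Φ y') ∂μ ∂μ := by
        refine lintegral_congr fun y => ?_
        rw [lintegral_add_left measurable_const, lintegral_const, measure_univ, mul_one]
        congr 1
        exact lintegral_const_mul _ mv
    _ = _ := by
        rw [lintegral_add_left (by fun_prop)]
        congr 1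
        rw [lintegral_mul_const _ (by fun_prop), hq]

/-- The recursion for the second moment, for a functional `T` that satisfies a one-step
decomposition into a continuation `T'`. -/
lemma lintegral_sq_step (h : Regenerative μ ρ Φ) (hS : MeasurableSet S) {w : R → ℝ≥0∞}
    (hw : Measurable w) {T T' : Y → ℝ≥0∞} (hT' : Measurable T')
    (hT : ∀ᵐ y ∂μ, T y = w (ρ y) + Sᶜ.indicator 1 (ρ y) * T' (Φ y)) :
    ∫⁻ y, T y ^ 2 ∂μ = ∫⁻ y, w (ρ y) ^ 2 ∂μ +
      2 * (∫⁻ y, Sᶜ.indicator w (ρ y) ∂μ) * ∫⁻ y, T' y ∂μ +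
        μ {y | ρ y ∉ S} * ∫⁻ y, T' y ^ 2 ∂μ := by
  have mρ := h.measurable_obs
  have m2 : Measurable (Sᶜ.indicator (1 : R → ℝ≥0∞)) := measurable_one.indicator hS.compl
  have m3 : Measurable (Sᶜ.indicator w) := hw.indicator hS.compl
  have hq : ∫⁻ y, Sᶜ.indicator 1 (ρ y) ∂μ = μ {y | ρ y ∉ S} :=
    lintegral_indicator_one (s := {y | ρ y ∉ S}) (mρ hS.compl)
  have expand : ∀ r t, (w r + Sᶜ.indicator 1 r * t) ^ 2 =
      w r ^ 2 + (2 * Sᶜ.indicator w r * t + Sᶜ.indicator 1 r * t ^ 2) := by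
    intro r t
    by_cases hr : r ∈ S
    · simp [hr]
    · simp [hr]; ring
  calc ∫⁻ y, T y ^ 2 ∂μ
      = ∫⁻ y, w (ρ y) ^ 2 + (2 * Sᶜ.indicator w (ρ y) * T' (Φ y) +
          Sᶜ.indicator 1 (ρ y) * T' (Φ y) ^ 2) ∂μ := by
        refine lintegral_congr_ae ?_
        filter_upwards [hT] with y hy
        rw [hy, expand]
    _ = ∫⁻ y, ∫⁻ y', w (ρ y) ^ 2 + (2 * Sᶜ.indicator w (ρ y) * T' y' +
          Sᶜ.indicator 1 (ρ y) * T' y' ^ 2) ∂μ ∂μ :=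
        h.lintegral_eq (fun p => w p.1 ^ 2 + (2 * Sᶜ.indicator w p.1 * T' p.2 +
          Sᶜ.indicator 1 p.1 * T' p.2 ^ 2)) (by fun_prop)
    _ = ∫⁻ y, w (ρ y) ^ 2 + (2 * Sᶜ.indicator w (ρ y) * ∫⁻ y', T' y' ∂μ +
          Sᶜ.indicator 1 (ρ y) * ∫⁻ y', T' y' ^ 2 ∂μ) ∂μ := by
        refine lintegral_congr fun y => ?_
        rw [lintegral_add_left measurable_const, lintegral_const, measure_univ, mul_one,
          lintegral_add_left (by fun_prop), lintegral_const_mul _ hT',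
          lintegral_const_mul _ (by fun_prop)]
    _ = _ := by
        rw [lintegral_add_left (by fun_prop), lintegral_add_left (by fun_prop),
          lintegral_mul_const _ (by fun_prop), lintegral_mul_const _ (by fun_prop), hq,
          lintegral_const_mul _ (by fun_prop), add_assoc]

lemma lintegral_totalUntil_sq (h : Regenerative μ ρ Φ) (hS : MeasurableSet S)
    (hfin : ∀ᵐ y ∂μ, ∃ n, history ρ Φ y n ∈ S) {w : R → ℝ≥0∞} (hw : Measurable w) :
    ∫⁻ y, totalUntil S w (history ρ Φ y) ^ 2 ∂μ =
      ∫⁻ y, w (ρ y) ^ 2 ∂μ +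
      2 * (∫⁻ y, Sᶜ.indicator w (ρ y) ∂μ) * ∫⁻ y, totalUntil S w (history ρ Φ y) ∂μ +
        μ {y | ρ y ∉ S} * ∫⁻ y, totalUntil S w (history ρ Φ y) ^ 2 ∂μ := by
  refine h.lintegral_sq_step hS hw ((measurable_totalUntil hS hw).comp h.measurable_history) ?_
  filter_upwards [h.ae_hit_map hfin] with y hy
  rw [history_eq_prepend y]
  by_cases hr : ρ y ∈ S
  · simp [hr, totalUntil_prepend_of_mem hr]
  · simp [hr, totalUntil_prepend_of_notMem hr hy]

/-- The sum up to the first visit of `S`, stopped after `n` steps. -/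
noncomputable def truncTotal (S : Set R) (w : R → ℝ≥0∞) (ρ : Y → R) (Φ : Y → Y) :
    ℕ → Y → ℝ≥0∞
  | 0, _ => 0
  | n + 1, y => w (ρ y) + Sᶜ.indicator 1 (ρ y) * truncTotal S w ρ Φ n (Φ y)

omit [IsProbabilityMeasure μ] in
lemma measurable_truncTotal (h : Regenerative μ ρ Φ) (hS : MeasurableSet S) {w : R → ℝ≥0∞}
    (hw : Measurable w) (n : ℕ) : Measurable (truncTotal S w ρ Φ n) := by
  have mρ := h.measurable_obs
  have mΦ := h.measurable_map
  have m2 : Measurable (Sᶜ.indicator (1 : R → ℝ≥0∞)) := measurable_one.indicator hS.compl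
  induction n with
  | zero => exact measurable_const
  | succ n ih =>
    simp only [truncTotal]
    fun_prop

omit [MeasurableSpace Y] [MeasurableSpace R] in
lemma truncTotal_eq {w : R → ℝ≥0∞} (n : ℕ) (y : Y) (hy : ∃ m, history ρ Φ y m ∈ S)
    (hn : hitTime S (history ρ Φ y) < n) :
    truncTotal S w ρ Φ n y = totalUntil S w (history ρ Φ y) := by
  induction n generalizing y with
  | zero => omega
  | succ n ih =>
    rw [history_eq_prepend y] at hn ⊢
    by_cases hr : ρ y ∈ S
    · simp [truncTotal, hr, totalUntil_prepend_of_mem hr]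
    · have hy' : ∃ m, history ρ Φ (Φ y) m ∈ S := by
        obtain ⟨m, hm⟩ := hy
        rw [history_eq_prepend y] at hm
        cases m with
        | zero => exact absurd hm hr
        | succ m => exact ⟨m, hm⟩
      rw [hitTime_prepend_of_notMem hr hy'] at hn
      rw [totalUntil_prepend_of_notMem hr hy', ← ih (Φ y) hy' (by omega)]
      simp [truncTotal, hr]

/-- The recursion of `lintegral_totalUntil_sq` cannot exclude `∞`. Sums stopped after `n` steps
start from `0` and obey the same recursion from `n` to `n + 1`, which bounds their first and then
their second moments uniformly; Fatou's lemma passes to the full sum. -/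
lemma lintegral_totalUntil_sq_ne_top (h : Regenerative μ ρ Φ) (hS : MeasurableSet S)
    (hfin : ∀ᵐ y ∂μ, ∃ n, history ρ Φ y n ∈ S) (hq : μ {y | ρ y ∉ S} < 1) {w : R → ℝ≥0∞}
    (hw : Measurable w) (hw1 : ∫⁻ y, w (ρ y) ∂μ ≠ ∞) (hw2 : ∫⁻ y, w (ρ y) ^ 2 ∂μ ≠ ∞) :
    ∫⁻ y, totalUntil S w (history ρ Φ y) ^ 2 ∂μ ≠ ∞ := by
  have mρ := h.measurable_obs
  have mT := h.measurable_truncTotal hS hw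
  set p := μ {y | ρ y ∉ S}
  have hp : (1 - p)⁻¹ ≠ ∞ := ENNReal.inv_ne_top.2 (tsub_pos_of_lt hq).ne'
  set A := ∫⁻ y, w (ρ y) ∂μ
  have hind : ∫⁻ y, Sᶜ.indicator w (ρ y) ∂μ ≠ ∞ := ne_top_of_le_ne_top hw1
    (lintegral_mono fun y => Set.indicator_le_self _ _ _)
  have m2 : Measurable (Sᶜ.indicator (1 : R → ℝ≥0∞)) := measurable_one.indicator hS.compl
  have hpp : ∫⁻ y, Sᶜ.indicator 1 (ρ y) ∂μ = p :=
    lintegral_indicator_one (s := {y | ρ y ∉ S}) (mρ hS.compl)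
  have b1 : ∀ n, ∫⁻ y, truncTotal S w ρ Φ n y ∂μ ≤ A * (1 - p)⁻¹ := by
    refine ENNReal_le_of_affine_recursion hq (by simp [truncTotal]) fun n => le_of_eq ?_
    simp only [truncTotal]
    rw [lintegral_add_left (by fun_prop)]
    congr 1
    have := h.lintegral_eq (fun p => Sᶜ.indicator 1 p.1 * truncTotal S w ρ Φ n p.2) (by fun_prop)
    dsimp only at this
    rw [this]
    simp_rw [lintegral_const_mul _ (mT n)]
    rw [lintegral_mul_const _ (by fun_prop), hpp]
  have b2 : ∀ n, ∫⁻ y, truncTotal S w ρ Φ n y ^ 2 ∂μ ≤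
      (∫⁻ y, w (ρ y) ^ 2 ∂μ + 2 * (∫⁻ y, Sᶜ.indicator w (ρ y) ∂μ) * (A * (1 - p)⁻¹)) *
        (1 - p)⁻¹ := by
    refine ENNReal_le_of_affine_recursion hq (by simp [truncTotal]) fun n => ?_
    rw [h.lintegral_sq_step (T := truncTotal S w ρ Φ (n + 1)) hS hw (mT n) (.of_forall fun y => rfl)]
    gcongr
    exact b1 n
  refine ne_top_of_le_ne_top (b := (∫⁻ y, w (ρ y) ^ 2 ∂μ +
    2 * (∫⁻ y, Sᶜ.indicator w (ρ y) ∂μ) * (A * (1 - p)⁻¹)) * (1 - p)⁻¹) ?_ ?_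
  · finiteness
  · calc ∫⁻ y, totalUntil S w (history ρ Φ y) ^ 2 ∂μ
        = ∫⁻ y, liminf (fun n => truncTotal S w ρ Φ n y ^ 2) atTop ∂μ := by
          refine lintegral_congr_ae ?_
          filter_upwards [hfin] with y hy
          refine (Tendsto.liminf_eq (tendsto_const_nhds.congr' ?_)).symm
          filter_upwards [eventually_gt_atTop (hitTime S (history ρ Φ y))] with n hn
          rw [truncTotal_eq n y hy hn]
      _ ≤ liminf (fun n => ∫⁻ y, truncTotal S w ρ Φ n y ^ 2 ∂μ) atTop :=
          lintegral_liminf_le fun n => (mT n).pow_const 2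
      _ ≤ _ := liminf_le_of_le (by isBoundedDefault) fun b hb => by
          obtain ⟨n, hn⟩ := hb.exists
          exact hn.trans (b2 n)

end Regenerative

/-- An i.i.d. sequence of erasures that are not certain contains a success. -/
lemma ae_exists_false {β : Measure (ℕ → Bool)} [IsProbabilityMeasure β]
    (h : Regenerative β (fun b => b 0) (fun b n => b (n + 1))) (hq : β {b | b 0 = true} < 1) :
    ∀ᵐ b ∂β, ∃ n, b n = false := by
  have mt : ∀ n, MeasurableSet {b : ℕ → Bool | b n = true} := fun n =>
    measurableSet_eq_fun (measurable_pi_apply n) measurable_const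
  have ms : MeasurableSet {b : ℕ → Bool | ∀ n, b n = true} :=
    measurableSet_setOfPred.2 (.forall fun n => measurableSet_setOfPred.1 (mt n))
  -- All attempts are erased when the first one is and all later ones are. By independence and
  -- stationarity the probability `p` of this event satisfies `p = β {b | b 0 = true} * p`, so `p =
  -- 0`.
  have key : {b : ℕ → Bool | ∀ n, b n = true} =
      {b | b 0 = true} ∩ (fun b n => b (n + 1)) ⁻¹' {b : ℕ → Bool | ∀ n, b n = true} := by
    ext b
    refine ⟨fun hb => ⟨hb 0, fun n => hb (n + 1)⟩, fun hb n => ?_⟩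
    cases n with
    | zero => exact hb.1
    | succ n => exact hb.2 n
  have hmul := h.indepFun.measure_inter_preimage_eq_mul {true} {b : ℕ → Bool | ∀ n, b n = true}
    (measurableSet_singleton true) ms
  have hp := h.measurePreserving.measure_preimage ms.nullMeasurableSet
  have e : β {b : ℕ → Bool | ∀ n, b n = true} =
      β {b | b 0 = true} * β {b : ℕ → Bool | ∀ n, b n = true} := by
    conv_lhs => rw [key]
    rw [← hp]
    conv_rhs => rw [hp]
    rw [hp] at hmul
    exact hmul
  have hz : β {b : ℕ → Bool | ∀ n, b n = true} = 0 := by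
    by_contra hne
    have := ENNReal.mul_lt_mul_left hne (measure_ne_top β _) hq
    rw [one_mul, ← e] at this
    exact lt_irrefl _ this
  rw [ae_iff]
  simpa using hz

/-! ### Moments of an attempt -/

lemma expMeasure_Ioi {r c : ℝ} (hr : 0 < r) (hc : 0 ≤ c) :
    expMeasure r (Set.Ioi c) = ENNReal.ofReal (Real.exp (-(r * c))) := by
  have := isProbabilityMeasure_expMeasure hr
  have := lintegral_expMeasure_sub (r := r) hc (fun _ => 1) measurable_const
  simpa [lintegral_indicator measurableSet_Ioi] using this

lemma expMeasure_Iic {r c : ℝ} (hr : 0 < r) (hc : 0 ≤ c) :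
    expMeasure r (Set.Iic c) = ENNReal.ofReal (1 - Real.exp (-(r * c))) := by
  have := isProbabilityMeasure_expMeasure hr
  rw [← Set.compl_Ioi, prob_compl_eq_one_sub measurableSet_Ioi, expMeasure_Ioi hr hc,
    ENNReal.ofReal_sub _ (Real.exp_nonneg _), ENNReal.ofReal_one]

lemma exp_neg_mul_le_one {r c : ℝ} (hr : 0 < r) (hc : 0 ≤ c) : Real.exp (-(r * c)) ≤ 1 :=
  Real.exp_le_one_iff.2 (neg_nonpos.2 (by positivity))

/-- The expectation of `f (max x c)` for an exponential random variable `x`, through a primitive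
`-G` of `f` times the density. -/
lemma lintegral_expMeasure_max {r c : ℝ} (hr : 0 < r) (hc : 0 ≤ c) {f G : ℝ → ℝ}
    (hf : Measurable f) (hf0 : ∀ x, c ≤ x → 0 ≤ f x)
    (hG : ∀ x, HasDerivAt G (-(r * Real.exp (-(r * x)) * f x)) x)
    (hlim : Tendsto G atTop (𝓝 0)) :
    0 ≤ f c * (1 - Real.exp (-(r * c))) + G c ∧
    ∫⁻ x, ENNReal.ofReal (f (max x c)) ∂expMeasure r =
      ENNReal.ofReal (f c * (1 - Real.exp (-(r * c))) + G c) := by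
  have hneg : ∀ x ∈ Set.Ioi c, -(r * Real.exp (-(r * x)) * f x) ≤ 0 := fun x hx =>
    neg_nonpos.2 (mul_nonneg (by positivity) (hf0 x (Set.mem_Ioi.1 hx).le))
  -- The sign of the derivative and the limit of `G` give integrability without any estimate, and `G
  -- c` is the part of the expectation beyond `c`. Below `c` the integrand is the constant `f c`.
  have hint := integrableOn_Ioi_deriv_of_nonpos' (a := c) (fun x _ => hG x) hneg hlim
  have hval := integral_Ioi_of_hasDerivAt_of_nonpos' (a := c) (fun x _ => hG x) hneg hlim
  rw [zero_sub, integral_neg, neg_inj] at hval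
  have hint' : IntegrableOn (fun x => r * Real.exp (-(r * x)) * f x) (Set.Ioi c) := by
    simpa using hint.neg
  have hnn : 0 ≤ᵐ[volume.restrict (Set.Ioi c)] fun x => r * Real.exp (-(r * x)) * f x := by
    filter_upwards [ae_restrict_mem measurableSet_Ioi] with x hx
    simpa using hneg x hx
  have hGc : 0 ≤ G c := by
    rw [← hval]
    exact integral_nonneg_of_ae hnn
  have m1 : Measurable fun x => ENNReal.ofReal (f (max x c)) := by fun_prop
  have hhi : ∫⁻ x in Set.Ioi c, ENNReal.ofReal (f (max x c)) ∂expMeasure r =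
      ENNReal.ofReal (G c) := by
    rw [← hval, ofReal_integral_eq_lintegral_ofReal hint' hnn,
      ← lintegral_indicator measurableSet_Ioi, lintegral_expMeasure _ (m1.indicator measurableSet_Ioi)]
    rw [← lintegral_indicator measurableSet_Ioi, ← lintegral_indicator measurableSet_Ioi]
    refine lintegral_congr fun x => ?_
    by_cases hx : c < x
    · have h0 : (0 : ℝ) < x := hc.trans_lt hx
      rw [Set.indicator_of_mem (Set.mem_Ioi.2 h0), Set.indicator_of_mem (Set.mem_Ioi.2 hx),
        Set.indicator_of_mem (Set.mem_Ioi.2 hx), max_eq_left hx.le,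
        ← ENNReal.ofReal_mul (by positivity)]
    · have hx' : x ∉ Set.Ioi c := hx
      rw [Set.indicator_of_notMem hx']
      simp [Set.indicator_of_notMem hx']
  have hlo : ∫⁻ x in (Set.Ioi c)ᶜ, ENNReal.ofReal (f (max x c)) ∂expMeasure r =
      ENNReal.ofReal (f c * (1 - Real.exp (-(r * c)))) := by
    calc _ = ∫⁻ _ in (Set.Ioi c)ᶜ, ENNReal.ofReal (f c) ∂expMeasure r := by
          refine setLIntegral_congr_fun measurableSet_Ioi.compl fun x hx => ?_
          rw [Set.compl_Ioi] at hx
          rw [max_eq_right (Set.mem_Iic.1 hx)]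
      _ = _ := by
          rw [setLIntegral_const, Set.compl_Ioi, expMeasure_Iic hr hc,
            ENNReal.ofReal_mul (hf0 c le_rfl)]
  have hfc : 0 ≤ f c * (1 - Real.exp (-(r * c))) :=
    mul_nonneg (hf0 c le_rfl) (sub_nonneg.2 (exp_neg_mul_le_one hr hc))
  refine ⟨add_nonneg hfc hGc, ?_⟩
  rw [← lintegral_add_compl _ (measurableSet_Ioi (a := c)), hhi, hlo, add_comm,
    ENNReal.ofReal_add hfc hGc]

lemma tendsto_pow_mul_exp_neg_mul {r : ℝ} (hr : 0 < r) (n : ℕ) :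
    Tendsto (fun t : ℝ => t ^ n * Real.exp (-(r * t))) atTop (𝓝 0) := by
  have := tendsto_rpow_mul_exp_neg_mul_atTop_nhds_zero (n : ℝ) r hr
  simpa using this

lemma hasDerivAt_exp_neg_mul (r x : ℝ) :
    HasDerivAt (fun t => Real.exp (-(r * t))) (Real.exp (-(r * x)) * -r) x := by
  simpa using (((hasDerivAt_id x).const_mul r).neg).exp

/-- The primitive of `-(u t² + v t + w) e^{-rt}` that vanishes at infinity. -/
noncomputable def polyExpTail (r u v w t : ℝ) : ℝ :=
  (u * (t ^ 2 / r + 2 * t / r ^ 2 + 2 / r ^ 3) + v * (t / r + 1 / r ^ 2) + w / r) *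
    Real.exp (-(r * t))

lemma hasDerivAt_polyExpTail {r : ℝ} (hr : 0 < r) (u v w x : ℝ) :
    HasDerivAt (polyExpTail r u v w) (-((u * x ^ 2 + v * x + w) * Real.exp (-(r * x)))) x := by
  have h1 : HasDerivAt (fun t : ℝ =>
      u * (t ^ 2 / r + 2 * t / r ^ 2 + 2 / r ^ 3) + v * (t / r + 1 / r ^ 2) + w / r)
      (u * (2 * x / r + 2 / r ^ 2) + v * (1 / r)) x := by
    have hid := hasDerivAt_id' x
    have := ((((hasDerivAt_pow 2 x).div_const r).add ((hid.const_mul 2).div_const (r ^ 2))).add_const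
      (2 / r ^ 3)).const_mul u |>.add (((hid.div_const r).add_const (1 / r ^ 2)).const_mul v)
      |>.add_const (w / r)
    refine this.congr_deriv ?_
    simp
  refine (h1.mul (hasDerivAt_exp_neg_mul r x)).congr_deriv ?_
  field_simp
  ring

lemma tendsto_polyExpTail {r : ℝ} (hr : 0 < r) (u v w : ℝ) :
    Tendsto (polyExpTail r u v w) atTop (𝓝 0) := by
  have h0 := (tendsto_pow_mul_exp_neg_mul hr 0).const_mul (u * (2 / r ^ 3) + v / r ^ 2 + w / r)
  have h1 := (tendsto_pow_mul_exp_neg_mul hr 1).const_mul (u * (2 / r ^ 2) + v / r)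
  have h2 := (tendsto_pow_mul_exp_neg_mul hr 2).const_mul (u / r)
  have := (h0.add h1).add h2
  simp only [mul_zero, add_zero] at this
  refine this.congr fun t => ?_
  simp only [polyExpTail]
  ring

/-- The conditional mean age of the packet sent at time `c`, jointly with the presence of one. -/
noncomputable def ageAt (s c : ℝ) : ℝ :=
  (1 - Real.exp (-(s * c))) / s - c * Real.exp (-(s * c))

lemma integral_ageAt {s c : ℝ} (hs : 0 < s) :
    ∫ u in (0 : ℝ)..c, (Real.exp (-(s * u)) - Real.exp (-(s * c))) = ageAt s c := by
  have hd : ∀ u ∈ Set.uIcc 0 c, HasDerivAt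
      (fun u => -(Real.exp (-(s * u)) / s) - u * Real.exp (-(s * c)))
      (Real.exp (-(s * u)) - Real.exp (-(s * c))) u := by
    intro u _
    have := (((hasDerivAt_exp_neg_mul s u).div_const s).neg).sub
      ((hasDerivAt_id' u).mul_const (Real.exp (-(s * c))))
    refine this.congr_deriv ?_
    field_simp
  rw [intervalIntegral.integral_eq_sub_of_hasDerivAt hd (by
    apply Continuous.intervalIntegrable
    fun_prop)]
  simp only [ageAt]
  simp
  ring

lemma ageAt_integrand_nonneg {s c u : ℝ} (hs : 0 < s) (hu : u ≤ c) :
    0 ≤ Real.exp (-(s * u)) - Real.exp (-(s * c)) :=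
  sub_nonneg.2 (Real.exp_le_exp.2 (neg_le_neg (mul_le_mul_of_nonneg_left hu hs.le)))

lemma ageAt_nonneg {s c : ℝ} (hs : 0 < s) (hc : 0 ≤ c) : 0 ≤ ageAt s c := by
  rw [← integral_ageAt hs]
  exact intervalIntegral.integral_nonneg hc fun u hu => ageAt_integrand_nonneg hs hu.2

/-! ### Moments of the waiting time and of the packet age -/

section PoissonMoments

variable {μ ν : Measure (ℕ → ℝ)} {r s γ : ℝ}

lemma IsPoissonLaw.lintegral_first (h : IsPoissonLaw μ r) {f : ℝ → ℝ≥0∞} (hf : Measurable f) :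
    ∫⁻ a, f (a 0) ∂μ = ∫⁻ x, f x ∂expMeasure r := by
  rw [← h.first, lintegral_map hf (measurable_pi_apply 0)]

lemma IsPoissonLaw.lintegral_max_first (h : IsPoissonLaw ν s) (hs : 0 < s) {c : ℝ} (hc : 0 ≤ c) :
    ∫⁻ b, ENNReal.ofReal (max (b 0) c) ∂ν = ENNReal.ofReal (c + Real.exp (-(s * c)) / s) := by
  rw [h.lintegral_first (f := fun x => ENNReal.ofReal (max x c)) (by fun_prop),
    (lintegral_expMeasure_max (f := fun x => x) (G := polyExpTail s 0 s 0) hs hc measurable_id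
    (fun x hx => hc.trans hx) (fun x => by
      convert hasDerivAt_polyExpTail hs 0 s 0 x using 1
      ring) (tendsto_polyExpTail hs _ _ _)).2]
  congr 1
  simp only [polyExpTail]
  field_simp
  ring

lemma IsPoissonLaw.lintegral_max_first_sq (h : IsPoissonLaw ν s) (hs : 0 < s) {c : ℝ}
    (hc : 0 ≤ c) : ∫⁻ b, ENNReal.ofReal (max (b 0) c ^ 2) ∂ν =
      ENNReal.ofReal (c ^ 2 + (2 * c / s + 2 / s ^ 2) * Real.exp (-(s * c))) := by
  rw [h.lintegral_first (f := fun x => ENNReal.ofReal (max x c ^ 2)) (by fun_prop),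
    (lintegral_expMeasure_max (f := fun x => x ^ 2) (G := polyExpTail s s 0 0) hs hc (by fun_prop)
    (fun x hx => sq_nonneg x) (fun x => by
      convert hasDerivAt_polyExpTail hs s 0 0 x using 1
      ring) (tendsto_polyExpTail hs _ _ _)).2]
  congr 1
  simp only [polyExpTail]
  field_simp
  ring

/-- The age at time `max{d, c}` of the latest packet is at least `u > 0` if and only if there is a
packet up to time `c - u` and none in `(c - u, c]`. -/
lemma Good.le_age_iff {b : ℕ → ℝ} (hb : Good b) {c u : ℝ} (hu : 0 < u) :
    u ≤ max (b 0) c - lastUpTo b (max (b 0) c) ↔ b 0 ≤ c - u ∧ u < shift b (c - u) 0 := by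
  -- If the first packet comes after `c`, the age is `0` and both sides fail, since `u > 0`.
  rcases lt_or_ge c (b 0) with h | h
  · rw [max_eq_left h.le]
    have h1 : lastUpTo b (b 0) = b 0 := le_antisymm (hb.lastUpTo_le le_rfl)
      (hb.mono.monotone (Nat.zero_le _))
    rw [h1, sub_self]
    constructor
    · intro h'; linarith
    · intro h'; linarith [h'.1]
  · rw [max_eq_right h]
    have h0 := hb.le_iff.1 h
    have hn := hb.lt_count c
    simp only [lastUpTo, shift, add_zero]
    constructor
    · intro h'
      have h2 : b (countUpTo b c - 1) ≤ c - u := by linarith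
      have h3 : countUpTo b (c - u) = countUpTo b c := by
        refine le_antisymm (hb.count_mono (by linarith)) ?_
        have := hb.le_iff.1 h2
        omega
      exact ⟨(hb.mono.monotone (Nat.zero_le _)).trans h2, by rw [h3]; linarith⟩
    · rintro ⟨h1, h2⟩
      have h3 : countUpTo b c ≤ countUpTo b (c - u) := hb.lt_iff.1 (by linarith)
      have h4 := hb.count_mono (by linarith : c - u ≤ c)
      have h5 : b (countUpTo b c - 1) ≤ c - u := hb.le_iff.2 (by omega)
      linarith

lemma Good.age_lt {b : ℕ → ℝ} (hb : Good b) {c : ℝ} (hc : 0 ≤ c) :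
    max (b 0) c - lastUpTo b (max (b 0) c) ≤ c := by
  rcases lt_or_ge c (b 0) with h | h
  · rw [max_eq_left h.le]
    have h1 : b 0 ≤ lastUpTo b (b 0) := hb.mono.monotone (Nat.zero_le _)
    linarith
  · rw [max_eq_right h]
    linarith [hb.lastUpTo_pos c]

/-- By the Markov property at time `c - u`, the two conditions of `Good.le_age_iff` are independent,
with probabilities `1 - exp (-(s * (c - u)))` and `exp (-(s * u))`. -/
lemma IsPoissonLaw.measure_age_le (h : IsPoissonLaw ν s) (hs : 0 < s) {c u : ℝ} (hu : 0 < u)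
    (huc : u ≤ c) : ν {b | u ≤ max (b 0) c - lastUpTo b (max (b 0) c)} =
      ENNReal.ofReal (Real.exp (-(s * u)) - Real.exp (-(s * c))) := by
  have := h.prob
  have hcu : 0 ≤ c - u := sub_nonneg.2 huc
  have e1 : ν {b | u ≤ max (b 0) c - lastUpTo b (max (b 0) c)} =
      ∫⁻ b, (Set.Iic (c - u)).indicator 1 (b 0) * (Set.Ioi u).indicator 1 (shift b (c - u) 0) ∂ν := by
    have ms : MeasurableSet {b : ℕ → ℝ | u ≤ max (b 0) c - lastUpTo b (max (b 0) c)} :=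
      measurableSet_le measurable_const (by fun_prop)
    rw [← lintegral_indicator_one ms]
    refine lintegral_congr_ae ?_
    filter_upwards [h.ae_good hs] with b hb
    have := hb.le_age_iff (c := c) hu
    simp only [Set.indicator_apply, Set.mem_ofPred_eq, Pi.one_apply]
    by_cases hl : u ≤ max (b 0) c - lastUpTo b (max (b 0) c)
    · have h2 := this.1 hl
      rw [if_pos hl, if_pos (Set.mem_Iic.2 h2.1), if_pos (Set.mem_Ioi.2 h2.2), mul_one]
    · rw [if_neg hl]
      rw [this, not_and_or] at hl
      rcases hl with hl | hl
      · rw [if_neg (show b 0 ∉ Set.Iic (c - u) from hl), zero_mul]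
      · rw [if_neg (show shift b (c - u) 0 ∉ Set.Ioi u from hl), mul_zero]
  have m1 : Measurable ((Set.Iic (c - u)).indicator (1 : ℝ → ℝ≥0∞)) :=
    measurable_one.indicator measurableSet_Iic
  have m2 : Measurable ((Set.Ioi u).indicator (1 : ℝ → ℝ≥0∞)) :=
    measurable_one.indicator measurableSet_Ioi
  have e2 := h.lintegral_shift hs hcu (fun p => (Set.Iic (c - u)).indicator 1 (p.1 0) *
    (Set.Ioi u).indicator 1 (p.2 0)) (by fun_prop) fun a b y _ _ hab => by
      have : a 0 ∈ Set.Iic (c - u) ↔ b 0 ∈ Set.Iic (c - u) :=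
        ⟨fun h' => hab 0 (.inl h') ▸ h', fun h' => (hab 0 (.inr h')).symm ▸ h'⟩
      simp only [Set.indicator_apply, this, Pi.one_apply]
  rw [e1, e2]
  have m3 : Measurable fun b : ℕ → ℝ => (Set.Ioi u).indicator (1 : ℝ → ℝ≥0∞) (b 0) := by fun_prop
  simp_rw [lintegral_const_mul _ m3]
  rw [lintegral_mul_const _ (by fun_prop), h.lintegral_first m1, h.lintegral_first m2,
    lintegral_indicator_one measurableSet_Iic, lintegral_indicator_one measurableSet_Ioi,
    expMeasure_Iic hs hcu, expMeasure_Ioi hs hu.le,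
    ← ENNReal.ofReal_mul (sub_nonneg.2 (exp_neg_mul_le_one hs hcu)), sub_mul, ← Real.exp_add]
  congr 2
  · ring
  · ring_nf

/-- Layer-cake formula: the tail probabilities of `measure_age_le` are integrated over `u` in `(0,
c]`, and the age never exceeds `c`. -/
lemma IsPoissonLaw.lintegral_age (h : IsPoissonLaw ν s) (hs : 0 < s) {c : ℝ} (hc : 0 ≤ c) :
    ∫⁻ b, ENNReal.ofReal (max (b 0) c - lastUpTo b (max (b 0) c)) ∂ν =
      ENNReal.ofReal (ageAt s c) := by
  have hnn : 0 ≤ᵐ[ν] fun b => max (b 0) c - lastUpTo b (max (b 0) c) := by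
    filter_upwards [h.ae_good hs] with b hb
    exact sub_nonneg.2 (hb.lastUpTo_le (le_max_left _ _))
  rw [lintegral_eq_lintegral_meas_le ν hnn (Measurable.aemeasurable (by fun_prop)),
    ← integral_ageAt hs, intervalIntegral.integral_of_le hc,
    ofReal_integral_eq_lintegral_ofReal ?_ ?_]
  · rw [← lintegral_indicator measurableSet_Ioi, ← lintegral_indicator measurableSet_Ioc]
    refine lintegral_congr fun u => ?_
    by_cases h0 : 0 < u
    · rw [Set.indicator_of_mem (Set.mem_Ioi.2 h0)]
      by_cases huc : u ≤ c
      · rw [Set.indicator_of_mem (show u ∈ Set.Ioc 0 c from ⟨h0, huc⟩), h.measure_age_le hs h0 huc]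
      · rw [Set.indicator_of_notMem (show u ∉ Set.Ioc 0 c from fun h' => huc h'.2)]
        refine measure_mono_null (t := {b | ¬ Good b}) (fun b hb hg => huc ?_) (h.ae_good hs)
        exact le_trans hb (hg.age_lt hc)
    · rw [Set.indicator_of_notMem (show u ∉ Set.Ioi 0 from h0),
        Set.indicator_of_notMem (show u ∉ Set.Ioc 0 c from fun h' => h0 h'.1)]
  · exact Continuous.integrableOn_Ioc (by fun_prop)
  · filter_upwards [ae_restrict_mem measurableSet_Ioc] with u hu
    exact ageAt_integrand_nonneg hs hu.2

/-- The inner integral over the data gives `c + exp (-(s * c)) / s` at `c = max (a 0) γ`. Against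
the density `r * exp (-(r * x))` its two terms have rates `r` and `r + s`, whence the two summands
of `G`. -/
lemma lintegral_attemptWait (hμ : IsPoissonLaw μ r) (hν : IsPoissonLaw ν s) (hr : 0 < r)
    (hs : 0 < s) (hγ : 0 ≤ γ) : 0 ≤ waitMoment₁ r s γ ∧
    ∫⁻ a, ∫⁻ b, ENNReal.ofReal (attemptWait γ a b) ∂ν ∂μ =
      ENNReal.ofReal (waitMoment₁ r s γ) := by
  have hrs : 0 < r + s := by positivity
  simp_rw [attemptWait_eq_right, hν.lintegral_max_first hs (hγ.trans (le_max_right _ _))]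
  rw [hμ.lintegral_first (f := fun x => ENNReal.ofReal (max x γ +
      Real.exp (-(s * max x γ)) / s)) (by fun_prop)]
  have key := lintegral_expMeasure_max (f := fun x => x + Real.exp (-(s * x)) / s)
    (G := fun t => polyExpTail r 0 r 0 t + polyExpTail (r + s) 0 0 (r / s) t) hr hγ (by fun_prop)
    (fun x hx => by have := hγ.trans hx; positivity) (fun x => by
      refine ((hasDerivAt_polyExpTail hr 0 r 0 x).add
        (hasDerivAt_polyExpTail hrs 0 0 (r / s) x)).congr_deriv ?_
      rw [show -((r + s) * x) = -(r * x) + -(s * x) by ring, Real.exp_add]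
      field_simp
      ring) (by simpa using (tendsto_polyExpTail hr 0 r 0).add (tendsto_polyExpTail hrs 0 0 (r / s)))
  refine (congrArg (fun v => 0 ≤ v ∧ _ = ENNReal.ofReal v) ?_).mp key
  simp only [polyExpTail, waitMoment₁]
  rw [show -((r + s) * γ) = -(r * γ) + -(s * γ) by ring, Real.exp_add]
  field_simp
  ring

lemma lintegral_attemptWait_sq (hμ : IsPoissonLaw μ r) (hν : IsPoissonLaw ν s) (hr : 0 < r)
    (hs : 0 < s) (hγ : 0 ≤ γ) : 0 ≤ waitMoment₂ r s γ ∧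
    ∫⁻ a, ∫⁻ b, ENNReal.ofReal (attemptWait γ a b ^ 2) ∂ν ∂μ =
      ENNReal.ofReal (waitMoment₂ r s γ) := by
  have hrs : 0 < r + s := by positivity
  simp_rw [attemptWait_eq_right, hν.lintegral_max_first_sq hs (hγ.trans (le_max_right _ _))]
  rw [hμ.lintegral_first (f := fun x => ENNReal.ofReal (max x γ ^ 2 + (2 * max x γ / s + 2 / s ^ 2) *
      Real.exp (-(s * max x γ)))) (by fun_prop)]
  have key := lintegral_expMeasure_max (f := fun x => x ^ 2 + (2 * x / s + 2 / s ^ 2) * Real.exp (-(s * x)))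
    (G := fun t => polyExpTail r r 0 0 t + polyExpTail (r + s) 0 (2 * r / s) (2 * r / s ^ 2) t)
    hr hγ (by fun_prop)
    (fun x hx => by have := hγ.trans hx; positivity) (fun x => by
      refine ((hasDerivAt_polyExpTail hr r 0 0 x).add
        (hasDerivAt_polyExpTail hrs 0 (2 * r / s) (2 * r / s ^ 2) x)).congr_deriv ?_
      rw [show -((r + s) * x) = -(r * x) + -(s * x) by ring, Real.exp_add]
      field_simp
      ring) (by
      simpa using (tendsto_polyExpTail hr r 0 0).add
        (tendsto_polyExpTail hrs 0 (2 * r / s) (2 * r / s ^ 2)))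
  refine (congrArg (fun v => 0 ≤ v ∧ _ = ENNReal.ofReal v) ?_).mp key
  simp only [polyExpTail, waitMoment₂]
  rw [show -((r + s) * γ) = -(r * γ) + -(s * γ) by ring, Real.exp_add]
  field_simp
  ring

lemma lintegral_attemptAge (hμ : IsPoissonLaw μ r) (hν : IsPoissonLaw ν s) (hr : 0 < r)
    (hs : 0 < s) (hγ : 0 ≤ γ) : 0 ≤ meanStartAge r s γ ∧
    ∫⁻ a, ∫⁻ b, ENNReal.ofReal (attemptAge γ a b) ∂ν ∂μ =
      ENNReal.ofReal (meanStartAge r s γ) := by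
  have hrs : 0 < r + s := by positivity
  simp_rw [attemptAge, attemptWait_eq_right, hν.lintegral_age hs (hγ.trans (le_max_right _ _))]
  rw [hμ.lintegral_first (f := fun x => ENNReal.ofReal (ageAt s (max x γ)))
      (by unfold ageAt; fun_prop)]
  -- The constant term of `ageAt s` has rate `r` against the energy density; the terms with `exp
  -- (-(s * x))`, one of them linear in `x`, have rate `r + s`.
  have key := lintegral_expMeasure_max (f := ageAt s)
    (G := fun t => polyExpTail r 0 0 (r / s) t + polyExpTail (r + s) 0 (-r) (-(r / s)) t)
    hr hγ (by unfold ageAt; fun_prop)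
    (fun x hx => ageAt_nonneg hs (hγ.trans hx)) (fun x => by
      refine ((hasDerivAt_polyExpTail hr 0 0 (r / s) x).add
        (hasDerivAt_polyExpTail hrs 0 (-r) (-(r / s)) x)).congr_deriv ?_
      rw [show -((r + s) * x) = -(r * x) + -(s * x) by ring, Real.exp_add]
      simp only [ageAt]
      field_simp
      ring) (by
      simpa using (tendsto_polyExpTail hr 0 0 (r / s)).add
        (tendsto_polyExpTail hrs 0 (-r) (-(r / s))))
  refine (congrArg (fun v => 0 ≤ v ∧ _ = ENNReal.ofReal v) ?_).mp key
  simp only [polyExpTail, meanStartAge, ageAt]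
  rw [show -((r + s) * γ) = -(r * γ) + -(s * γ) by ring, Real.exp_add]
  field_simp
  ring

end PoissonMoments

/-! ### Maximum-age-first scheduling is a round robin -/

section Dynamics

variable {N : ℕ} [NeZero N]

/-- The source of visit number `v` in a round robin. -/
def src (N : ℕ) [NeZero N] (v : ℕ) : Fin N := ⟨v % N, Nat.mod_lt _ (NeZero.pos N)⟩

lemma src_succ_val (v : ℕ) :
    ((src N (v + 1) : Fin N) : ℕ) = if v % N + 1 = N then 0 else v % N + 1 := by
  have hlt := Nat.mod_lt v (NeZero.pos N)
  change (v + 1) % N = _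
  rw [← Nat.mod_add_mod]
  split_ifs with h
  · rw [h, Nat.mod_self]
  · exact Nat.mod_eq_of_lt (by omega)

lemma src_add_mul (j : Fin N) (i : ℕ) : src N (j + i * N) = j := by
  ext
  simp [src, Nat.mod_eq_of_lt j.isLt]

/-- Source `s` is the next one in the round robin. -/
structure RoundRobin (S : State N) (s : Fin N) : Prop where
  le_time : ∀ κ, S.stamp κ ≤ S.time
  mono : ∀ i j, i ≤ j → (s ≤ i ∨ j < s) → S.stamp i ≤ S.stamp j
  lt : ∀ i j, j < s → s ≤ i → S.stamp i < S.stamp j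

namespace RoundRobin

variable {S : State N} {s : Fin N}

lemma stamp_le (h : RoundRobin S s) (κ : Fin N) : S.stamp s ≤ S.stamp κ := by
  rcases le_or_gt s κ with hκ | hκ
  · exact h.mono s κ hκ (.inl le_rfl)
  · exact (h.lt s κ hκ le_rfl).le

/-- The stamps increase weakly along the cyclic order that starts at `s`, so `s` has maximal age.
Ties go to the smallest index, hence the strict inequality across the wrap: every index below `s`
has a strictly fresher packet. -/
lemma source_eq (h : RoundRobin S s) : S.source = s := by
  unfold State.source maxAgeSource
  refine le_antisymm (Finset.min'_le _ _ ?_) (Finset.le_min' _ _ _ fun κ hκ => ?_)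
  · simp only [Finset.mem_filter, Finset.mem_univ, true_and, sub_le_sub_iff_left]
    exact h.stamp_le
  · simp only [Finset.mem_filter, Finset.mem_univ, true_and, sub_le_sub_iff_left] at hκ
    by_contra! hlt
    exact absurd (hκ s) (not_le.2 (h.lt s κ hlt le_rfl))

lemma failure (h : RoundRobin S s) {t : ℝ} (ht : S.time ≤ t) : RoundRobin ⟨t, S.stamp⟩ s :=
  ⟨fun κ => (h.le_time κ).trans ht, h.mono, h.lt⟩

/-- The new stamp `u` exceeds all the old ones, as these are at most `S.time`; the source served
therefore goes from the front of the cyclic order to its end. -/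
lemma success {v : ℕ} (h : RoundRobin S (src N v)) {t u : ℝ} (hu : S.time < u) (ht : u ≤ t) :
    RoundRobin ⟨t, Function.update S.stamp (src N v) u⟩ (src N (v + 1)) := by
  have hval := src_succ_val (N := N) v
  have hsv : ((src N v : Fin N) : ℕ) = v % N := rfl
  have hle : ∀ κ, S.stamp κ < u := fun κ => (h.le_time κ).trans_lt hu
  have hupd : ∀ κ, Function.update S.stamp (src N v) u κ ≤ u := fun κ => by
    by_cases hκ : κ = src N v
    · simp [hκ]
    · simpa [hκ] using (hle κ).le
  refine ⟨fun κ => (hupd κ).trans ht, fun i j hij hs => ?_, fun i j hj hi => ?_⟩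
  · dsimp only
    by_cases hjs : j = src N v
    · subst hjs
      simpa using hupd i
    have his : ¬ (i : ℕ) = v % N ∨ (i : ℕ) = v % N := (em _).symm
    have hi_lt := i.isLt
    have hj_lt := j.isLt
    simp only [Fin.le_def, Fin.lt_def, Fin.ext_iff, hval, hsv] at hij hs hjs
    rcases his with his | his
    · have his' : i ≠ src N v := fun h' => his (Fin.ext_iff.1 h')
      have hjs' : j ≠ src N v := fun h' => hjs (Fin.ext_iff.1 h')
      rw [Function.update_of_ne his', Function.update_of_ne hjs']
      refine h.mono i j hij ?_
      simp only [Fin.le_def, Fin.lt_def, hsv]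
      split_ifs at hs <;> omega
    · split_ifs at hs <;> omega
  · dsimp only
    have hi_lt := i.isLt
    simp only [Fin.le_def, Fin.lt_def, hval] at hi hj
    have his' : i ≠ src N v := fun h' => by
      rw [h', hsv] at hi
      split_ifs at hi hj <;> omega
    rw [Function.update_of_ne his']
    by_cases hjs : j = src N v
    · subst hjs
      simpa using hle i
    · rw [Function.update_of_ne hjs]
      have hjs' : (j : ℕ) ≠ v % N := fun h' => hjs (Fin.ext h')
      refine h.lt i j ?_ ?_ <;> simp only [Fin.le_def, Fin.lt_def, hsv] <;>
        split_ifs at hi hj <;> omega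

end RoundRobin

/-- Realizations outside of a null set. -/
structure GoodPath (x : Path N) : Prop where
  energy : Good x.energy
  data : ∀ j, Good (x.data j)
  success : ∀ n, ∃ m, n ≤ m ∧ x.erased m = false

/-- The system as seen from the state after `k` attempts. -/
noncomputable def sysAt (γ : ℝ) (x : Path N) (k : ℕ) : Sys N :=
  (shift x.energy (state γ x k).time, fun j => shift (x.data j) (state γ x k).time,
    fun n => x.erased (k + n))

/-- The number of successful transmissions among the first `k` attempts. -/
def numSuccess (x : Path N) (k : ℕ) : ℕ := Nat.count (fun i => x.erased i = false) k

/-- The index of the `v`-th successful attempt. -/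
noncomputable def successIdx (x : Path N) (v : ℕ) : ℕ := Nat.nth (fun i => x.erased i = false) v

/-- The first attempt after `v` successes. -/
noncomputable def visitStart (x : Path N) : ℕ → ℕ
  | 0 => 0
  | v + 1 => successIdx x v + 1

lemma wait_eq_max (γ t : ℝ) : wait γ t = max t γ := by
  rw [wait, ← max_add_add_left, add_zero, add_sub_cancel, max_comm]

namespace GoodPath

variable {γ : ℝ} {x : Path N} (hx : GoodPath x)
include hx

lemma energyWait_eq (S : State N) : S.energyWait x = shift x.energy S.time 0 := by
  rw [State.energyWait, hx.energy.nextArrival_eq]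
  rfl

lemma dataWait_eq (S : State N) : S.dataWait x = shift (x.data S.source) S.time 0 := by
  rw [State.dataWait, (hx.data _).nextArrival_eq]
  rfl

lemma nextTime_eq (S : State N) : S.nextTime γ x =
    S.time + attemptWait γ (shift x.energy S.time) (shift (x.data S.source) S.time) := by
  rw [State.nextTime, hx.energyWait_eq, hx.dataWait_eq, wait_eq_max]
  rfl

omit hx in
omit [NeZero N] in
lemma attemptWait_pos {a b : ℕ → ℝ} (ha : Good a) : 0 < attemptWait γ a b :=
  ha.pos.trans_le ((le_max_left _ _).trans (le_max_left _ _))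

lemma time_succ (k : ℕ) : (state γ x (k + 1)).time = (state γ x k).time +
    attemptWait γ (sysAt γ x k).1 ((sysAt γ x k).2.1 (state γ x k).source) :=
  hx.nextTime_eq _

lemma time_lt_succ (k : ℕ) : (state γ x k).time < (state γ x (k + 1)).time := by
  rw [hx.time_succ]
  exact lt_add_of_pos_right _ (attemptWait_pos (hx.energy.shift (state γ x k).time))

lemma time_strictMono : StrictMono fun k => (state γ x k).time :=
  strictMono_nat_of_lt_succ hx.time_lt_succ

lemma time_nonneg (k : ℕ) : 0 ≤ (state γ x k).time :=
  hx.time_strictMono.monotone k.zero_le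

/-- Every attempt waits for a new energy arrival. Hence the times of the attempts are unbounded, and
every `t ≥ 0` falls between two of them. -/
lemma energy_le_time (k : ℕ) : x.energy k ≤ (state γ x (k + 1)).time := by
  rw [hx.energy.le_iff]
  have hstep : ∀ k, countUpTo x.energy (state γ x k).time + 1 ≤
      countUpTo x.energy (state γ x (k + 1)).time := by
    intro k
    have : x.energy (countUpTo x.energy (state γ x k).time) ≤ (state γ x (k + 1)).time := by
      have h1 : shift x.energy (state γ x k).time 0 ≤
          attemptWait γ (sysAt γ x k).1 ((sysAt γ x k).2.1 (state γ x k).source) :=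
        (le_max_left _ _).trans (le_max_left _ _)
      rw [hx.time_succ]
      simp only [shift, add_zero] at h1
      linarith
    exact hx.energy.le_iff.1 this
  induction k with
  | zero => exact (Nat.succ_pos _).trans_le (hstep 0)
  | succ k ih => exact (Nat.succ_lt_succ ih).trans_le (hstep (k + 1))

lemma exists_time_between {t : ℝ} (ht : 0 ≤ t) :
    ∃ k, (state γ x k).time ≤ t ∧ t < (state γ x (k + 1)).time := by
  classical
  have hex : ∃ k, t < (state γ x (k + 1)).time := by
    obtain ⟨n, hn⟩ := hx.energy.unbounded t
    exact ⟨n, hn.trans_le (hx.energy_le_time n)⟩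
  refine ⟨Nat.find hex, ?_, Nat.find_spec hex⟩
  cases h : Nat.find hex with
  | zero => exact ht
  | succ k => exact not_lt.1 (Nat.find_min hex (by omega : k < Nat.find hex))

lemma sSup_time_eq {t : ℝ} {k : ℕ} (h1 : (state γ x k).time ≤ t)
    (h2 : t < (state γ x (k + 1)).time) : sSup {k : ℕ | (state γ x k).time ≤ t} = k := by
  apply IsGreatest.csSup_eq
  refine ⟨h1, fun m hm => ?_⟩
  have : (state γ x m).time < (state γ x (k + 1)).time := lt_of_le_of_lt hm h2
  have := hx.time_strictMono.lt_iff_lt.1 this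
  omega

lemma stampAt_eq {t : ℝ} {k : ℕ} (j : Fin N) (h1 : (state γ x k).time ≤ t)
    (h2 : t < (state γ x (k + 1)).time) : stampAt γ x j t = (state γ x k).stamp j := by
  rw [stampAt, hx.sSup_time_eq h1 h2]

/-- Seen from its own current time, the system evolves by `attemptNext`; this connects the dynamics
with the regenerative maps. -/
lemma sysAt_succ (hγ : 0 ≤ γ) (k : ℕ) :
    sysAt γ x (k + 1) = attemptNext γ (state γ x k).source (sysAt γ x k) := by
  have h := hx.time_succ (γ := γ) k
  have hw : 0 ≤ attemptWait γ (sysAt γ x k).1 ((sysAt γ x k).2.1 (state γ x k).source) :=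
    attemptWait_nonneg hγ _ _
  refine Prod.ext ?_ (Prod.ext ?_ ?_)
  · change shift x.energy _ = shift (shift x.energy _) _
    rw [hx.energy.shift_shift hw, h]
  · funext j
    change shift (x.data j) _ = shift (shift (x.data j) _) _
    rw [(hx.data j).shift_shift hw, h]
  · funext n
    change x.erased (k + 1 + n) = x.erased (k + (n + 1))
    congr 1
    ring

lemma latestArrival_eq (hγ : 0 ≤ γ) (k : ℕ) :
    latestArrival (x.data (state γ x k).source) (state γ x (k + 1)).time =
      (state γ x k).time + lastUpTo ((sysAt γ x k).2.1 (state γ x k).source)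
        (attemptWait γ (sysAt γ x k).1 ((sysAt γ x k).2.1 (state γ x k).source)) := by
  have hw : 0 ≤ attemptWait γ (sysAt γ x k).1 ((sysAt γ x k).2.1 (state γ x k).source) :=
    attemptWait_nonneg hγ _ _
  have hle : (sysAt γ x k).2.1 (state γ x k).source 0 ≤
      attemptWait γ (sysAt γ x k).1 ((sysAt γ x k).2.1 (state γ x k).source) :=
    (le_max_right _ _).trans (le_max_left _ _)
  have hg := hx.data (state γ x k).source
  have e := hg.lastUpTo_shift (t := (state γ x k).time) hw hle
  rw [hg.latestArrival_eq, hx.time_succ]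
  · exact e.symm
  · rw [hx.time_succ]
    have : x.data (state γ x k).source 0 ≤
        x.data (state γ x k).source (countUpTo (x.data (state γ x k).source) (state γ x k).time) :=
      hg.mono.monotone (Nat.zero_le _)
    simp only [sysAt, shift, add_zero] at hle ⊢
    linarith

lemma state_succ_of_true {k : ℕ} (h : x.erased k = true) :
    state γ x (k + 1) = ⟨(state γ x (k + 1)).time, (state γ x k).stamp⟩ := by
  simp [state, h]

lemma state_succ_of_false {k : ℕ} (h : x.erased k = false) :
    state γ x (k + 1) = ⟨(state γ x (k + 1)).time, Function.update (state γ x k).stamp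
      (state γ x k).source (latestArrival (x.data (state γ x k).source)
        (state γ x (k + 1)).time)⟩ := by
  simp [state, h]

/-- Invariant of the dynamics. Initially all stamps are `0` and source `0` wins the tie; afterwards
each packet sent has arrived strictly after the previous attempt, as `RoundRobin.success` needs. -/
lemma roundRobin (hγ : 0 ≤ γ) (k : ℕ) : RoundRobin (state γ x k) (src N (numSuccess x k)) := by
  induction k with
  | zero =>
    refine ⟨fun κ => le_rfl, fun _ _ _ _ => le_rfl, fun i j hj _ => ?_⟩
    simp [numSuccess, src] at hj
  | succ k ih =>
    have hs := ih.source_eq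
    cases he : x.erased k with
    | true =>
      rw [hx.state_succ_of_true he, numSuccess, Nat.count_succ]
      simpa [he] using! ih.failure (hx.time_lt_succ k).le
    | false =>
      rw [hx.state_succ_of_false he, numSuccess, Nat.count_succ, hx.latestArrival_eq hγ]
      simp only [he, if_true]
      have hg : Good ((sysAt γ x k).2.1 (state γ x k).source) := (hx.data _).shift _
      have hle : (sysAt γ x k).2.1 (state γ x k).source 0 ≤
          attemptWait γ (sysAt γ x k).1 ((sysAt γ x k).2.1 (state γ x k).source) :=
        (le_max_right _ _).trans (le_max_left _ _)
      have := ih.success (t := (state γ x (k + 1)).time)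
        (u := (state γ x k).time + lastUpTo ((sysAt γ x k).2.1 (state γ x k).source)
          (attemptWait γ (sysAt γ x k).1 ((sysAt γ x k).2.1 (state γ x k).source)))
        (by linarith [hg.lastUpTo_pos (attemptWait γ (sysAt γ x k).1
          ((sysAt γ x k).2.1 (state γ x k).source))])
        (by rw [hx.time_succ]; linarith [hg.lastUpTo_le hle])
      rw [← hs] at this
      rw [hs] at this ⊢
      exact this

lemma source_eq (hγ : 0 ≤ γ) (k : ℕ) : (state γ x k).source = src N (numSuccess x k) :=
  (hx.roundRobin hγ k).source_eq

/-! ### Visits -/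

lemma infinite_success : {i | x.erased i = false}.Infinite :=
  Set.infinite_of_forall_exists_gt fun n => by
    obtain ⟨m, hm, h⟩ := hx.success (n + 1)
    exact ⟨m, h, hm⟩

lemma erased_successIdx (v : ℕ) : x.erased (successIdx x v) = false :=
  Nat.nth_mem_of_infinite hx.infinite_success v

lemma numSuccess_successIdx (v : ℕ) : numSuccess x (successIdx x v) = v :=
  Nat.count_nth_of_infinite hx.infinite_success v

lemma numSuccess_visitStart (v : ℕ) : numSuccess x (visitStart x v) = v := by
  cases v with
  | zero => rfl
  | succ v =>
    rw [visitStart, numSuccess, Nat.count_succ, if_pos (hx.erased_successIdx v)]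
    exact congrArg (· + 1) (hx.numSuccess_successIdx v)

omit hx in
omit [NeZero N] in
lemma numSuccess_mono : Monotone (numSuccess x) := Nat.count_monotone _

lemma visitStart_le_of_le {v k : ℕ} (h : v ≤ numSuccess x k) : visitStart x v ≤ k := by
  cases v with
  | zero => exact Nat.zero_le _
  | succ v => exact Nat.nth_lt_of_lt_count (p := fun i => x.erased i = false) h

lemma visitStart_strictMono : StrictMono (visitStart x) := by
  intro u v huv
  by_contra! h
  have := numSuccess_mono (x := x) h
  rw [hx.numSuccess_visitStart, hx.numSuccess_visitStart] at this
  omega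

lemma visitStart_le_successIdx (v : ℕ) : visitStart x v ≤ successIdx x v :=
  hx.visitStart_le_of_le (hx.numSuccess_successIdx v).ge

lemma numSuccess_of_mem {v k : ℕ} (h1 : visitStart x v ≤ k) (h2 : k ≤ successIdx x v) :
    numSuccess x k = v := by
  have := numSuccess_mono (x := x) h1
  have := numSuccess_mono (x := x) h2
  rw [hx.numSuccess_visitStart] at *
  rw [hx.numSuccess_successIdx] at *
  omega

lemma isSuccess_iff (hγ : 0 ≤ γ) (j : Fin N) (k : ℕ) :
    IsSuccess γ x j k ↔ src N (numSuccess x k) = j ∧ x.erased k = false := by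
  rw [IsSuccess, hx.source_eq hγ]

/-- Successes of source `j` are those whose overall number, counted from `0`, is congruent to `j`
modulo `N`. -/
lemma count_isSuccess (hγ : 0 ≤ γ) (j : Fin N) (k : ℕ) [DecidablePred (IsSuccess γ x j)] :
    Nat.count (IsSuccess γ x j) k = Nat.count (· ≡ j [MOD N]) (numSuccess x k) := by
  induction k with
  | zero => rfl
  | succ k ih =>
    have hsucc : numSuccess x (k + 1) = numSuccess x k + if x.erased k = false then 1 else 0 :=
      Nat.count_succ _ _
    rw [Nat.count_succ, ih, hsucc]
    have hmod : numSuccess x k ≡ j [MOD N] ↔ src N (numSuccess x k) = j := by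
      rw [Nat.ModEq, Nat.mod_eq_of_lt j.isLt, Fin.ext_iff]
      rfl
    by_cases he : x.erased k = false
    · rw [if_pos he, Nat.count_succ]
      simp only [hx.isSuccess_iff hγ, he, and_true]
      simp only [hmod]
    · rw [if_neg he, if_neg (fun h' => he ((hx.isSuccess_iff hγ j k).1 h').2), add_zero, add_zero]

omit hx in
lemma count_modEq_add_mul (j : Fin N) (i : ℕ) : Nat.count (· ≡ j [MOD N]) (j + i * N) = i := by
  rw [Nat.count_modEq_card _ (NeZero.pos N), Nat.add_mul_div_right _ _ (NeZero.pos N),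
    Nat.add_mul_mod_self_right, Nat.div_eq_of_lt j.isLt]
  simp

lemma nth_isSuccess (hγ : 0 ≤ γ) (j : Fin N) (i : ℕ) :
    Nat.nth (IsSuccess γ x j) i = successIdx x (j + i * N) := by
  classical
  have hp : IsSuccess γ x j (successIdx x (j + i * N)) := by
    rw [hx.isSuccess_iff hγ, hx.numSuccess_successIdx, src_add_mul]
    exact ⟨rfl, hx.erased_successIdx _⟩
  have := Nat.nth_count hp
  rwa [hx.count_isSuccess hγ, hx.numSuccess_successIdx, count_modEq_add_mul] at this

/-- Epochs are counted from `1` and visits from `0`: epoch `i + 1` of source `j` ends with visit `j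
+ i * N`, the only one in it that serves `j`. -/
lemma firstAttempt_eq (hγ : 0 ≤ γ) (j : Fin N) (i : ℕ) :
    firstAttempt γ x j (i + 1) = visitStart x (j + i * N) := by
  classical
  apply IsLeast.csInf_eq
  have hcount := fun k => hx.count_isSuccess hγ j k
  refine ⟨⟨?_, ?_⟩, fun k hk => ?_⟩
  · rw [hx.source_eq hγ, hx.numSuccess_visitStart, src_add_mul]
  · rw [hx.count_isSuccess hγ, hx.numSuccess_visitStart, count_modEq_add_mul]
    simp
  · obtain ⟨h1, h2⟩ := hk
    refine hx.visitStart_le_of_le (le_of_eq ?_)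
    rw [hx.count_isSuccess hγ] at h2
    rw [hx.source_eq hγ] at h1
    have h3 : numSuccess x k = j + numSuccess x k / N * N := by
      have := Nat.mod_add_div' (numSuccess x k) N
      rw [Fin.ext_iff] at h1
      change numSuccess x k % N = j at h1
      omega
    rw [h3, count_modEq_add_mul, Nat.add_sub_cancel] at h2
    rw [h2] at h3
    exact h3.symm

end GoodPath
end Dynamics

/-! ### Visits and epochs as functionals of the arrivals and erasures -/

section Visits

variable {N : ℕ}

/-- The observations of successful attempts. -/
def successSet : Set ((ℝ × ℝ) × Bool) := {r | r.2 = false}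

/-- The duration of a visit, the age of the packet that is delivered at its end, and the waiting
time of its first attempt, in terms of the observations of the attempts. -/
noncomputable def visitStats (f : ℕ → (ℝ × ℝ) × Bool) : ℝ × ℝ × ℝ :=
  (totalUntil successSet (fun r => r.1.1) f, valueAt successSet (fun r => r.1.2) f, (f 0).1.1)

/-- The statistics of a visit of source `s`. -/
noncomputable def visitObs (γ : ℝ) (s : Fin N) (y : Sys N) : ℝ × ℝ × ℝ :=
  visitStats (history (attemptObs γ s) (attemptNext γ s) y)

/-- The system after a visit of source `s`. -/
noncomputable def visitNext (γ : ℝ) (s : Fin N) (y : Sys N) : Sys N :=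
  (attemptNext γ s)^[hitTime successSet (history (attemptObs γ s) (attemptNext γ s) y) + 1] y

lemma iterate_attemptNext_erased (γ : ℝ) (s : Fin N) (y : Sys N) (m n : ℕ) :
    ((attemptNext γ s)^[m] y).2.2 n = y.2.2 (m + n) := by
  induction m generalizing n with
  | zero => simp
  | succ m ih =>
    rw [Function.iterate_succ_apply']
    change ((attemptNext γ s)^[m] y).2.2 (n + 1) = _
    rw [ih, add_assoc, add_comm 1 n]

lemma history_attempt_erased (γ : ℝ) (s : Fin N) (y : Sys N) (m : ℕ) :
    (history (attemptObs γ s) (attemptNext γ s) y m).2 = y.2.2 m :=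
  iterate_attemptNext_erased γ s y m 0

variable [NeZero N]

/-- The system at the start of visit number `v`. -/
noncomputable def visitSys (γ : ℝ) (y : Sys N) : ℕ → Sys N
  | 0 => y
  | v + 1 => visitNext γ (src N v) (visitSys γ y v)

/-- The duration of visit number `v`. -/
noncomputable def visitLength (γ : ℝ) (v : ℕ) (y : Sys N) : ℝ :=
  (visitObs γ (src N v) (visitSys γ y v)).1

/-- The age of the packet delivered at the end of visit number `v`. -/
noncomputable def visitAge (γ : ℝ) (v : ℕ) (y : Sys N) : ℝ :=
  (visitObs γ (src N v) (visitSys γ y v)).2.1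

/-- The waiting time of the first attempt of visit number `v`. -/
noncomputable def visitWait (γ : ℝ) (v : ℕ) (y : Sys N) : ℝ :=
  (visitObs γ (src N v) (visitSys γ y v)).2.2

/-- The number of the first visit of epoch `i + 1` of source `j`. -/
def epochStart {N : ℕ} (j : Fin N) : ℕ → ℕ
  | 0 => 0
  | i + 1 => j + i * N + 1

/-- The components of a realization. -/
def Path.toSys (x : Path N) : Sys N := (x.energy, x.data, x.erased)

namespace GoodPath

variable {γ : ℝ} {x : Path N} (hx : GoodPath x) (hγ : 0 ≤ γ)
include hx hγ

lemma sysAt_zero : sysAt γ x 0 = x.toSys := by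
  refine Prod.ext ?_ (Prod.ext ?_ ?_)
  · exact hx.energy.shift_zero
  · funext j
    exact (hx.data j).shift_zero
  · funext n
    simp [sysAt, Path.toSys]

lemma sysAt_visit (v m : ℕ) (hm : visitStart x v + m ≤ successIdx x v + 1) :
    sysAt γ x (visitStart x v + m) = (attemptNext γ (src N v))^[m] (sysAt γ x (visitStart x v)) := by
  induction m with
  | zero => rfl
  | succ m ih =>
    rw [Function.iterate_succ_apply', ← ih (by omega), ← add_assoc, hx.sysAt_succ hγ,
      hx.source_eq hγ, hx.numSuccess_of_mem (by omega) (by omega : _ ≤ successIdx x v)]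

lemma history_visit (v m : ℕ) (hm : visitStart x v + m ≤ successIdx x v) :
    history (attemptObs γ (src N v)) (attemptNext γ (src N v)) (sysAt γ x (visitStart x v)) m =
      attemptObs γ (src N v) (sysAt γ x (visitStart x v + m)) := by
  rw [hx.sysAt_visit hγ v m (by omega)]
  rfl

lemma hitTime_visit (v : ℕ) : visitStart x v + hitTime successSet
    (history (attemptObs γ (src N v)) (attemptNext γ (src N v)) (sysAt γ x (visitStart x v))) =
      successIdx x v := by
  have hle := hx.visitStart_le_successIdx v
  have herased : ∀ m, (history (attemptObs γ (src N v)) (attemptNext γ (src N v))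
      (sysAt γ x (visitStart x v)) m) ∈ successSet ↔ x.erased (visitStart x v + m) = false := by
    intro m
    change (history (attemptObs γ (src N v)) (attemptNext γ (src N v))
      (sysAt γ x (visitStart x v)) m).2 = false ↔ _
    rw [history_attempt_erased]
    rfl
  have hlast : x.erased (visitStart x v + (successIdx x v - visitStart x v)) = false := by
    rw [Nat.add_sub_cancel' hle]
    exact hx.erased_successIdx v
  have := (hitTime_eq_iff (n := successIdx x v - visitStart x v) ⟨_, (herased _).2 hlast⟩).2
    ⟨(herased _).2 hlast, fun m hm h' => by
      rw [herased] at h'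
      have h1 := hx.numSuccess_of_mem (k := visitStart x v + m) (by omega)
        (by omega : _ ≤ successIdx x v)
      have h2 := numSuccess_mono (x := x) (by omega : visitStart x v + m + 1 ≤ successIdx x v)
      rw [hx.numSuccess_successIdx, numSuccess, Nat.count_succ, if_pos h'] at h2
      change numSuccess x (visitStart x v + m) + 1 ≤ v at h2
      omega⟩
  omega

/-- The dynamics, driven by ages, and the iteration of `visitNext`, driven by the round robin alone,
produce the same systems. Only the latter is used for computing laws. -/
lemma sysAt_visitStart (v : ℕ) : sysAt γ x (visitStart x v) = visitSys γ x.toSys v := by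
  induction v with
  | zero => exact hx.sysAt_zero hγ
  | succ v ih =>
    have h := hx.hitTime_visit hγ v
    rw [visitSys, visitNext, ← ih, ← hx.sysAt_visit hγ v _ (by omega), ← add_assoc, h]
    rfl

lemma time_visit (v m : ℕ) (hm : visitStart x v + m ≤ successIdx x v + 1) :
    (state γ x (visitStart x v + m)).time = (state γ x (visitStart x v)).time +
      ∑ i ∈ Finset.range m, (history (attemptObs γ (src N v)) (attemptNext γ (src N v))
        (sysAt γ x (visitStart x v)) i).1.1 := by
  induction m with
  | zero => simp
  | succ m ih =>
    rw [Finset.sum_range_succ, ← add_assoc, ← add_assoc, ← ih (by omega), hx.time_succ,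
      hx.history_visit hγ v m (by omega), hx.source_eq hγ,
      hx.numSuccess_of_mem (by omega) (by omega : _ ≤ successIdx x v)]
    rfl

lemma time_visitStart (v : ℕ) :
    (state γ x (visitStart x v)).time = ∑ u ∈ Finset.range v, visitLength γ u x.toSys := by
  induction v with
  | zero => rfl
  | succ v ih =>
    have h := hx.hitTime_visit hγ v
    have h1 : visitStart x (v + 1) = visitStart x v + (hitTime successSet (history
        (attemptObs γ (src N v)) (attemptNext γ (src N v)) (sysAt γ x (visitStart x v))) + 1) := by
      rw [← add_assoc, h]
      rfl
    rw [Finset.sum_range_succ, ← ih, h1, hx.time_visit hγ v _ (by omega), visitLength,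
      ← hx.sysAt_visitStart hγ]
    rfl

lemma stamp_visitStart (v : ℕ) : (state γ x (visitStart x (v + 1))).time -
    (state γ x (visitStart x (v + 1))).stamp (src N v) = visitAge γ v x.toSys := by
  have hsrc : (state γ x (successIdx x v)).source = src N v := by
    rw [hx.source_eq hγ, hx.numSuccess_successIdx]
  have h := hx.hitTime_visit hγ v
  have hhist := hx.history_visit hγ v _ h.le
  rw [visitAge, ← hx.sysAt_visitStart hγ, visitObs, visitStats, valueAt]
  dsimp only
  rw [hhist, h]
  change (state γ x (successIdx x v + 1)).time - (state γ x (successIdx x v + 1)).stamp _ = _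
  rw [hx.state_succ_of_false (hx.erased_successIdx v), hx.latestArrival_eq hγ, hx.time_succ, hsrc]
  simp only [Function.update_self, attemptObs, attemptAge]
  ring

lemma stamp_eq_of_not_success {j : Fin N} {k : ℕ} (h : ¬ IsSuccess γ x j k) :
    (state γ x (k + 1)).stamp j = (state γ x k).stamp j := by
  cases he : x.erased k with
  | true => rw [hx.state_succ_of_true he]
  | false =>
    rw [hx.state_succ_of_false he]
    have : j ≠ (state γ x k).source := fun h' => h ⟨h'.symm, he⟩
    simp [this]

/-- A success of `j` inside the epoch would have a number congruent to `j` modulo `N` strictly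
between those of the two successes that delimit the epoch, or below `j` in the first epoch. -/
lemma stamp_epoch (j : Fin N) (i k : ℕ) (h1 : visitStart x (epochStart j i) ≤ k)
    (h2 : k < visitStart x (epochStart j (i + 1))) :
    (state γ x k).stamp j = (state γ x (visitStart x (epochStart j i))).stamp j := by
  induction k, h1 using Nat.le_induction with
  | base => rfl
  | succ k hk ih =>
    rw [← ih (by omega)]
    refine hx.stamp_eq_of_not_success hγ fun hs => ?_
    rw [hx.isSuccess_iff hγ] at hs
    have hlt : k < successIdx x (j + i * N) := Nat.lt_of_succ_lt_succ h2
    have c1 := numSuccess_mono (x := x) hk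
    have c2 := numSuccess_mono (x := x) (Nat.succ_le_of_lt hlt)
    rw [hx.numSuccess_visitStart] at c1
    rw [hx.numSuccess_successIdx, Nat.succ_eq_add_one, numSuccess, Nat.count_succ,
      if_pos hs.2] at c2
    change numSuccess x k + 1 ≤ j + i * N at c2
    have hmod : numSuccess x k = j + numSuccess x k / N * N := by
      have := Nat.mod_add_div' (numSuccess x k) N
      have h3 := hs.1
      rw [Fin.ext_iff] at h3
      change numSuccess x k % N = j at h3
      omega
    have hupper : numSuccess x k / N < i := by
      have : numSuccess x k / N * N < i * N := by omega
      exact Nat.lt_of_mul_lt_mul_right this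
    cases i with
    | zero => omega
    | succ i =>
      simp only [epochStart] at c1
      have : i * N < numSuccess x k / N * N := by omega
      have := Nat.lt_of_mul_lt_mul_right this
      omega

lemma successTime_eq (j : Fin N) (i : ℕ) :
    successTime γ x j i = (state γ x (visitStart x (epochStart j i))).time := by
  cases i with
  | zero => rfl
  | succ i =>
    rw [successTime, hx.nth_isSuccess hγ]
    rfl

lemma startAge_eq (j : Fin N) (i : ℕ) : startAge γ x j i =
    (state γ x (visitStart x (epochStart j i))).time -
      (state γ x (visitStart x (epochStart j i))).stamp j := by
  rw [startAge, aoi, hx.successTime_eq hγ, hx.stampAt_eq j le_rfl (hx.time_lt_succ _)]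

lemma startAge_zero (j : Fin N) : startAge γ x j 0 = 0 := by
  rw [hx.startAge_eq hγ]
  simp [epochStart, visitStart, state]

lemma startAge_succ (j : Fin N) (i : ℕ) :
    startAge γ x j (i + 1) = visitAge γ (j + i * N) x.toSys := by
  rw [hx.startAge_eq hγ, ← hx.stamp_visitStart hγ, src_add_mul]
  rfl

lemma epochStart_lt (j : Fin N) (i : ℕ) : epochStart j i < epochStart j (i + 1) := by
  have := NeZero.pos N
  cases i with
  | zero => simp [epochStart]
  | succ i =>
    simp only [epochStart]
    have : i * N < (i + 1) * N := Nat.mul_lt_mul_of_pos_right (Nat.lt_succ_self i) this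
    omega

lemma epochLength_eq (j : Fin N) (i : ℕ) : epochLength γ x j (i + 1) =
    ∑ u ∈ Finset.Ico (epochStart j i) (epochStart j (i + 1)), visitLength γ u x.toSys := by
  rw [epochLength, Nat.add_sub_cancel, hx.successTime_eq hγ, hx.successTime_eq hγ,
    hx.time_visitStart hγ, hx.time_visitStart hγ,
    Finset.sum_Ico_eq_sub _ (hx.epochStart_lt hγ j i).le]

lemma epochArea_eq (j : Fin N) (i : ℕ) : epochArea γ x j (i + 1) =
    startAge γ x j i * epochLength γ x j (i + 1) + epochLength γ x j (i + 1) ^ 2 / 2 := by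
  have hlt : successTime γ x j i < successTime γ x j (i + 1) := by
    rw [hx.successTime_eq hγ, hx.successTime_eq hγ]
    exact hx.time_strictMono (hx.visitStart_strictMono (hx.epochStart_lt hγ j i))
  have h0 : 0 ≤ successTime γ x j i := by
    rw [hx.successTime_eq hγ]
    exact hx.time_nonneg _
  -- The interval is open because at its right end the new packet has already been received and the
  -- age has dropped.
  have hcongr : ∀ t ∈ Set.Ioo (successTime γ x j i) (successTime γ x j (i + 1)),
      aoi γ x j t = t - (successTime γ x j i - startAge γ x j i) := by
    intro t ht
    obtain ⟨k, hk1, hk2⟩ := hx.exists_time_between (γ := γ) (h0.trans ht.1.le)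
    rw [hx.successTime_eq hγ, hx.successTime_eq hγ] at ht
    have a1 := hx.time_strictMono.lt_iff_lt.1 (ht.1.trans hk2)
    have a2 := hx.time_strictMono.lt_iff_lt.1 (hk1.trans_lt ht.2)
    rw [aoi, hx.stampAt_eq j hk1 hk2, hx.stamp_epoch hγ j i k (by omega) a2, hx.startAge_eq hγ,
      hx.successTime_eq hγ]
    ring
  have hint : epochArea γ x j (i + 1) = ∫ t in (successTime γ x j i)..(successTime γ x j (i + 1)),
      (t - (successTime γ x j i - startAge γ x j i)) := by
    rw [epochArea, Nat.add_sub_cancel, intervalIntegral.integral_of_le hlt.le,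
      intervalIntegral.integral_of_le hlt.le, integral_Ioc_eq_integral_Ioo,
      integral_Ioc_eq_integral_Ioo]
    exact setIntegral_congr_fun measurableSet_Ioo hcongr
  rw [hint, intervalIntegral.integral_sub (by simp) (by simp), integral_id,
    intervalIntegral.integral_const, epochLength, Nat.add_sub_cancel, smul_eq_mul]
  ring

lemma firstWait_eq (j : Fin N) (i : ℕ) :
    firstWait γ x j (i + 1) = visitWait γ (j + i * N) x.toSys := by
  have hsrc : (state γ x (visitStart x (j + i * N))).source = src N (j + i * N) := by
    rw [hx.source_eq hγ, hx.numSuccess_visitStart]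
  rw [firstWait, firstEnergy, firstData, hx.firstAttempt_eq hγ, hx.energyWait_eq, hx.dataWait_eq,
    wait_eq_max, visitWait, ← hx.sysAt_visitStart hγ, hsrc]
  rfl

end GoodPath
end Visits

/-! ### The statistics of a visit -/

lemma measurableSet_successSet : MeasurableSet successSet :=
  measurableSet_eq_fun (f := fun r : (ℝ × ℝ) × Bool => r.2) measurable_snd measurable_const

lemma measurable_visitStats : Measurable visitStats := by
  have h1 := measurable_totalUntil (M := ℝ) measurableSet_successSet
    (w := fun r : (ℝ × ℝ) × Bool => r.1.1) (by fun_prop)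
  have h2 := measurable_valueAt (M := ℝ) measurableSet_successSet
    (g := fun r : (ℝ × ℝ) × Bool => r.1.2) (by fun_prop)
  unfold visitStats
  fun_prop

/-- The mean duration of a visit, for first moment `m` of the waiting time of an attempt. -/
noncomputable def visitMean (q m : ℝ) : ℝ := m / (1 - q)

/-- The second moment of the duration of a visit, for moments `m` and `m'` of the waiting time of an
attempt. -/
noncomputable def visitSecond (q m m' : ℝ) : ℝ := (m' + 2 * q * m * visitMean q m) / (1 - q)

lemma integral_eq_of_lintegral_ofReal {α : Type*} [MeasurableSpace α] {μ : Measure α} {f : α → ℝ}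
    {c : ℝ} (hf : Measurable f) (h0 : 0 ≤ᵐ[μ] f) (hc : 0 ≤ c)
    (h : ∫⁻ x, ENNReal.ofReal (f x) ∂μ = ENNReal.ofReal c) : ∫ x, f x ∂μ = c := by
  rw [integral_eq_lintegral_of_nonneg_ae h0 hf.aestronglyMeasurable, h, ENNReal.toReal_ofReal hc]

lemma memLp_two_of_lintegral_ofReal {α : Type*} [MeasurableSpace α] {μ : Measure α} {f : α → ℝ}
    (hf : Measurable f) (h : ∫⁻ x, ENNReal.ofReal (f x ^ 2) ∂μ ≠ ∞) : MemLp f 2 μ := by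
  refine (memLp_two_iff_integrable_sq hf.aestronglyMeasurable).2
    ⟨(hf.pow_const 2).aestronglyMeasurable, ?_⟩
  rw [hasFiniteIntegral_iff_ofReal (.of_forall fun x => sq_nonneg _)]
  exact h.lt_top

/-- Solves the first-step equations. Finiteness of `x` has to be assumed, since `∞` is a solution as
well when `q > 0`. -/
lemma eq_div_of_eq_add_mul {x : ℝ≥0∞} {A q : ℝ} (hA : 0 ≤ A) (hq0 : 0 ≤ q) (hq : q < 1)
    (hx : x ≠ ∞) (h : x = ENNReal.ofReal A + ENNReal.ofReal q * x) :
    x = ENNReal.ofReal (A / (1 - q)) := by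
  have h1 : x.toReal = A + q * x.toReal := by
    conv_lhs => rw [h]
    rw [ENNReal.toReal_add (by simp) (by finiteness), ENNReal.toReal_mul,
      ENNReal.toReal_ofReal hA, ENNReal.toReal_ofReal hq0]
  have h2 : x.toReal = A / (1 - q) := by
    rw [eq_div_iff (by linarith)]
    linarith
  rw [← h2, ENNReal.ofReal_toReal hx]

namespace IsSysLaw

variable {N : ℕ} {Θ : Measure (Sys N)} {lamE : ℝ} {lamD : Fin N → ℝ} {q : ℝ}
    {μ : Measure (ℕ → ℝ)} {ν : Fin N → Measure (ℕ → ℝ)} {β : Measure (ℕ → Bool)} {γ : ℝ}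

/-- The erasure of the next attempt is independent of the arrivals, hence of its waiting time and of
the age of its packet. -/
lemma lintegral_attempt_mul (h : IsSysLaw Θ lamE lamD q μ ν β) (s : Fin N)
    {F : (ℕ → ℝ) × (ℕ → ℝ) → ℝ≥0∞} (hF : Measurable F) {g : Bool → ℝ≥0∞} (hg : Measurable g) :
    ∫⁻ y, F (y.1, y.2.1 s) * g (y.2.2 0) ∂Θ =
      (∫⁻ a, ∫⁻ b, F (a, b) ∂ν s ∂μ) * ∫⁻ b, g (b 0) ∂β := by
  have := h.energy.prob
  have := fun j => (h.data j).prob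
  have := h.prob
  have hmp := measurePreserving_eval ν s
  rw [h.eq, lintegral_prod _ (by fun_prop), ← lintegral_mul_const _ hF.lintegral_prod_right']
  refine lintegral_congr fun a => ?_
  rw [lintegral_prod _ (by fun_prop)]
  dsimp only
  have e : ∀ D : Fin N → ℕ → ℝ, ∫⁻ b : ℕ → Bool, F (a, D s) * g (b 0) ∂β =
      F (a, D s) * ∫⁻ b, g (b 0) ∂β := fun D => lintegral_const_mul _ (by fun_prop)
  simp_rw [e]
  rw [lintegral_mul_const _ (by fun_prop), ← hmp.map_eq,
    lintegral_map (f := fun b => F (a, b)) (by fun_prop) hmp.measurable]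

lemma lintegral_attempt (h : IsSysLaw Θ lamE lamD q μ ν β) (s : Fin N)
    {F : (ℕ → ℝ) × (ℕ → ℝ) → ℝ≥0∞} (hF : Measurable F) :
    ∫⁻ y, F (y.1, y.2.1 s) ∂Θ = ∫⁻ a, ∫⁻ b, F (a, b) ∂ν s ∂μ := by
  have := h.prob
  simpa using h.lintegral_attempt_mul s hF (g := fun _ => 1) measurable_const

lemma ae_good (h : IsSysLaw Θ lamE lamD q μ ν β) (hE : 0 < lamE) (hD : ∀ j, 0 < lamD j)
    (hq : q < 1) :
    ∀ᵐ y ∂Θ, Good y.1 ∧ (∀ j, Good (y.2.1 j)) ∧ ∃ n, y.2.2 n = false := by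
  have := h.energy.prob
  have := fun j => (h.data j).prob
  have := h.prob
  rw [h.eq]
  have h1 : ∀ᵐ y ∂μ.prod ((Measure.pi ν).prod β), Good y.1 :=
    Measure.quasiMeasurePreserving_fst.ae (h.energy.ae_good hE)
  have h2 : ∀ᵐ D ∂Measure.pi ν, ∀ j, Good (D j) := ae_all_iff.2 fun j =>
    (measurePreserving_eval ν j).quasiMeasurePreserving.ae ((h.data j).ae_good (hD j))
  have h3 : ∀ᵐ y ∂μ.prod ((Measure.pi ν).prod β), ∀ j, Good (y.2.1 j) :=
    Measure.quasiMeasurePreserving_snd.ae (Measure.quasiMeasurePreserving_fst.ae h2)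
  have h4 : ∀ᵐ y ∂μ.prod ((Measure.pi ν).prod β), ∃ n, y.2.2 n = false :=
    Measure.quasiMeasurePreserving_snd.ae (Measure.quasiMeasurePreserving_snd.ae
      (ae_exists_false h.erased (by
        rw [h.erased_true]
        exact ENNReal.ofReal_lt_one.2 hq)))
  filter_upwards [h1, h3, h4] with y a b c using ⟨a, b, c⟩

lemma ae_hit (h : IsSysLaw Θ lamE lamD q μ ν β) (hE : 0 < lamE) (hD : ∀ j, 0 < lamD j)
    (hq : q < 1) (s : Fin N) :
    ∀ᵐ y ∂Θ, ∃ n, history (attemptObs γ s) (attemptNext γ s) y n ∈ successSet := by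
  filter_upwards [h.ae_good hE hD hq] with y hy
  obtain ⟨n, hn⟩ := hy.2.2
  exact ⟨n, (history_attempt_erased γ s y n).trans hn⟩

/-- Strong Markov property at the first success: the statistics of a visit are determined by the
observations of its own attempts. -/
lemma visit (h : IsSysLaw Θ lamE lamD q μ ν β) (hE : 0 < lamE) (hD : ∀ j, 0 < lamD j)
    (hq : q < 1) (hγ : 0 ≤ γ) (s : Fin N) :
    Regenerative Θ (visitObs γ s) (visitNext γ s) := by
  have := h.isProbabilityMeasure
  refine (h.attempt hE hD hγ s).iterate_hitTime measurableSet_successSet (h.ae_hit hE hD hq s)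
    measurable_visitStats fun f g n hn hlt hfg => ?_
  have hg : g n ∈ successSet := hfg n le_rfl ▸ hn
  have h1 : hitTime successSet f = n := (hitTime_eq_iff ⟨n, hn⟩).2 ⟨hn, hlt⟩
  have h2 : hitTime successSet g = n := (hitTime_eq_iff ⟨n, hg⟩).2
    ⟨hg, fun m hm => hfg m hm.le ▸ hlt m hm⟩
  have h3 : totalUntil successSet (fun r : (ℝ × ℝ) × Bool => r.1.1) f =
      totalUntil successSet (fun r => r.1.1) g := by
    rw [totalUntil, totalUntil, h1, h2]
    refine Finset.sum_congr rfl fun m hm => ?_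
    rw [hfg m (by simpa [Nat.lt_succ_iff] using hm)]
  have h4 : valueAt successSet (fun r : (ℝ × ℝ) × Bool => r.1.2) f =
      valueAt successSet (fun r => r.1.2) g := by
    rw [valueAt, valueAt, h1, h2, hfg n le_rfl]
  rw [visitStats, visitStats, h3, h4, hfg 0 (Nat.zero_le _)]

/-- The packet delivered arrived during the last waiting period of the visit. Domination by the
duration also yields integrability of the age. -/
lemma ae_age (h : IsSysLaw Θ lamE lamD q μ ν β) (hE : 0 < lamE) (hD : ∀ j, 0 < lamD j)
    (hq : q < 1) (hγ : 0 ≤ γ) (s : Fin N) :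
    ∀ᵐ y ∂Θ, 0 ≤ (visitObs γ s y).2.1 ∧ (visitObs γ s y).2.1 ≤ (visitObs γ s y).1 := by
  have := h.isProbabilityMeasure
  have hreg := h.attempt hE hD hγ s
  have h1 : ∀ᵐ y ∂Θ, 0 ≤ (attemptObs γ s y).1.2 ∧
      (attemptObs γ s y).1.2 ≤ (attemptObs γ s y).1.1 := by
    filter_upwards [h.ae_good hE hD hq] with y hy
    have hb := hy.2.1 s
    refine ⟨sub_nonneg.2 (hb.lastUpTo_le ((le_max_right _ _).trans (le_max_left _ _))),
      sub_le_self _ (hb.lastUpTo_pos _).le⟩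
  have h2 : ∀ᵐ y ∂Θ, ∀ n, 0 ≤ (history (attemptObs γ s) (attemptNext γ s) y n).1.2 ∧
      (history (attemptObs γ s) (attemptNext γ s) y n).1.2 ≤
        (history (attemptObs γ s) (attemptNext γ s) y n).1.1 := ae_all_iff.2 fun n =>
    (hreg.measurePreserving.iterate n).quasiMeasurePreserving.ae h1
  filter_upwards [h2] with y hy
  refine ⟨(hy _).1, (hy _).2.trans ?_⟩
  exact Finset.single_le_sum (f := fun m => (history (attemptObs γ s) (attemptNext γ s) y m).1.1)
    (fun m _ => attemptWait_nonneg hγ _ _) (Finset.self_mem_range_succ _)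

lemma visitLength_nonneg (hγ : 0 ≤ γ) (s : Fin N) (y : Sys N) : 0 ≤ (visitObs γ s y).1 := by
  simp only [visitObs, visitStats, totalUntil]
  exact Finset.sum_nonneg fun _ _ => attemptWait_nonneg hγ _ _

lemma ofReal_visitLength (hγ : 0 ≤ γ) (s : Fin N) (y : Sys N) :
    ENNReal.ofReal (visitObs γ s y).1 = totalUntil successSet (fun r => ENNReal.ofReal r.1.1)
      (history (attemptObs γ s) (attemptNext γ s) y) := by
  simp only [visitObs, visitStats, totalUntil]
  exact ENNReal.ofReal_sum_of_nonneg fun _ _ => attemptWait_nonneg hγ _ _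

lemma lintegral_erased (h : IsSysLaw Θ lamE lamD q μ ν β) :
    ∫⁻ b, (if b 0 = true then 1 else 0 : ℝ≥0∞) ∂β = ENNReal.ofReal q := by
  have ms : MeasurableSet {b : ℕ → Bool | b 0 = true} :=
    measurableSet_eq_fun (measurable_pi_apply 0) measurable_const
  rw [← h.erased_true, ← lintegral_indicator_one ms]
  refine lintegral_congr fun b => ?_
  by_cases hb : b 0 = true
  · rw [Set.indicator_of_mem (s := {b : ℕ → Bool | b 0 = true}) hb, if_pos hb]
    rfl
  · rw [Set.indicator_of_notMem (s := {b : ℕ → Bool | b 0 = true}) hb, if_neg hb]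

lemma lintegral_not_erased (h : IsSysLaw Θ lamE lamD q μ ν β) (hq0 : 0 ≤ q) :
    ∫⁻ b, (if b 0 = false then 1 else 0 : ℝ≥0∞) ∂β = ENNReal.ofReal (1 - q) := by
  have := h.prob
  have ms : MeasurableSet {b : ℕ → Bool | b 0 = true} :=
    measurableSet_eq_fun (measurable_pi_apply 0) measurable_const
  have e := prob_compl_eq_one_sub (μ := β) ms
  rw [h.erased_true] at e
  rw [ENNReal.ofReal_sub _ hq0, ENNReal.ofReal_one, ← e, ← lintegral_indicator_one ms.compl]
  refine lintegral_congr fun b => ?_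
  by_cases hb : b 0 = true
  · rw [Set.indicator_of_notMem (not_not.2 hb), if_neg (by simp [hb])]
  · rw [Set.indicator_of_mem hb, if_pos (by simpa using hb)]
    rfl

/-- The moments of the statistics of a visit. -/
lemma visit_moments (h : IsSysLaw Θ lamE lamD q μ ν β) (hE : 0 < lamE) (hD : ∀ j, 0 < lamD j)
    (hq0 : 0 ≤ q) (hq : q < 1) (hγ : 0 ≤ γ) (s : Fin N) :
    MemLp (fun y => (visitObs γ s y).1) 2 Θ ∧ MemLp (fun y => (visitObs γ s y).2.1) 2 Θ ∧
    MemLp (fun y => (visitObs γ s y).2.2) 2 Θ ∧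
    ∫ y, (visitObs γ s y).1 ∂Θ = visitMean q (waitMoment₁ lamE (lamD s) γ) ∧
    ∫ y, (visitObs γ s y).1 ^ 2 ∂Θ =
      visitSecond q (waitMoment₁ lamE (lamD s) γ) (waitMoment₂ lamE (lamD s) γ) ∧
    ∫ y, (visitObs γ s y).2.1 ∂Θ = meanStartAge lamE (lamD s) γ ∧
    ∫ y, (visitObs γ s y).2.2 ∂Θ = waitMoment₁ lamE (lamD s) γ ∧
    ∫ y, (visitObs γ s y).2.2 ^ 2 ∂Θ = waitMoment₂ lamE (lamD s) γ ∧
    0 < waitMoment₁ lamE (lamD s) γ := by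
  have := h.isProbabilityMeasure
  have hreg := h.attempt hE hD hγ s
  have hhit := h.ae_hit (γ := γ) hE hD hq s
  have hmv := (h.visit hE hD hq hγ s).measurable_obs
  have m1 : Measurable fun y => (visitObs γ s y).1 := hmv.fst
  have m2 : Measurable fun y => (visitObs γ s y).2.1 := hmv.snd.fst
  have m3 : Measurable fun y => (visitObs γ s y).2.2 := hmv.snd.snd
  obtain ⟨p1, e1⟩ := lintegral_attemptWait h.energy (h.data s) hE (hD s) hγ
  obtain ⟨p2, e2⟩ := lintegral_attemptWait_sq h.energy (h.data s) hE (hD s) hγ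
  obtain ⟨p3, e3⟩ := lintegral_attemptAge h.energy (h.data s) hE (hD s) hγ
  set w₁ := waitMoment₁ lamE (lamD s) γ
  set w₂ := waitMoment₂ lamE (lamD s) γ
  set δ := meanStartAge lamE (lamD s) γ
  have mobs := hreg.measurable_obs
  set w : (ℝ × ℝ) × Bool → ℝ≥0∞ := fun r => ENNReal.ofReal r.1.1 with hw
  have mw : Measurable w := by fun_prop
  set g : (ℝ × ℝ) × Bool → ℝ≥0∞ := fun r => ENNReal.ofReal r.1.2 with hg
  have mg : Measurable g := by fun_prop
  have mb : ∀ v : Bool, Measurable fun b : Bool => (if b = v then 1 else 0 : ℝ≥0∞) :=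
    fun v => measurable_of_countable _
  have memS : ∀ y, attemptObs γ s y ∈ successSet ↔ y.2.2 0 = false := fun y => Iff.rfl
  have f1 : ∫⁻ y, w (attemptObs γ s y) ∂Θ = ENNReal.ofReal w₁ :=
    (h.lintegral_attempt s (F := fun p => ENNReal.ofReal (attemptWait γ p.1 p.2))
      (by fun_prop)).trans e1
  have f2 : ∫⁻ y, w (attemptObs γ s y) ^ 2 ∂Θ = ENNReal.ofReal w₂ := by
    rw [← e2, ← h.lintegral_attempt s (F := fun p => ENNReal.ofReal (attemptWait γ p.1 p.2 ^ 2))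
      (by fun_prop)]
    exact lintegral_congr fun y => (ENNReal.ofReal_pow (attemptWait_nonneg hγ _ _) 2).symm
  have f3 : ∫⁻ y, successSetᶜ.indicator w (attemptObs γ s y) ∂Θ =
      ENNReal.ofReal w₁ * ENNReal.ofReal q := by
    rw [← e1, ← h.lintegral_erased, ← h.lintegral_attempt_mul s
      (F := fun p => ENNReal.ofReal (attemptWait γ p.1 p.2)) (by fun_prop) (mb true)]
    refine lintegral_congr fun y => ?_
    by_cases hb : y.2.2 0 = true
    · rw [Set.indicator_of_mem (fun h' => by simp [(memS y).1 h'] at hb), if_pos hb, mul_one]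
      rfl
    · rw [Set.indicator_of_notMem (not_not.2 ((memS y).2 (by simpa using hb))), if_neg hb, mul_zero]
  have f4 : ∫⁻ y, successSet.indicator g (attemptObs γ s y) ∂Θ =
      ENNReal.ofReal δ * ENNReal.ofReal (1 - q) := by
    rw [← e3, ← h.lintegral_not_erased hq0, ← h.lintegral_attempt_mul s
      (F := fun p => ENNReal.ofReal (attemptAge γ p.1 p.2)) (by fun_prop) (mb false)]
    refine lintegral_congr fun y => ?_
    by_cases hb : y.2.2 0 = false
    · rw [Set.indicator_of_mem ((memS y).2 hb), if_pos hb, mul_one]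
      rfl
    · rw [Set.indicator_of_notMem (mt (memS y).1 hb), if_neg hb, mul_zero]
  have f5 : Θ {y | attemptObs γ s y ∉ successSet} = ENNReal.ofReal q := by
    have ms : MeasurableSet {y | attemptObs γ s y ∉ successSet} :=
      mobs measurableSet_successSet.compl
    have := h.prob
    have := h.energy.prob
    have := (h.data s).prob
    rw [← lintegral_indicator_one ms, ← h.lintegral_erased]
    have := h.lintegral_attempt_mul s (F := fun _ => 1) measurable_const (mb true)
    simp only [one_mul, lintegral_const, measure_univ] at this
    rw [← this]
    refine lintegral_congr fun y => ?_
    by_cases hb : y.2.2 0 = true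
    · rw [Set.indicator_of_mem (show attemptObs γ s y ∉ successSet from
        fun h' => by simp [(memS y).1 h'] at hb), if_pos hb]
      rfl
    · rw [Set.indicator_of_notMem (not_not.2 ((memS y).2 (by simpa using hb))), if_neg hb]
  have hq1 : Θ {y | attemptObs γ s y ∉ successSet} < 1 := by
    rw [f5]; exact ENNReal.ofReal_lt_one.2 hq
  set V : Sys N → ℝ≥0∞ := fun y => totalUntil successSet w
    (history (attemptObs γ s) (attemptNext γ s) y) with hV
  have mV : Measurable V := (measurable_totalUntil measurableSet_successSet mw).comp
    hreg.measurable_history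
  have hVeq : ∀ y, ENNReal.ofReal (visitObs γ s y).1 = V y := ofReal_visitLength hγ s
  have hVsq : ∀ y, ENNReal.ofReal ((visitObs γ s y).1 ^ 2) = V y ^ 2 := fun y => by
    rw [ENNReal.ofReal_pow (visitLength_nonneg hγ s y), hVeq]
  -- Finiteness comes first; the linear equations below for the moments of `V` can then be solved.
  have fin2 : ∫⁻ y, V y ^ 2 ∂Θ ≠ ∞ := hreg.lintegral_totalUntil_sq_ne_top measurableSet_successSet
    hhit hq1 mw (by rw [f1]; exact ENNReal.ofReal_ne_top) (by rw [f2]; exact ENNReal.ofReal_ne_top)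
  have L1 : MemLp (fun y => (visitObs γ s y).1) 2 Θ :=
    memLp_two_of_lintegral_ofReal m1 (by simpa only [hVsq] using fin2)
  have hage := h.ae_age hE hD hq hγ s
  have L2 : MemLp (fun y => (visitObs γ s y).2.1) 2 Θ := L1.mono' m2.aestronglyMeasurable (by
    filter_upwards [hage] with y hy
    rw [Real.norm_of_nonneg hy.1]
    exact hy.2)
  have L3 : MemLp (fun y => (visitObs γ s y).2.2) 2 Θ := by
    refine memLp_two_of_lintegral_ofReal m3 (ne_of_eq_of_ne ?_ (ENNReal.ofReal_ne_top (r := w₂)))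
    rw [← f2]
    exact lintegral_congr fun y => ENNReal.ofReal_pow (attemptWait_nonneg hγ _ _) 2
  have fin1 : ∫⁻ y, V y ∂Θ ≠ ∞ := by
    have := (L1.integrable one_le_two).2
    rw [hasFiniteIntegral_iff_ofReal (.of_forall fun y => visitLength_nonneg hγ s y)] at this
    simpa only [hVeq] using this.ne
  have v1 : ∫⁻ y, V y ∂Θ = ENNReal.ofReal (visitMean q w₁) := by
    refine eq_div_of_eq_add_mul p1 hq0 hq fin1 ?_
    have := hreg.lintegral_totalUntil measurableSet_successSet hhit mw
    rwa [f1, f5] at this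
  have pm : 0 ≤ visitMean q w₁ := div_nonneg p1 (by linarith)
  have v2 : ∫⁻ y, V y ^ 2 ∂Θ = ENNReal.ofReal (visitSecond q w₁ w₂) := by
    refine eq_div_of_eq_add_mul (by positivity) hq0 hq fin2 ?_
    have := hreg.lintegral_totalUntil_sq measurableSet_successSet hhit mw
    rw [f2, f3, f5] at this
    change ∫⁻ y, V y ^ 2 ∂Θ = ENNReal.ofReal w₂ + 2 * (ENNReal.ofReal w₁ * ENNReal.ofReal q) *
      ∫⁻ y, V y ∂Θ + ENNReal.ofReal q * ∫⁻ y, V y ^ 2 ∂Θ at this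
    rw [v1] at this
    conv_lhs => rw [this]
    congr 1
    rw [ENNReal.ofReal_add p2 (by positivity), ENNReal.ofReal_mul (by positivity),
      ENNReal.ofReal_mul (by positivity), ENNReal.ofReal_mul (by positivity)]
    simp only [ENNReal.ofReal_ofNat]
    ring
  set A : Sys N → ℝ≥0∞ := fun y => valueAt successSet g
    (history (attemptObs γ s) (attemptNext γ s) y) with hA
  have hAeq : ∀ y, ENNReal.ofReal (visitObs γ s y).2.1 = A y := fun y => rfl
  have finA : ∫⁻ y, A y ∂Θ ≠ ∞ := by
    refine ne_top_of_le_ne_top fin1 (lintegral_mono_ae ?_)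
    filter_upwards [hage] with y hy
    rw [← hAeq, ← hVeq]
    exact ENNReal.ofReal_le_ofReal hy.2
  -- The equation is `x = δ * (1 - q) + q * x`, so `x = δ`: being delivered tells nothing about the
  -- age of a packet.
  have v3 : ∫⁻ y, A y ∂Θ = ENNReal.ofReal δ := by
    have h1q : 0 ≤ 1 - q := by linarith
    have h1q' : 1 - q ≠ 0 := by linarith
    have := hreg.lintegral_valueAt measurableSet_successSet hhit mg
    rw [f4, f5, ← ENNReal.ofReal_mul p3] at this
    have := eq_div_of_eq_add_mul (by positivity) hq0 hq finA this
    rwa [mul_div_cancel_right₀ _ h1q'] at this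
  -- A vanishing mean would make the waiting time `0` almost surely, whereas it is at least the
  -- positive time to the next energy arrival.
  have hpos : 0 < w₁ := by
    refine lt_of_le_of_ne p1 fun h0 => ?_
    rw [← h0, ENNReal.ofReal_zero, lintegral_eq_zero_iff (by fun_prop)] at f1
    have hfalse : ∀ᵐ y ∂Θ, False := by
      filter_upwards [f1, h.ae_good hE hD hq] with y hy hgood
      have h1 : attemptWait γ y.1 (y.2.1 s) ≤ 0 := ENNReal.ofReal_eq_zero.1 hy
      exact absurd (GoodPath.attemptWait_pos (γ := γ) (b := y.2.1 s) hgood.1) (not_lt.2 h1)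
    exact IsProbabilityMeasure.ne_zero Θ (by simpa using hfalse)
  refine ⟨L1, L2, L3, ?_, ?_, ?_, ?_, ?_, hpos⟩
  · refine integral_eq_of_lintegral_ofReal m1 (.of_forall (visitLength_nonneg hγ s)) pm ?_
    simpa only [hVeq] using v1
  · refine integral_eq_of_lintegral_ofReal (m1.pow_const 2) (.of_forall fun _ => sq_nonneg _)
      (div_nonneg (by positivity) (by linarith)) ?_
    simpa only [hVsq] using v2
  · refine integral_eq_of_lintegral_ofReal m2 ?_ p3 v3
    filter_upwards [hage] with y hy using hy.1
  · exact integral_eq_of_lintegral_ofReal m3 (.of_forall fun _ => attemptWait_nonneg hγ _ _) p1 f1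
  · refine integral_eq_of_lintegral_ofReal (m3.pow_const 2) (.of_forall fun _ => sq_nonneg _) p2 ?_
    rw [← f2]
    exact lintegral_congr fun y => ENNReal.ofReal_pow (attemptWait_nonneg hγ _ _) 2

variable [NeZero N]

lemma measurePreserving_visitSys (h : IsSysLaw Θ lamE lamD q μ ν β) (hE : 0 < lamE)
    (hD : ∀ j, 0 < lamD j) (hq : q < 1) (hγ : 0 ≤ γ) (v : ℕ) :
    MeasurePreserving (fun y => visitSys γ y v) Θ Θ := by
  have := h.isProbabilityMeasure
  induction v with
  | zero => exact .id Θ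
  | succ v ih => exact (h.visit hE hD hq hγ (src N v)).measurePreserving.comp ih

/-- All later visits are functions of the system at the start of visit `u`. Independence of one
visit from the system right after it thus extends to every later visit. -/
lemma exists_visitSys_eq (h : IsSysLaw Θ lamE lamD q μ ν β) (hE : 0 < lamE)
    (hD : ∀ j, 0 < lamD j) (hq : q < 1) (hγ : 0 ≤ γ) (u m : ℕ) :
    ∃ G : Sys N → Sys N, Measurable G ∧
      ∀ y, visitSys γ y (u + m) = G (visitSys γ y u) := by
  induction m with
  | zero => exact ⟨id, measurable_id, fun _ => rfl⟩
  | succ m ih =>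
    obtain ⟨G, hG, e⟩ := ih
    refine ⟨visitNext γ (src N (u + m)) ∘ G,
      (h.visit hE hD hq hγ (src N (u + m))).measurable_map.comp hG, fun y => ?_⟩
    rw [← add_assoc, visitSys, e]
    rfl

/-- The statistics of different visits are independent. -/
lemma indepFun_visit (h : IsSysLaw Θ lamE lamD q μ ν β) (hE : 0 < lamE)
    (hD : ∀ j, 0 < lamD j) (hq : q < 1) (hγ : 0 ≤ γ) {u v : ℕ} (huv : u < v) :
    IndepFun (fun y => visitObs γ (src N u) (visitSys γ y u))
      (fun y => visitObs γ (src N v) (visitSys γ y v)) Θ := by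
  have := h.isProbabilityMeasure
  obtain ⟨m, rfl⟩ := Nat.exists_eq_add_of_lt huv
  obtain ⟨G, hG, e⟩ := h.exists_visitSys_eq (γ := γ) hE hD hq hγ (u + 1) m
  have hreg := h.visit hE hD hq hγ (src N u)
  have hT := h.measurePreserving_visitSys (γ := γ) hE hD hq hγ u
  have hind : IndepFun (fun y => visitObs γ (src N u) (visitSys γ y u))
      (fun y => visitNext γ (src N u) (visitSys γ y u)) Θ := by
    have ma : Measurable fun y => visitObs γ (src N u) (visitSys γ y u) :=
      hreg.measurable_obs.comp hT.measurable
    have mb : Measurable fun y => visitNext γ (src N u) (visitSys γ y u) :=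
      hreg.measurable_map.comp hT.measurable
    rw [indepFun_iff_map_prod_eq_prod_map_map ma.aemeasurable mb.aemeasurable]
    -- The system at the start of visit `u` has law `Θ` again, so the joint law of what the visit
    -- shows and leaves behind is the one obtained from a system started in `Θ`.
    have c1 : Θ.map (fun y => (visitObs γ (src N u) (visitSys γ y u),
        visitNext γ (src N u) (visitSys γ y u))) =
        Θ.map (fun y => (visitObs γ (src N u) y, visitNext γ (src N u) y)) := by
      conv_rhs => rw [← hT.map_eq]
      rw [Measure.map_map (hreg.measurable_obs.prodMk hreg.measurable_map) hT.measurable]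
      rfl
    have c2 : Θ.map (fun y => visitObs γ (src N u) (visitSys γ y u)) =
        Θ.map (visitObs γ (src N u)) := by
      conv_rhs => rw [← hT.map_eq]
      rw [Measure.map_map hreg.measurable_obs hT.measurable]
      rfl
    have c3 : Θ.map (fun y => visitNext γ (src N u) (visitSys γ y u)) = Θ :=
      (hreg.measurePreserving.comp hT).map_eq
    rw [c1, c2, c3, hreg.map_prod]
  have hc := hind.comp (φ := id) measurable_id
    (((h.visit hE hD hq hγ (src N (u + m + 1))).measurable_obs).comp hG)
  have he : (fun y => visitObs γ (src N (u + m + 1)) (visitSys γ y (u + m + 1))) =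
      (visitObs γ (src N (u + m + 1)) ∘ G) ∘ fun y => visitNext γ (src N u) (visitSys γ y u) := by
    funext y
    have e' := e y
    rw [show u + 1 + m = u + m + 1 by ring] at e'
    rw [e']
    rfl
  rw [he]
  exact hc

end IsSysLaw

/-! ### Moments of a round -/

/-- Any `N` consecutive visits serve each source exactly once, wherever the round begins. -/
lemma sum_round {N : ℕ} [NeZero N] (f : Fin N → ℝ) (c : ℕ) :
    ∑ u ∈ Finset.Ico c (c + N), f (src N u) = ∑ κ, f κ := by
  induction c with
  | zero =>
    rw [zero_add, ← Finset.range_eq_Ico, Finset.sum_range]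
    refine Finset.sum_congr rfl fun κ _ => ?_
    rw [show src N κ = κ by simpa using src_add_mul κ 0]
  | succ c ih =>
    have hN := NeZero.pos N
    have hper : src N (c + N) = src N c := by simp [src]
    rw [← ih, Finset.sum_eq_sum_Ico_succ_bot (by omega : c < c + N), add_right_comm,
      Finset.sum_Ico_succ_top (by omega), hper, add_comm]

lemma sum_sq_eq {ι : Type*} [Fintype ι] [LinearOrder ι] [LocallyFiniteOrderBot ι] (m : ι → ℝ) :
    (∑ κ, m κ) ^ 2 = ∑ κ, m κ ^ 2 + 2 * ∑ α, ∑ β ∈ Finset.Iio α, m α * m β := by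
  classical
  have h1 : ∑ α, ∑ β ∈ Finset.univ.filter (fun β => α < β), m α * m β =
      ∑ α, ∑ β ∈ Finset.Iio α, m α * m β := by
    rw [Finset.sum_comm' (t' := Finset.univ) (s' := fun β => Finset.Iio β) (by simp)]
    exact Finset.sum_congr rfl fun α _ => Finset.sum_congr rfl fun β _ => mul_comm _ _
  have h2 : ∀ α, ∑ β, m α * m β = m α ^ 2 + ∑ β ∈ Finset.Iio α, m α * m β +
      ∑ β ∈ Finset.univ.filter (fun β => α < β), m α * m β := by
    intro α
    rw [← Finset.sum_filter_add_sum_filter_not _ (fun β => α < β), add_comm]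
    congr 1
    have : Finset.univ.filter (fun β => ¬ α < β) = insert α (Finset.Iio α) := by
      ext β
      simp [le_iff_eq_or_lt]
    rw [this, Finset.sum_insert (by simp), sq]
  rw [sq, Finset.sum_mul_sum]
  simp_rw [h2]
  rw [Finset.sum_add_distrib, Finset.sum_add_distrib, h1]
  ring

namespace IsSysLaw

variable {N : ℕ} [NeZero N] {Θ : Measure (Sys N)} {lamE : ℝ} {lamD : Fin N → ℝ} {q : ℝ}
    {μ : Measure (ℕ → ℝ)} {ν : Fin N → Measure (ℕ → ℝ)} {β : Measure (ℕ → Bool)} {γ : ℝ}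

/-- The moments of the statistics of visit number `v`. -/
lemma visit_moments_at (h : IsSysLaw Θ lamE lamD q μ ν β) (hE : 0 < lamE) (hD : ∀ j, 0 < lamD j)
    (hq0 : 0 ≤ q) (hq : q < 1) (hγ : 0 ≤ γ) (v : ℕ) :
    MemLp (visitLength γ v) 2 Θ ∧ MemLp (visitAge γ v) 2 Θ ∧ MemLp (visitWait γ v) 2 Θ ∧
    ∫ y, visitLength γ v y ∂Θ = visitMean q (waitMoment₁ lamE (lamD (src N v)) γ) ∧
    ∫ y, visitLength γ v y ^ 2 ∂Θ = visitSecond q (waitMoment₁ lamE (lamD (src N v)) γ)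
      (waitMoment₂ lamE (lamD (src N v)) γ) ∧
    ∫ y, visitAge γ v y ∂Θ = meanStartAge lamE (lamD (src N v)) γ ∧
    ∫ y, visitWait γ v y ∂Θ = waitMoment₁ lamE (lamD (src N v)) γ ∧
    ∫ y, visitWait γ v y ^ 2 ∂Θ = waitMoment₂ lamE (lamD (src N v)) γ := by
  have hT := h.measurePreserving_visitSys (γ := γ) hE hD hq hγ v
  obtain ⟨a1, a2, a3, a4, a5, a6, a7, a8, -⟩ := h.visit_moments hE hD hq0 hq hγ (src N v)
  have key : ∀ f : Sys N → ℝ, AEStronglyMeasurable f Θ →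
      ∫ y, f (visitSys γ y v) ∂Θ = ∫ y, f y ∂Θ := fun f hf => by
    conv_rhs => rw [← hT.map_eq]
    rw [integral_map hT.measurable.aemeasurable (by rwa [hT.map_eq])]
  refine ⟨a1.comp_measurePreserving hT, a2.comp_measurePreserving hT,
    a3.comp_measurePreserving hT, ?_, ?_, ?_, ?_, ?_⟩
  · exact (key _ a1.1).trans a4
  · exact (key _ (a1.1.pow 2)).trans a5
  · exact (key _ a2.1).trans a6
  · exact (key _ a3.1).trans a7
  · exact (key _ (a3.1.pow 2)).trans a8

/-- The first two moments of the duration of the visits of one round, and its correlation with the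
age of the packet delivered just before. -/
lemma round_moments (h : IsSysLaw Θ lamE lamD q μ ν β) (hE : 0 < lamE) (hD : ∀ j, 0 < lamD j)
    (hq0 : 0 ≤ q) (hq : q < 1) (hγ : 0 ≤ γ) (v : ℕ) :
    ∫ y, ∑ u ∈ Finset.Ico (v + 1) (v + 1 + N), visitLength γ u y ∂Θ =
      ∑ κ, visitMean q (waitMoment₁ lamE (lamD κ) γ) ∧
    ∫ y, (∑ u ∈ Finset.Ico (v + 1) (v + 1 + N), visitLength γ u y) ^ 2 ∂Θ =
      ∑ κ, (visitSecond q (waitMoment₁ lamE (lamD κ) γ) (waitMoment₂ lamE (lamD κ) γ) -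
        visitMean q (waitMoment₁ lamE (lamD κ) γ) ^ 2) +
      (∑ κ, visitMean q (waitMoment₁ lamE (lamD κ) γ)) ^ 2 ∧
    ∫ y, visitAge γ v y * ∑ u ∈ Finset.Ico (v + 1) (v + 1 + N), visitLength γ u y ∂Θ =
      meanStartAge lamE (lamD (src N v)) γ * ∑ κ, visitMean q (waitMoment₁ lamE (lamD κ) γ) := by
  have := h.isProbabilityMeasure
  have hm := h.visit_moments_at (γ := γ) hE hD hq0 hq hγ
  set x : Fin N → ℝ := fun κ => visitMean q (waitMoment₁ lamE (lamD κ) γ) with hx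
  set z : Fin N → ℝ := fun κ => visitSecond q (waitMoment₁ lamE (lamD κ) γ)
    (waitMoment₂ lamE (lamD κ) γ) with hz
  have m1 : Measurable fun r : ℝ × ℝ × ℝ => r.1 := measurable_fst
  have m2 : Measurable fun r : ℝ × ℝ × ℝ => r.2.1 := by fun_prop
  have hind : ∀ {u w : ℕ}, u < w → IndepFun (visitLength γ u) (visitLength γ w) Θ := fun huw =>
    (h.indepFun_visit hE hD hq hγ huw).comp m1 m1
  have hint : ∀ u, Integrable (visitLength γ u) Θ := fun u => (hm u).1.integrable (by norm_num)
  set s := Finset.Ico (v + 1) (v + 1 + N) with hs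
  have e1 : ∫ y, ∑ u ∈ s, visitLength γ u y ∂Θ = ∑ κ, x κ := by
    rw [integral_finsetSum _ fun u _ => hint u, ← sum_round x (v + 1)]
    exact Finset.sum_congr rfl fun u _ => (hm u).2.2.2.1
  have hL : MemLp (∑ u ∈ s, visitLength γ u) 2 Θ := memLp_finsetSum' _ fun u _ => (hm u).1
  refine ⟨e1, ?_, ?_⟩
  -- The second moment is the variance plus the squared mean; variances add up under pairwise
  -- independence, so no joint independence of the visits is needed.
  · have hv := IndepFun.variance_sum (s := s) (fun u _ => (hm u).1) (fun u _ w _ huw => by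
      rcases lt_or_gt_of_ne huw with h' | h'
      · exact hind h'
      · exact (hind h').symm)
    rw [variance_eq_sub hL] at hv
    have e2 : ∀ u, variance (visitLength γ u) Θ = z (src N u) - x (src N u) ^ 2 := fun u => by
      rw [variance_eq_sub (hm u).1, (hm u).2.2.2.1]
      congr 1
      exact (hm u).2.2.2.2.1
    simp only [e2, sum_round (fun κ => z κ - x κ ^ 2) (v + 1), hs] at hv
    rw [← hs] at hv
    simp only [Pi.pow_apply, Finset.sum_apply, e1] at hv
    linarith
  · simp only [Finset.mul_sum]
    have hprod : ∀ u ∈ s, Integrable (fun y => visitAge γ v y * visitLength γ u y) Θ :=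
      fun u _ => (hm v).2.1.integrable_mul (hm u).1
    rw [integral_finsetSum _ hprod, ← Finset.mul_sum, ← sum_round x (v + 1), Finset.mul_sum]
    refine Finset.sum_congr rfl fun u hu => ?_
    have huv : v < u := (Finset.mem_Ico.1 hu).1
    have hi : IndepFun (visitAge γ v) (visitLength γ u) Θ :=
      (h.indepFun_visit hE hD hq hγ huv).comp m2 m1
    rw [← (hm v).2.2.2.2.2.1]
    refine (hi.integral_mul_eq_mul_integral (hm v).2.1.1 (hm u).1.1).trans ?_
    rw [(hm u).2.2.2.1]

end IsSysLaw

/-! ### The law of the system -/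

section Model

variable {N : ℕ} {Ω : Type*} [MeasurableSpace Ω] {P : Measure Ω}
  {X : Ω → Path N} {lamE : ℝ} {lamD : Fin N → ℝ} {q γ : ℝ}

namespace IsModel

lemma measurable_energy (hX : IsModel P X lamE lamD q) : Measurable fun ω => (X ω).energy :=
  measurable_pi_lambda _ hX.energy_poisson.measurable

lemma measurable_data (hX : IsModel P X lamE lamD q) (j : Fin N) :
    Measurable fun ω => (X ω).data j :=
  measurable_pi_lambda _ (hX.data_poisson j).measurable

lemma measurable_erased (hX : IsModel P X lamE lamD q) : Measurable fun ω => (X ω).erased :=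
  measurable_pi_lambda _ hX.erased_measurable

lemma measurable_toSys (hX : IsModel P X lamE lamD q) : Measurable fun ω => (X ω).toSys :=
  hX.measurable_energy.prodMk
    ((measurable_pi_lambda _ hX.measurable_data).prodMk hX.measurable_erased)

lemma measurePreserving_toSys (hX : IsModel P X lamE lamD q) :
    MeasurePreserving (fun ω => (X ω).toSys) P (P.map fun ω => (X ω).toSys) :=
  ⟨hX.measurable_toSys, rfl⟩

lemma integral_toSys (hX : IsModel P X lamE lamD q) {f : Sys N → ℝ}
    (hf : AEStronglyMeasurable f (P.map fun ω => (X ω).toSys)) :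
    ∫ ω, f (X ω).toSys ∂P = ∫ y, f y ∂(P.map fun ω => (X ω).toSys) :=
  (integral_map hX.measurable_toSys.aemeasurable hf).symm

lemma map_erased [IsProbabilityMeasure P] (hX : IsModel P X lamE lamD q) (k : ℕ) :
    P.map (fun ω => (X ω).erased k) = P.map (fun ω => (X ω).erased 0) := by
  have ht : ∀ k, P.map (fun ω => (X ω).erased k) {true} = ENNReal.ofReal q := fun k => by
    rw [Measure.map_apply (hX.erased_measurable k) (measurableSet_singleton _)]
    exact hX.erased_prob k
  have hp : ∀ k, IsProbabilityMeasure (P.map fun ω => (X ω).erased k) := fun k =>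
    Measure.isProbabilityMeasure_map (hX.erased_measurable k).aemeasurable
  refine Measure.ext_of_singleton fun b => ?_
  cases b with
  | true => rw [ht, ht]
  | false =>
    rw [show ({false} : Set Bool) = {true}ᶜ by ext b; simp,
      prob_compl_eq_one_sub (measurableSet_singleton _),
      prob_compl_eq_one_sub (measurableSet_singleton _), ht, ht]

lemma isSysLaw [IsProbabilityMeasure P] (hX : IsModel P X lamE lamD q) (hE : 0 < lamE) (hD : ∀ j, 0 < lamD j) :
    IsSysLaw (P.map fun ω => (X ω).toSys) lamE lamD q (P.map fun ω => (X ω).energy)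
      (fun j => P.map fun ω => (X ω).data j) (P.map fun ω => (X ω).erased) := by
  have mE := hX.measurable_energy
  have mD := hX.measurable_data
  have mD' : Measurable fun ω => (X ω).data := measurable_pi_lambda _ mD
  have mB := hX.measurable_erased
  have hp : ∀ k, IsProbabilityMeasure (P.map fun ω => (X ω).erased k) := fun k =>
    Measure.isProbabilityMeasure_map (hX.erased_measurable k).aemeasurable
  have hpE : IsProbabilityMeasure (P.map fun ω => (X ω).energy) :=
    Measure.isProbabilityMeasure_map mE.aemeasurable
  have hpD : ∀ j, IsProbabilityMeasure (P.map fun ω => (X ω).data j) := fun j =>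
    Measure.isProbabilityMeasure_map (mD j).aemeasurable
  have hpB : IsProbabilityMeasure (P.map fun ω => (X ω).erased) :=
    Measure.isProbabilityMeasure_map mB.aemeasurable
  have eD : P.map (fun ω => (X ω).data) = Measure.pi fun j => P.map fun ω => (X ω).data j :=
    (iIndepFun_iff_map_fun_eq_pi_map fun j => (mD j).aemeasurable).1 hX.data_indep
  have eED := (indepFun_iff_map_prod_eq_prod_map_map mE.aemeasurable mD'.aemeasurable).1
    hX.energy_indep_data
  have eEDB := (indepFun_iff_map_prod_eq_prod_map_map (mE.prodMk mD').aemeasurable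
    mB.aemeasurable).1 hX.arrivals_indep_erased
  rw [eED, eD] at eEDB
  have eB : P.map (fun ω => (X ω).erased) =
      Measure.infinitePi fun _ : ℕ => P.map fun ω => (X ω).erased 0 := by
    have := hX.erased_indep.map_fun_eq_infinitePi_map hX.erased_measurable
    simp only [hX.map_erased] at this
    exact this
  refine ⟨?_, hX.energy_poisson.isPoissonLaw hE, fun j => (hX.data_poisson j).isPoissonLaw (hD j),
    hpB, ?_, ?_⟩
  · rw [← Measure.prodAssoc_prod, ← eEDB,
      Measure.map_map MeasurableEquiv.prodAssoc.measurable ((mE.prodMk mD').prodMk mB)]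
    rfl
  · rw [eB]
    exact regenerative_infinitePi _
  · rw [Measure.map_apply mB (measurableSet_eq_fun (measurable_pi_apply 0) measurable_const)]
    exact hX.erased_prob 0

lemma ae_goodPath [IsProbabilityMeasure P] (hX : IsModel P X lamE lamD q) (hE : 0 < lamE) (hD : ∀ j, 0 < lamD j)
    (hq : q < 1) : ∀ᵐ ω ∂P, GoodPath (X ω) := by
  have h := hX.isSysLaw hE hD
  have := h.prob
  have h1 := ae_of_ae_map hX.measurable_energy.aemeasurable (h.energy.ae_good hE)
  have h2 := ae_all_iff.2 fun j =>
    ae_of_ae_map (hX.measurable_data j).aemeasurable ((h.data j).ae_good (hD j))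
  -- The shifted erasures have the same law, so almost surely there is a success after every index
  -- and not just one in all.
  have hT : ∀ (n : ℕ) (b : ℕ → Bool), (fun (b : ℕ → Bool) n => b (n + 1))^[n] b =
      fun k => b (k + n) := fun n => by
    induction n with
    | zero => exact fun b => rfl
    | succ n ih => exact fun b => by rw [Function.iterate_succ_apply, ih]; rfl
  have h3 := ae_all_iff.2 fun n =>
    ae_of_ae_map hX.measurable_erased.aemeasurable
      ((h.erased.measurePreserving.iterate n).quasiMeasurePreserving.ae
        (ae_exists_false h.erased (by
          rw [h.erased_true]
          exact ENNReal.ofReal_lt_one.2 hq)))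
  filter_upwards [h1, h2, h3] with ω a b c
  refine ⟨a, b, fun n => ?_⟩
  obtain ⟨k, hk⟩ := c n
  rw [hT] at hk
  exact ⟨k + n, by omega, hk⟩

end IsModel

end Model

/-! ### Epochs -/

/-- The values are constant from index `2` on only: the first epoch of source `j` starts with age
`0` and has just `j + 1` visits. Its contribution disappears in the Cesàro means of numerator and
denominator. -/
lemma tendsto_sum_div_sum {f g : ℕ → ℝ} {A B : ℝ} (hB : B ≠ 0) (hf : ∀ i, f (i + 2) = A)
    (hg : ∀ i, g (i + 2) = B) :
    Tendsto (fun n => (∑ i ∈ Finset.Icc 1 n, f i) / ∑ i ∈ Finset.Icc 1 n, g i) atTop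
      (𝓝 (A / B)) := by
  have key : ∀ {u : ℕ → ℝ} {c : ℝ}, (∀ i, u (i + 2) = c) →
      Tendsto (fun n : ℕ => (n : ℝ)⁻¹ * ∑ i ∈ Finset.Icc 1 n, u i) atTop (𝓝 c) := by
    intro u c hu
    have hlim : Tendsto (fun i => u (i + 1)) atTop (𝓝 c) := by
      refine tendsto_const_nhds.congr' ?_
      filter_upwards [eventually_ge_atTop 1] with i hi
      obtain ⟨k, rfl⟩ := Nat.exists_eq_add_of_le' hi
      exact (hu k).symm
    refine hlim.cesaro.congr fun n => ?_
    rw [Finset.range_eq_Ico, Finset.sum_Ico_add' u 0 n 1]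
    rfl
  refine ((key hf).div (key hg) hB).congr' ?_
  filter_upwards [eventually_ne_atTop 0] with n hn
  exact mul_div_mul_left _ _ (inv_ne_zero (Nat.cast_ne_zero.2 hn))

/-- The mean duration of an epoch, in terms of the first moments of the waiting times. -/
noncomputable def epochMean {N : ℕ} (q : ℝ) (m : Fin N → ℝ) : ℝ := ∑ κ, visitMean q (m κ)

/-- The second moment of the duration of an epoch, in terms of the moments of the waiting times. -/
noncomputable def epochSecond {N : ℕ} (q : ℝ) (m m' : Fin N → ℝ) : ℝ :=
  ∑ κ, (visitSecond q (m κ) (m' κ) - visitMean q (m κ) ^ 2) + epochMean q m ^ 2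

/-- The variances contribute `(2 * q - 1) / (1 - q) ^ 2` times `∑ m²`, and the squared mean
contributes `1 / (1 - q) ^ 2` times `∑ m²` plus twice the mixed products. The sum of the
coefficients of `∑ m²` is `2 * q / (1 - q) ^ 2`, which explains the factor `q` in the formula. -/
lemma epochSecond_div {N : ℕ} {q : ℝ} (hq : q < 1) (m m' : Fin N → ℝ) (hm : 0 < ∑ κ, m κ) :
    epochSecond q m m' / (2 * epochMean q m) =
      (∑ κ, m' κ) / (2 * ∑ κ, m κ) + (q * ∑ κ, m κ ^ 2) / ((1 - q) * ∑ κ, m κ) +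
      (∑ α, ∑ β ∈ Finset.Iio α, m α * m β) / ((1 - q) * ∑ κ, m κ) := by
  have hq' : 1 - q ≠ 0 := by linarith
  have e1 : epochMean q m = (∑ κ, m κ) / (1 - q) := by
    simp only [epochMean, visitMean, Finset.sum_div]
  have e2 : ∑ κ, (visitSecond q (m κ) (m' κ) - visitMean q (m κ) ^ 2) =
      (∑ κ, m' κ) / (1 - q) + (2 * q - 1) / (1 - q) ^ 2 * ∑ κ, m κ ^ 2 := by
    rw [Finset.sum_div, Finset.mul_sum, ← Finset.sum_add_distrib]
    refine Finset.sum_congr rfl fun κ _ => ?_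
    simp only [visitSecond, visitMean]
    field_simp
    ring
  have e3 := sum_sq_eq m
  rw [epochSecond, e2, e1, div_pow, e3]
  set S := ∑ κ, m κ
  have hS : S ≠ 0 := hm.ne'
  field_simp
  ring

/-! ### Moments of epochs and convergence of the averages -/

namespace IsModel

variable {N : ℕ} [NeZero N] {Ω : Type*} [MeasurableSpace Ω] {P : Measure Ω}
  [IsProbabilityMeasure P] {X : Ω → Path N} {lamE : ℝ} {lamD : Fin N → ℝ} {q γ : ℝ}

section

variable (hX : IsModel P X lamE lamD q) (hE : 0 < lamE) (hD : ∀ j, 0 < lamD j) (hq0 : 0 ≤ q)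
  (hq : q < 1) (hγ : 0 ≤ γ)
include hX hE hD hq0 hq hγ

lemma memLp_startAge (j : Fin N) (i : ℕ) : MemLp (fun ω => startAge γ (X ω) j i) 2 P := by
  have h := hX.isSysLaw hE hD
  have hgood := hX.ae_goodPath hE hD hq
  cases i with
  | zero =>
    refine (MemLp.zero' (ε := ℝ)).ae_eq ?_
    filter_upwards [hgood] with ω hω using (hω.startAge_zero hγ j).symm
  | succ i =>
    refine ((h.visit_moments_at hE hD hq0 hq hγ (j + i * N)).2.1.comp_measurePreserving
      hX.measurePreserving_toSys).ae_eq ?_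
    filter_upwards [hgood] with ω hω using (hω.startAge_succ hγ j i).symm

lemma integral_startAge (j : Fin N) (i : ℕ) :
    ∫ ω, startAge γ (X ω) j (i + 1) ∂P = meanStartAge lamE (lamD j) γ := by
  have hm := (hX.isSysLaw hE hD).visit_moments_at hE hD hq0 hq hγ (j + i * N)
  rw [src_add_mul] at hm
  rw [← hm.2.2.2.2.2.1, ← hX.integral_toSys hm.2.1.1]
  refine integral_congr_ae ?_
  filter_upwards [hX.ae_goodPath hE hD hq] with ω hω using hω.startAge_succ hγ j i

lemma memLp_firstWait (j : Fin N) (i : ℕ) : MemLp (fun ω => firstWait γ (X ω) j (i + 1)) 2 P := by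
  have h := hX.isSysLaw hE hD
  refine ((h.visit_moments_at hE hD hq0 hq hγ (j + i * N)).2.2.1.comp_measurePreserving
      hX.measurePreserving_toSys).ae_eq ?_
  filter_upwards [hX.ae_goodPath hE hD hq] with ω hω using (hω.firstWait_eq hγ j i).symm

lemma integral_firstWait (j : Fin N) (i : ℕ) :
    ∫ ω, firstWait γ (X ω) j (i + 1) ∂P = waitMoment₁ lamE (lamD j) γ := by
  have hm := (hX.isSysLaw hE hD).visit_moments_at hE hD hq0 hq hγ (j + i * N)
  rw [src_add_mul] at hm
  rw [← hm.2.2.2.2.2.2.1, ← hX.integral_toSys hm.2.2.1.1]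
  refine integral_congr_ae ?_
  filter_upwards [hX.ae_goodPath hE hD hq] with ω hω using hω.firstWait_eq hγ j i

lemma integral_firstWait_sq (j : Fin N) (i : ℕ) :
    ∫ ω, firstWait γ (X ω) j (i + 1) ^ 2 ∂P = waitMoment₂ lamE (lamD j) γ := by
  have hm := (hX.isSysLaw hE hD).visit_moments_at hE hD hq0 hq hγ (j + i * N)
  rw [src_add_mul] at hm
  rw [← hm.2.2.2.2.2.2.2]
  refine (integral_congr_ae ?_).trans (hX.integral_toSys (hm.2.2.1.1.pow 2))
  filter_upwards [hX.ae_goodPath hE hD hq] with ω hω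
  rw [hω.firstWait_eq hγ j i]

lemma memLp_epochLength (j : Fin N) (i : ℕ) :
    MemLp (fun ω => epochLength γ (X ω) j (i + 1)) 2 P := by
  have h := hX.isSysLaw hE hD
  refine (MemLp.comp_measurePreserving (memLp_finsetSum
    (Finset.Ico (epochStart j i) (epochStart j (i + 1))) fun u _ =>
      (h.visit_moments_at hE hD hq0 hq hγ u).1)
      hX.measurePreserving_toSys).ae_eq ?_
  filter_upwards [hX.ae_goodPath hE hD hq] with ω hω using (hω.epochLength_eq hγ j i).symm

lemma integrable_startAge_mul_epochLength (j : Fin N) (i : ℕ) :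
    Integrable (fun ω => startAge γ (X ω) j i * epochLength γ (X ω) j (i + 1)) P :=
  (memLp_startAge hX hE hD hq0 hq hγ j i).integrable_mul
    (memLp_epochLength hX hE hD hq0 hq hγ j i)

lemma integrable_epochArea (j : Fin N) (i : ℕ) :
    Integrable (fun ω => epochArea γ (X ω) j (i + 1)) P := by
  refine ((integrable_startAge_mul_epochLength hX hE hD hq0 hq hγ j i).add
    ((memLp_epochLength hX hE hD hq0 hq hγ j i).integrable_sq.div_const 2)).congr ?_
  filter_upwards [hX.ae_goodPath hE hD hq] with ω hω using (hω.epochArea_eq hγ j i).symm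

lemma integral_epochLength (j : Fin N) (i : ℕ) :
    ∫ ω, epochLength γ (X ω) j (i + 2) ∂P = epochMean q fun κ => waitMoment₁ lamE (lamD κ) γ := by
  have h := hX.isSysLaw hE hD
  rw [epochMean, ← (h.round_moments hE hD hq0 hq hγ (j + i * N)).1,
    ← hX.integral_toSys
      (memLp_finsetSum _ fun u _ => (h.visit_moments_at hE hD hq0 hq hγ u).1).1]
  refine integral_congr_ae ?_
  filter_upwards [hX.ae_goodPath hE hD hq] with ω hω
  rw [hω.epochLength_eq hγ j (i + 1), epochStart, epochStart]
  congr 2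
  ring

/-- The area is `Δ L + L² / 2`. Here `Δ` is the age at the end of visit `j + i * N` and `L` is the
duration of the following round, so the mean of `Δ L` factorizes. -/
lemma integral_epochArea (j : Fin N) (i : ℕ) :
    ∫ ω, epochArea γ (X ω) j (i + 2) ∂P =
      meanStartAge lamE (lamD j) γ * (epochMean q fun κ => waitMoment₁ lamE (lamD κ) γ) +
      epochSecond q (fun κ => waitMoment₁ lamE (lamD κ) γ)
        (fun κ => waitMoment₂ lamE (lamD κ) γ) / 2 := by
  have h := hX.isSysLaw hE hD
  have hm := h.visit_moments_at hE hD hq0 hq hγ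
  obtain ⟨-, r2, r3⟩ := h.round_moments hE hD hq0 hq hγ (j + i * N)
  rw [src_add_mul] at r3
  have hgood := hX.ae_goodPath hE hD hq
  have hL := memLp_finsetSum (Finset.Ico (j + i * N + 1) (j + i * N + 1 + N))
    fun u _ => (hm u).1
  have eL : ∀ᵐ ω ∂P, epochLength γ (X ω) j (i + 2) =
      ∑ u ∈ Finset.Ico (j + i * N + 1) (j + i * N + 1 + N), visitLength γ u (X ω).toSys := by
    filter_upwards [hgood] with ω hω
    rw [hω.epochLength_eq hγ j (i + 1), epochStart, epochStart]
    congr 2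
    ring
  have e1 : ∫ ω, startAge γ (X ω) j (i + 1) * epochLength γ (X ω) j (i + 2) ∂P =
      meanStartAge lamE (lamD j) γ * (epochMean q fun κ => waitMoment₁ lamE (lamD κ) γ) := by
    rw [epochMean, ← r3]
    refine (integral_congr_ae ?_).trans (hX.integral_toSys ((hm _).2.1.1.mul hL.1))
    filter_upwards [hgood, eL] with ω hω hω'
    rw [hω', hω.startAge_succ hγ j i]
  have e2 : ∫ ω, epochLength γ (X ω) j (i + 2) ^ 2 ∂P =
      epochSecond q (fun κ => waitMoment₁ lamE (lamD κ) γ)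
        (fun κ => waitMoment₂ lamE (lamD κ) γ) := by
    rw [epochSecond, epochMean, ← r2]
    refine (integral_congr_ae ?_).trans (hX.integral_toSys (hL.1.pow 2))
    filter_upwards [eL] with ω hω'
    rw [hω']
  rw [← e1, ← e2, ← integral_div, ← integral_add
    (integrable_startAge_mul_epochLength hX hE hD hq0 hq hγ j (i + 1))
    ((memLp_epochLength hX hE hD hq0 hq hγ j (i + 1)).integrable_sq.div_const 2)]
  refine integral_congr_ae ?_
  filter_upwards [hgood] with ω hω using hω.epochArea_eq hγ j (i + 1)

omit [NeZero N] in
lemma waitMoment_pos (j : Fin N) : 0 < waitMoment₁ lamE (lamD j) γ :=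
  ((hX.isSysLaw hE hD).visit_moments hE hD hq0 hq hγ j).2.2.2.2.2.2.2.2

lemma tendsto_averageAoI (j : Fin N) :
    Tendsto (fun n => averageAoI P X γ j n) atTop (𝓝 (meanStartAge lamE (lamD j) γ +
      epochSecond q (fun κ => waitMoment₁ lamE (lamD κ) γ)
        (fun κ => waitMoment₂ lamE (lamD κ) γ) /
          (2 * epochMean q fun κ => waitMoment₁ lamE (lamD κ) γ))) := by
  have hpos : 0 < epochMean q fun κ => waitMoment₁ lamE (lamD κ) γ :=
    Finset.sum_pos (fun κ _ => div_pos (waitMoment_pos hX hE hD hq0 hq hγ κ) (by linarith))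
      Finset.univ_nonempty
  have := tendsto_sum_div_sum (f := fun i => ∫ ω, epochArea γ (X ω) j i ∂P)
    (g := fun i => ∫ ω, epochLength γ (X ω) j i ∂P) hpos.ne' (integral_epochArea hX hE hD hq0 hq hγ j)
    (integral_epochLength hX hE hD hq0 hq hγ j)
  rw [add_div, mul_div_cancel_right₀ _ hpos.ne', div_div] at this
  exact this

end

end IsModel

end StatusUpdate

theorem theorem1 {N : ℕ} [NeZero N] {Ω : Type*} [MeasurableSpace Ω]
    (P : Measure Ω) [IsProbabilityMeasure P] (X : Ω → Path N)
    (lamE : ℝ) (lamD : Fin N → ℝ) (q γ : ℝ)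
    (hE : 0 < lamE) (hD : ∀ j, 0 < lamD j) (hq₀ : 0 ≤ q) (hq₁ : q < 1) (hγ : 0 ≤ γ)
    (hX : IsModel P X lamE lamD q) :
    -- the expectations that define the long-term average age exist, and the averages converge
    (∀ j, ∀ i ≥ 1, Integrable (fun ω => epochArea γ (X ω) j i) P ∧
      Integrable (fun ω => epochLength γ (X ω) j i) P) ∧
    (∀ j, ∃ l : ℝ, Tendsto (fun n => averageAoI P X γ j n) atTop (𝓝 l)) ∧
    -- the collective long-term average age, through the expectations in any epoch `i ≥ 1`
    (∀ i ≥ 1, collectiveAoI P X γ =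
      (1 / (N : ℝ)) * ∑ j : Fin N, ∫ ω, startAge γ (X ω) j i ∂P
      + (∑ κ : Fin N, ∫ ω, firstWait γ (X ω) κ i ^ 2 ∂P)
          / (2 * ∑ κ : Fin N, ∫ ω, firstWait γ (X ω) κ i ∂P)
      + (q * ∑ κ : Fin N, (∫ ω, firstWait γ (X ω) κ i ∂P) ^ 2)
          / ((1 - q) * ∑ κ : Fin N, ∫ ω, firstWait γ (X ω) κ i ∂P)
      + (∑ α : Fin N, ∑ β ∈ Finset.Iio α,
            (∫ ω, firstWait γ (X ω) α i ∂P) * ∫ ω, firstWait γ (X ω) β i ∂P)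
          / ((1 - q) * ∑ κ : Fin N, ∫ ω, firstWait γ (X ω) κ i ∂P)) ∧
    -- closed forms of these expectations
    (∀ j, ∀ i ≥ 1,
      (Integrable (fun ω => startAge γ (X ω) j i) P ∧
        ∫ ω, startAge γ (X ω) j i ∂P = meanStartAge lamE (lamD j) γ) ∧
      (Integrable (fun ω => firstWait γ (X ω) j i) P ∧
        ∫ ω, firstWait γ (X ω) j i ∂P = waitMoment₁ lamE (lamD j) γ) ∧
      (Integrable (fun ω => firstWait γ (X ω) j i ^ 2) P ∧
        ∫ ω, firstWait γ (X ω) j i ^ 2 ∂P = waitMoment₂ lamE (lamD j) γ)) := by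
  have hage : ∀ j, ∀ i ≥ 1, ∫ ω, startAge γ (X ω) j i ∂P = meanStartAge lamE (lamD j) γ := by
    intro j i hi
    obtain ⟨i, rfl⟩ := Nat.exists_eq_add_of_le' hi
    exact hX.integral_startAge hE hD hq₀ hq₁ hγ j i
  have hwait : ∀ j, ∀ i ≥ 1, ∫ ω, firstWait γ (X ω) j i ∂P = waitMoment₁ lamE (lamD j) γ := by
    intro j i hi
    obtain ⟨i, rfl⟩ := Nat.exists_eq_add_of_le' hi
    exact hX.integral_firstWait hE hD hq₀ hq₁ hγ j i
  have hwait_sq : ∀ j, ∀ i ≥ 1,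
      ∫ ω, firstWait γ (X ω) j i ^ 2 ∂P = waitMoment₂ lamE (lamD j) γ := by
    intro j i hi
    obtain ⟨i, rfl⟩ := Nat.exists_eq_add_of_le' hi
    exact hX.integral_firstWait_sq hE hD hq₀ hq₁ hγ j i
  refine ⟨fun j i hi => ?_, fun j => ⟨_, hX.tendsto_averageAoI hE hD hq₀ hq₁ hγ j⟩,
    fun i hi => ?_, fun j i hi => ⟨⟨?_, hage j i hi⟩, ⟨?_, hwait j i hi⟩, ?_, hwait_sq j i hi⟩⟩
  · obtain ⟨i, rfl⟩ := Nat.exists_eq_add_of_le' hi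
    exact ⟨hX.integrable_epochArea hE hD hq₀ hq₁ hγ j i,
      (hX.memLp_epochLength hE hD hq₀ hq₁ hγ j i).integrable (by norm_num)⟩
  · have hpos : 0 < ∑ κ, waitMoment₁ lamE (lamD κ) γ :=
      Finset.sum_pos (fun κ _ => hX.waitMoment_pos hE hD hq₀ hq₁ hγ κ) Finset.univ_nonempty
    have hN : (N : ℝ) ≠ 0 := Nat.cast_ne_zero.2 (NeZero.ne N)
    -- Of the limit for source `j` only the mean starting age depends on `j`; the other summand is
    -- common to all sources and unchanged by averaging over them.
    simp only [collectiveAoI, (hX.tendsto_averageAoI hE hD hq₀ hq₁ hγ _).limsup_eq,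
      hage _ i hi, hwait _ i hi, hwait_sq _ i hi]
    rw [epochSecond_div hq₁ _ _ hpos, Finset.sum_add_distrib, Finset.sum_const, Finset.card_univ,
      Fintype.card_fin, nsmul_eq_mul, mul_add, ← mul_assoc, one_div, inv_mul_cancel₀ hN, one_mul]
    ring
  · exact (hX.memLp_startAge hE hD hq₀ hq₁ hγ j i).integrable (by norm_num)
  · obtain ⟨i, rfl⟩ := Nat.exists_eq_add_of_le' hi
    exact (hX.memLp_firstWait hE hD hq₀ hq₁ hγ j i).integrable (by norm_num)
  · obtain ⟨i, rfl⟩ := Nat.exists_eq_add_of_le' hi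
    exact (hX.memLp_firstWait hE hD hq₀ hq₁ hγ j i).integrable_sq
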